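/- **Setting.** Let $\mathsf G=(\mathsf V,\mathsf E)$ be a finite directed graph without loops, with lengths $\ell_{\mathsf e}>0$ and integers $k_{\mathsf e}\ge 1$; each edge $\mathsf e$ is identified with $[0,\ell_{\mathsf e}]$, $0$ being its initial and $\ell_{\mathsf e}$ its terminal endpoint. Let $\mathsf E_{\mathsf v}$ be the set of edges incident in $\mathsf v$, $k_{\mathsf v}=\sum_{\mathsf e\in\mathsf E_{\mathsf v}}k_{\mathsf e}$, and $\iota_{\mathsf v\mathsf e}=+1$ (resp. $-1$) if $\mathsf v$ is the terminal (resp. initial) endpoint of $\mathsf e$. For every $\mathsf e$ let $M_{\mathsf e},Q_{\mathsf e}:[0,\ell_{\mathsf e}]\to M_{k_{\mathsf e}}(\mathbb C)$ be Lipschitz continuous and $N_{\mathsf e}\in L^\infty(0,\ell_{\mathsf e};M_{k_{\mathsf e}}(\mathbb C))$, with $M_{\mathsf e}(x)$ invertible, $Q_{\mathsf e}(x)$ and $Q_{\mathsf e}(x)M_{\mathsf e}(x)$ Hermitian for all $x$, and $Q_{\mathsf e}$ uniformly positive definite on $[0,\ell_{\mathsf e}]$. For every $\mathsf v$ let $Y^{(d)}_{\mathsf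 v}\subset Y_{\mathsf v}$ be subspaces of $\mathbb C^{k_{\mathsf v}}$, let $B_{\mathsf v}:Y_{\mathsf v}\to Y_{\mathsf v}^{(d)}$, $C_{\mathsf v}:Y^{(d)}_{\mathsf v}\to Y^{(d)}_{\mathsf v}$ be linear, and let $Q_{\mathsf v}$ be a Hermitian positive definite operator on $Y_{\mathsf v}^{(d)}$. Let $B_{\mathsf v}^*:Y^{(d)}_{\mathsf v}\to Y_{\mathsf v}$ be the adjoint for the Euclidean inner products, $P^{(d)}_{\mathsf v}$ the orthogonal projector of $\mathbb C^{k_{\mathsf v}}$ onto $Y^{(d)}_{\mathsf v}$, $P^{(d),\perp}_{\mathsf v}$ the orthogonal projector of $\mathbb C^{k_{\mathsf v}}$ onto the orthogonal complement of $Y_{\mathsf v}^{(d)}$ in $Y_{\mathsf v}$, and $$T_{\mathsf v}=\operatorname{diag}\big(Q_{\mathsf e}(\mathsf v)M_{\mathsf e}(\mathsf v)\iota_{\mathsf v\mathsf e}\big)_{\mathsf e\in\mathsf E_{\mathsf v}},\qquad \mathbb Y^*_{\mathsf v}=\operatorname{Ker}\begin{pmatrix}P^{(d),\perp}_{\mathsf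 v}T_{\mathsf v}& P^{(d),\perp}_{\mathsf v}B^*_{\mathsf v}Q_{\mathsf v}\end{pmatrix}\subset\mathbb C^{k_{\mathsf v}}\oplus Y^{(d)}_{\mathsf v}.$$ Let $\mathbf L^2_d(\mathcal G)=\bigoplus_{\mathsf e}L^2(0,\ell_{\mathsf e})^{k_{\mathsf e}}\oplus\bigoplus_{\mathsf v}Y^{(d)}_{\mathsf v}$, with the inner product $$\big((u,\mathsf x),(v,\mathsf y)\big)_d=\sum_{\mathsf e}\int_0^{\ell_{\mathsf e}}Q_{\mathsf e}u_{\mathsf e}\cdot\bar v_{\mathsf e}\,dx+\sum_{\mathsf v}Q_{\mathsf v}\mathsf x_{\mathsf v}\cdot\bar{\mathsf y}_{\mathsf v},$$ which is equivalent to the canonical one. With $\gamma_{\mathsf v}(u)=(u_{\mathsf e}(\mathsf v))_{\mathsf e\in\mathsf E_{\mathsf v}}$, let $\mathbb A$ be the operator on $\mathbf L^2_d(\mathcal G)$ given by $$\mathbb A(u,\mathsf x)=\big((M_{\mathsf e}u_{\mathsf e}'+N_{\mathsf e}u_{\mathsf e})_{\mathsf e},\ (B_{\mathsf v}\gamma_{\mathsf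 v}(u)+C_{\mathsf v}\mathsf x_{\mathsf v})_{\mathsf v}\big),$$ $$D(\mathbb A)=\Big\{(u,\mathsf x):\ u\in\bigoplus_{\mathsf e}H^1(0,\ell_{\mathsf e})^{k_{\mathsf e}},\ \gamma_{\mathsf v}(u)\in Y_{\mathsf v},\ \mathsf x_{\mathsf v}=P^{(d)}_{\mathsf v}\gamma_{\mathsf v}(u)\ \text{for all }\mathsf v\Big\}.$$ **Statement.** Assume that for all $\mathsf v\in\mathsf V$: * for some $\lambda\ge0$, the quadratic form associated with $T_{\mathsf v}+Q_{\mathsf v}B_{\mathsf v}+B^*_{\mathsf v}Q_{\mathsf v}-\lambda P^{(d)}_{\mathsf v}Q_{\mathsf v}P^{(d)}_{\mathsf v}$ (where $B^*_{\mathsf v}Q_{\mathsf v}$ stands for $B^*_{\mathsf v}Q_{\mathsf v}P^{(d)}_{\mathsf v}$, the adjoint of $Q_{\mathsf v}B_{\mathsf v}$) vanishes on $Y_{\mathsf v}$; and * for some $\mu\ge0$, the quadratic form on $\mathbb C^{k_{\mathsf v}}\oplus Y^{(d)}_{\mathsf v}$ (with the Euclidean inner product) associated with $$\begin{pmatrix}-T_{\mathsf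 v}-2\mu&T_{\mathsf v}\\ P^{(d)}_{\mathsf v}T_{\mathsf v}&(P^{(d)}_{\mathsf v}B^*_{\mathsf v}-\mu\,\mathrm{Id})Q_{\mathsf v}+Q_{\mathsf v}(B_{\mathsf v}-\mu\,\mathrm{Id})\end{pmatrix}$$ vanishes on $\mathbb Y^*_{\mathsf v}$. Then both $\mathbb A$ and $-\mathbb A$ are quasi-$m$-dissipative with respect to $(\cdot,\cdot)_d$ (that is, $\pm\mathbb A-\omega$ is $m$-dissipative for some $\omega\in\mathbb R$), and $\mathbb A$ generates a strongly continuous group on $\mathbf L^2_d(\mathcal G)$. -/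

import Mathlib

open MeasureTheory Set Filter
open scoped ContDiff Topology InnerProductSpace

namespace NetworkDyn

noncomputable section

/-! ### Sobolev functions on an interval -/

/-- The space `L²(0,ℓ)^n` of (classes of) `ℂⁿ`-valued functions. -/
abbrev EdgeL2 (n : ℕ) (ℓ : ℝ) : Type :=
  Lp (EuclideanSpace ℂ (Fin n)) 2 (volume.restrict (Ioo (0 : ℝ) ℓ))

instance (n : ℕ) (ℓ : ℝ) : NormedAddCommGroup (EdgeL2 n ℓ) := Lp.instNormedAddCommGroup
instance (n : ℕ) (ℓ : ℝ) : SeminormedAddCommGroup (EdgeL2 n ℓ) :=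
  NormedAddCommGroup.toSeminormedAddCommGroup
instance (n : ℕ) (ℓ : ℝ) : NormedSpace ℂ (EdgeL2 n ℓ) := Lp.instNormedSpace

/-- `g` is the weak (distributional) derivative of `u` on `(0,ℓ)`. -/
def IsWeakDeriv {n : ℕ} (ℓ : ℝ) (u g : ℝ → EuclideanSpace ℂ (Fin n)) : Prop :=
  ∀ φ : ℝ → ℝ, ContDiff ℝ ∞ φ → HasCompactSupport φ → tsupport φ ⊆ Ioo 0 ℓ →
    ∫ x in Ioo 0 ℓ, deriv φ x • u x = -∫ x in Ioo 0 ℓ, φ x • g x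

lemma integrableOn_edge {n : ℕ} {ℓ : ℝ} (u : EdgeL2 n ℓ) : IntegrableOn u (Ioo 0 ℓ) :=
  (Lp.memLp u).integrable (by norm_num)

lemma integrable_test_smul {n : ℕ} {ℓ : ℝ} {φ : ℝ → ℝ} (hφ : Continuous φ)
    (hc : HasCompactSupport φ) {u : ℝ → EuclideanSpace ℂ (Fin n)}
    (hu : IntegrableOn u (Ioo 0 ℓ)) :
    Integrable (fun x => φ x • u x) (volume.restrict (Ioo 0 ℓ)) := by
  obtain ⟨C, hC⟩ := hφ.bounded_above_of_compact_support hc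
  exact Integrable.bdd_smul hu C hφ.aestronglyMeasurable (Eventually.of_forall hC)

lemma IsWeakDeriv.congr {n : ℕ} {ℓ : ℝ} {u u' g g' : ℝ → EuclideanSpace ℂ (Fin n)}
    (h : IsWeakDeriv ℓ u g) (hu : u =ᵐ[volume.restrict (Ioo 0 ℓ)] u')
    (hg : g =ᵐ[volume.restrict (Ioo 0 ℓ)] g') : IsWeakDeriv ℓ u' g' := by
  intro φ h1 h2 h3
  have e1 : ∫ x in Ioo 0 ℓ, deriv φ x • u' x = ∫ x in Ioo 0 ℓ, deriv φ x • u x := by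
    apply integral_congr_ae
    filter_upwards [hu] with x hx
    rw [hx]
  have e2 : ∫ x in Ioo 0 ℓ, φ x • g' x = ∫ x in Ioo 0 ℓ, φ x • g x := by
    apply integral_congr_ae
    filter_upwards [hg] with x hx
    rw [hx]
  rw [e1, e2]
  exact h φ h1 h2 h3

lemma IsWeakDeriv.add {n : ℕ} {ℓ : ℝ} {u u' g g' : ℝ → EuclideanSpace ℂ (Fin n)}
    (h : IsWeakDeriv ℓ u g) (h' : IsWeakDeriv ℓ u' g')
    (hu : IntegrableOn u (Ioo 0 ℓ)) (hu' : IntegrableOn u' (Ioo 0 ℓ))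
    (hg : IntegrableOn g (Ioo 0 ℓ)) (hg' : IntegrableOn g' (Ioo 0 ℓ)) :
    IsWeakDeriv ℓ (u + u') (g + g') := by
  intro φ h1 h2 h3
  have hd : Continuous (deriv φ) := h1.continuous_deriv (by simp)
  simp only [Pi.add_apply, smul_add]
  rw [integral_add (integrable_test_smul hd h2.deriv hu) (integrable_test_smul hd h2.deriv hu'),
    integral_add (integrable_test_smul h1.continuous h2 hg)
      (integrable_test_smul h1.continuous h2 hg'), h φ h1 h2 h3, h' φ h1 h2 h3, neg_add]

lemma IsWeakDeriv.const_smul {n : ℕ} {ℓ : ℝ} {u g : ℝ → EuclideanSpace ℂ (Fin n)}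
    (h : IsWeakDeriv ℓ u g) (c : ℂ) : IsWeakDeriv ℓ (c • u) (c • g) := by
  intro φ h1 h2 h3
  simp only [Pi.smul_apply, smul_comm _ c]
  rw [integral_smul, integral_smul, h φ h1 h2 h3, smul_neg]

/-- Weak derivatives are unique. -/
lemma IsWeakDeriv.unique {n : ℕ} {ℓ : ℝ} {u g g' : ℝ → EuclideanSpace ℂ (Fin n)}
    (h : IsWeakDeriv ℓ u g) (h' : IsWeakDeriv ℓ u g')
    (hg : IntegrableOn g (Ioo 0 ℓ)) (hg' : IntegrableOn g' (Ioo 0 ℓ)) :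
    g =ᵐ[volume.restrict (Ioo 0 ℓ)] g' := by
  have key : ∀ᵐ x ∂(volume : Measure ℝ), x ∈ Ioo 0 ℓ → (g - g') x = 0 := by
    apply isOpen_Ioo.ae_eq_zero_of_integral_contDiff_smul_eq_zero
      ((hg.sub hg').locallyIntegrableOn)
    intro φ h1 h2 h3
    have e : ∫ x, φ x • (g - g') x = ∫ x in Ioo 0 ℓ, φ x • (g - g') x := by
      rw [setIntegral_eq_integral_of_forall_compl_eq_zero]
      intro x hx
      have : φ x = 0 := image_eq_zero_of_notMem_tsupport (fun hh => hx (h3 hh))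
      rw [this, zero_smul]
    rw [e]
    simp only [Pi.sub_apply, smul_sub]
    rw [integral_sub (integrable_test_smul h1.continuous h2 hg)
      (integrable_test_smul h1.continuous h2 hg')]
    have a := h φ h1 h2 h3
    have b := h' φ h1 h2 h3
    rw [a] at b
    rw [neg_injective b, sub_self]
  have := (ae_restrict_iff' (μ := (volume : Measure ℝ)) measurableSet_Ioo).2 key
  filter_upwards [this] with x hx
  exact sub_eq_zero.1 hx

/-- An indefinite integral has the expected weak derivative. -/
lemma isWeakDeriv_primitive {n : ℕ} {ℓ : ℝ} {g : ℝ → EuclideanSpace ℂ (Fin n)}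
    (hg : IntegrableOn g (Ioo 0 ℓ)) :
    IsWeakDeriv ℓ (fun x => ∫ t in Iic x, (Ioo 0 ℓ).indicator g t) g := by
  intro φ h1 h2 h3
  set G := (Ioo (0 : ℝ) ℓ).indicator g with hG
  have hGi : Integrable G := (integrable_indicator_iff measurableSet_Ioo).2 hg
  have hd : Continuous (deriv φ) := h1.continuous_deriv (by simp)
  have hdi : Integrable (deriv φ) := hd.integrable_of_hasCompactSupport h2.deriv
  have e1 : ∫ x in Ioo 0 ℓ, deriv φ x • (∫ t in Iic x, G t) =
      ∫ x, deriv φ x • (∫ t in Iic x, G t) := by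
    rw [setIntegral_eq_integral_of_forall_compl_eq_zero]
    intro x hx
    have : deriv φ x = 0 := image_eq_zero_of_notMem_tsupport
      (fun hh => hx (h3 (tsupport_deriv_subset hh)))
    rw [this, zero_smul]
  have e2 : ∫ x in Ioo 0 ℓ, φ x • g x = ∫ t, φ t • G t := by
    rw [← integral_indicator measurableSet_Ioo]
    congr 1
    ext1 x
    by_cases hx : x ∈ Ioo 0 ℓ <;> simp [hG, hx]
  rw [e1, e2]
  have hS : MeasurableSet {p : ℝ × ℝ | p.2 ≤ p.1} := measurableSet_le measurable_snd measurable_fst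
  have hint : Integrable (Function.uncurry fun x t =>
      {p : ℝ × ℝ | p.2 ≤ p.1}.indicator (fun p => deriv φ p.1 • G p.2) (x, t))
      (volume.prod volume) := by
    have := (Integrable.smul_prod hdi hGi).indicator hS
    exact this
  have e3 : ∫ x, deriv φ x • (∫ t in Iic x, G t) =
      ∫ x, ∫ t, {p : ℝ × ℝ | p.2 ≤ p.1}.indicator (fun p => deriv φ p.1 • G p.2) (x, t) := by
    congr 1
    ext1 x
    rw [← integral_smul, ← integral_indicator measurableSet_Iic]
    congr 1
  have e4 : ∀ t, ∫ x, {p : ℝ × ℝ | p.2 ≤ p.1}.indicator (fun p => deriv φ p.1 • G p.2) (x, t) =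
      -(φ t • G t) := by
    intro t
    have : ∫ x, {p : ℝ × ℝ | p.2 ≤ p.1}.indicator (fun p => deriv φ p.1 • G p.2) (x, t) =
        ∫ x in Ici t, deriv φ x • G t := by
      rw [← integral_indicator measurableSet_Ici]
      congr 1
    rw [this, integral_smul_const, integral_Ici_eq_integral_Ioi,
      HasCompactSupport.integral_Ioi_deriv_eq (h1.of_le (by simp)) h2, neg_smul]
  rw [e3, integral_integral_swap hint]
  simp_rw [e4]
  rw [integral_neg]

/-- A function with vanishing weak derivative is constant. -/
lemma ae_const_of_isWeakDeriv_zero {n : ℕ} {ℓ : ℝ} (hℓ : 0 < ℓ)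
    {v : ℝ → EuclideanSpace ℂ (Fin n)} (hv : IntegrableOn v (Ioo 0 ℓ))
    (h : IsWeakDeriv ℓ v 0) : ∃ c, ∀ᵐ x ∂volume.restrict (Ioo 0 ℓ), v x = c := by
  -- a normalised bump function
  let b : ContDiffBump (ℓ / 2) := ⟨ℓ / 8, ℓ / 4, by positivity, by linarith⟩
  let ψ : ℝ → ℝ := b.normed volume
  have hψ1 : ContDiff ℝ ∞ ψ := b.contDiff_normed
  have hψ2 : HasCompactSupport ψ := b.hasCompactSupport_normed
  have hψ3 : tsupport ψ ⊆ Ioo 0 ℓ := by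
    rw [b.tsupport_normed_eq]
    intro x hx
    rw [Metric.mem_closedBall, Real.dist_eq, abs_le] at hx
    change -(ℓ / 4) ≤ _ ∧ _ ≤ ℓ / 4 at hx
    constructor <;> linarith [hx.1, hx.2]
  have hψ4 : ∫ x, ψ x = 1 := b.integral_normed
  refine ⟨∫ x in Ioo 0 ℓ, ψ x • v x, ?_⟩
  set c := ∫ x in Ioo 0 ℓ, ψ x • v x with hc
  have hcI : IntegrableOn (fun _ : ℝ => c) (Ioo 0 ℓ) := by simp
  have key : ∀ᵐ x ∂(volume : Measure ℝ), x ∈ Ioo 0 ℓ → (v x - c) = 0 := by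
    apply isOpen_Ioo.ae_eq_zero_of_integral_contDiff_smul_eq_zero
      ((hv.sub hcI).locallyIntegrableOn)
    intro η h1 h2 h3
    set m := ∫ x, η x with hm
    let θ : ℝ → ℝ := fun x => η x - m * ψ x
    have hθ1 : ContDiff ℝ ∞ θ := h1.sub (contDiff_const.mul hψ1)
    have hθ2 : HasCompactSupport θ := h2.sub (hψ2.mul_left)
    have hθi : Integrable θ := hθ1.continuous.integrable_of_hasCompactSupport hθ2
    have hθ3 : ∫ x, θ x = 0 := by
      change ∫ x, (η x - m * ψ x) = 0
      rw [integral_sub (h1.continuous.integrable_of_hasCompactSupport h2)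
        ((hψ1.continuous.integrable_of_hasCompactSupport hψ2).const_mul m),
        integral_const_mul, hψ4, mul_one, sub_self]
    -- the support lies in a compact subinterval
    obtain ⟨a, a', ha, hab, ha', hK⟩ : ∃ a a', 0 < a ∧ a < a' ∧ a' < ℓ ∧
        ∀ x, x ∉ Icc a a' → θ x = 0 := by
      have hcomp : IsCompact (tsupport η ∪ tsupport ψ) := h2.isCompact.union hψ2.isCompact
      have hsub : tsupport η ∪ tsupport ψ ⊆ Ioo 0 ℓ := union_subset h3 hψ3
      have hne : (tsupport η ∪ tsupport ψ).Nonempty := by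
        by_contra hemp
        rw [not_nonempty_iff_eq_empty, union_empty_iff] at hemp
        have : ψ = 0 := tsupport_eq_empty_iff.1 hemp.2
        rw [this] at hψ4
        simp at hψ4
      obtain ⟨x0, hx0, hmin⟩ := hcomp.exists_isMinOn hne continuousOn_id
      obtain ⟨x1, hx1, hmax⟩ := hcomp.exists_isMaxOn hne continuousOn_id
      have i0 := hsub hx0
      have i1 := hsub hx1
      have i2 : x0 ≤ x1 := hmin hx1
      refine ⟨x0 / 2, (x1 + ℓ) / 2, by linarith [i0.1], by linarith [i0.1, i1.2],
        by linarith [i1.2], ?_⟩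
      intro x hx
      have hx' : x ∉ tsupport η ∪ tsupport ψ := by
        intro hh
        apply hx
        have j0 : x0 ≤ x := hmin hh
        have j1 : x ≤ x1 := hmax hh
        exact ⟨by linarith [i0.1], by linarith [i1.2]⟩
      rw [mem_union, not_or] at hx'
      change η x - m * ψ x = 0
      rw [image_eq_zero_of_notMem_tsupport hx'.1, image_eq_zero_of_notMem_tsupport hx'.2]
      ring
    let φ : ℝ → ℝ := fun x => ∫ t in a..x, θ t
    have hφd : ∀ x, HasDerivAt φ (θ x) x := fun x =>
      intervalIntegral.integral_hasDerivAt_right (hθ1.continuous.intervalIntegrable _ _)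
        (hθ1.continuous.stronglyMeasurableAtFilter _ _) hθ1.continuous.continuousAt
    have hφ' : deriv φ = θ := funext fun x => (hφd x).deriv
    have hφ1 : ContDiff ℝ ∞ φ := by
      rw [contDiff_infty_iff_deriv, hφ']
      exact ⟨fun x => (hφd x).differentiableAt, hθ1⟩
    have hφ0 : ∀ x, x ∉ Icc a a' → φ x = 0 := by
      intro x hx
      have hz : ∀ y ≤ a, ∫ t in Iic y, θ t = 0 := by
        intro y hy
        rw [integral_Iic_eq_integral_Iio]
        apply setIntegral_eq_zero_of_forall_eq_zero
        intro t ht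
        rw [mem_Iio] at ht
        exact hK t (fun hh => absurd (lt_of_lt_of_le ht hy) (not_lt.2 hh.1))
      have hsubt : φ x = (∫ t in Iic x, θ t) - ∫ t in Iic a, θ t :=
        (intervalIntegral.integral_Iic_sub_Iic hθi.integrableOn hθi.integrableOn).symm
      rw [hsubt, hz a le_rfl, sub_zero]
      by_cases hxa : x < a
      · exact hz x hxa.le
      · have hxa' : a' < x := by
          by_contra hh
          exact hx ⟨not_lt.1 hxa, not_lt.1 hh⟩
        rw [← hθ3]
        apply setIntegral_eq_integral_of_forall_compl_eq_zero
        intro t ht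
        rw [mem_Iic, not_le] at ht
        exact hK t (fun hh => absurd hh.2 (not_le.2 (hxa'.trans ht)))
    have hφts : tsupport φ ⊆ Icc a a' := by
      apply closure_minimal _ isClosed_Icc
      intro x hx
      by_contra hh
      exact hx (hφ0 x hh)
    have hφ2 : HasCompactSupport φ := HasCompactSupport.of_support_subset_isCompact isCompact_Icc
      ((subset_tsupport φ).trans hφts)
    have hφ3 : tsupport φ ⊆ Ioo 0 ℓ := fun x hx =>
      ⟨ha.trans_le (hφts hx).1, (hφts hx).2.trans_lt ha'⟩
    have main := h φ hφ1 hφ2 hφ3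
    rw [hφ'] at main
    simp only [Pi.zero_apply, smul_zero, integral_zero, neg_zero] at main
    have e : ∫ x, η x • (v x - c) = ∫ x in Ioo 0 ℓ, η x • (v x - c) := by
      rw [setIntegral_eq_integral_of_forall_compl_eq_zero]
      intro x hx
      have : η x = 0 := image_eq_zero_of_notMem_tsupport (fun hh => hx (h3 hh))
      rw [this, zero_smul]
    have em : ∫ x in Ioo 0 ℓ, η x = m := by
      rw [hm, setIntegral_eq_integral_of_forall_compl_eq_zero]
      intro x hx
      exact image_eq_zero_of_notMem_tsupport (fun hh => hx (h3 hh))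
    have e5 : ∫ x in Ioo 0 ℓ, θ x • v x = (∫ x in Ioo 0 ℓ, η x • v x) - m • c := by
      change ∫ x in Ioo 0 ℓ, (η x - m * ψ x) • v x = _
      simp only [sub_smul, mul_smul]
      have hI : Integrable (fun x => m • ψ x • v x) (volume.restrict (Ioo 0 ℓ)) :=
        (integrable_test_smul hψ1.continuous hψ2 hv).smul m
      rw [integral_sub (integrable_test_smul h1.continuous h2 hv) hI, integral_smul]
    change ∫ x, η x • (v x - c) = 0
    rw [e]
    simp only [smul_sub]
    rw [integral_sub (integrable_test_smul h1.continuous h2 hv)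
      (integrable_test_smul h1.continuous h2 hcI), integral_smul_const, em, ← e5, main]
  have := (ae_restrict_iff' (μ := (volume : Measure ℝ)) measurableSet_Ioo).2 key
  filter_upwards [this] with x hx
  exact sub_eq_zero.1 hx

/-- The Sobolev space `H¹(0,ℓ)^n`: the functions in `L²` with a weak derivative in `L²`. -/
def H1 (n : ℕ) (ℓ : ℝ) : Submodule ℂ (EdgeL2 n ℓ) where
  carrier := {u | ∃ g : EdgeL2 n ℓ, IsWeakDeriv ℓ u g}
  zero_mem' := by
    refine ⟨0, fun φ _ _ _ => ?_⟩
    have e : ((0 : EdgeL2 n ℓ) : ℝ → EuclideanSpace ℂ (Fin n))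
        =ᵐ[volume.restrict (Ioo (0 : ℝ) ℓ)] 0 := Lp.coeFn_zero _ _ _
    rw [integral_eq_zero_of_ae, integral_eq_zero_of_ae, neg_zero]
    · filter_upwards [e] with x hx
      change φ x • ((0 : EdgeL2 n ℓ) : ℝ → EuclideanSpace ℂ (Fin n)) x = 0
      rw [hx, Pi.zero_apply, smul_zero]
    · filter_upwards [e] with x hx
      change deriv φ x • ((0 : EdgeL2 n ℓ) : ℝ → EuclideanSpace ℂ (Fin n)) x = 0
      rw [hx, Pi.zero_apply, smul_zero]
  add_mem' := by
    rintro u u' ⟨g, hg⟩ ⟨g', hg'⟩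
    exact ⟨g + g', (hg.add hg' (integrableOn_edge _) (integrableOn_edge _) (integrableOn_edge _)
      (integrableOn_edge _)).congr (Lp.coeFn_add _ _).symm (Lp.coeFn_add _ _).symm⟩
  smul_mem' := by
    rintro c u ⟨g, hg⟩
    exact ⟨c • g, (hg.const_smul c).congr (Lp.coeFn_smul _ _).symm (Lp.coeFn_smul _ _).symm⟩

lemma weakDeriv_ext {n : ℕ} {ℓ : ℝ} {u : ℝ → EuclideanSpace ℂ (Fin n)} {g g' : EdgeL2 n ℓ}
    (h : IsWeakDeriv ℓ u g) (h' : IsWeakDeriv ℓ u g') : g = g' :=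
  Lp.ext (h.unique h' (integrableOn_edge _) (integrableOn_edge _))

/-- The weak derivative `u ↦ u'` from `H¹(0,ℓ)^n` to `L²(0,ℓ)^n`. -/
def weakDeriv (n : ℕ) (ℓ : ℝ) : H1 n ℓ →ₗ[ℂ] EdgeL2 n ℓ where
  toFun u := Classical.choose u.2
  map_add' u u' := weakDeriv_ext (Classical.choose_spec (u + u').2)
    (((Classical.choose_spec u.2).add (Classical.choose_spec u'.2) (integrableOn_edge _)
      (integrableOn_edge _) (integrableOn_edge _) (integrableOn_edge _)).congr
      (Lp.coeFn_add _ _).symm (Lp.coeFn_add _ _).symm)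
  map_smul' c u := weakDeriv_ext (Classical.choose_spec (c • u).2)
    (((Classical.choose_spec u.2).const_smul c).congr
      (Lp.coeFn_smul _ _).symm (Lp.coeFn_smul _ _).symm)

lemma isWeakDeriv_weakDeriv {n : ℕ} {ℓ : ℝ} (u : H1 n ℓ) :
    IsWeakDeriv ℓ (u : EdgeL2 n ℓ) (weakDeriv n ℓ u) := Classical.choose_spec u.2

/-- `w` is a representative of `u` that is continuous on `[0,ℓ]`. -/
def IsContRep {n : ℕ} {ℓ : ℝ} (u : EdgeL2 n ℓ) (w : ℝ → EuclideanSpace ℂ (Fin n)) : Prop :=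
  ContinuousOn w (Icc 0 ℓ) ∧ u =ᵐ[volume.restrict (Ioo 0 ℓ)] w

/-- Every `H¹` function has a continuous representative. -/
lemma exists_isContRep {n : ℕ} {ℓ : ℝ} (hℓ : 0 < ℓ) (u : H1 n ℓ) :
    ∃ w, IsContRep (u : EdgeL2 n ℓ) w := by
  set g := weakDeriv n ℓ u
  have hg : IntegrableOn g (Ioo 0 ℓ) := integrableOn_edge g
  have hGi : Integrable ((Ioo (0 : ℝ) ℓ).indicator g) :=
    (integrable_indicator_iff measurableSet_Ioo).2 hg
  let w : ℝ → EuclideanSpace ℂ (Fin n) := fun x => ∫ t in Iic x, (Ioo 0 ℓ).indicator g t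
  have hwc : Continuous w := by
    have hh : w = fun x => (∫ t in Iic (0 : ℝ), (Ioo 0 ℓ).indicator g t) +
        ∫ t in (0 : ℝ)..x, (Ioo 0 ℓ).indicator g t := by
      ext1 x
      rw [← intervalIntegral.integral_Iic_sub_Iic hGi.integrableOn hGi.integrableOn]
      simp [w]
    rw [hh]
    exact continuous_const.add
      (intervalIntegral.continuous_primitive (fun _ _ => hGi.intervalIntegrable) 0)
  have hwi : IntegrableOn w (Ioo 0 ℓ) :=
    (hwc.continuousOn.integrableOn_Icc).mono_set Ioo_subset_Icc_self
  have hw := isWeakDeriv_primitive hg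
  have hz : IsWeakDeriv ℓ (((u : EdgeL2 n ℓ) : ℝ → EuclideanSpace ℂ (Fin n)) + (-1 : ℂ) • w) 0 := by
    have := (isWeakDeriv_weakDeriv u).add (hw.const_smul (-1)) (integrableOn_edge _)
      (hwi.smul (-1 : ℂ)) hg (hg.smul (-1 : ℂ))
    refine this.congr (EventuallyEq.refl _ _) (Eventually.of_forall fun x => ?_)
    simp [g]
  obtain ⟨c, hc⟩ := ae_const_of_isWeakDeriv_zero hℓ
    ((integrableOn_edge _).add (hwi.smul (-1 : ℂ))) hz
  refine ⟨fun x => w x + c, (hwc.add continuous_const).continuousOn, ?_⟩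
  filter_upwards [hc] with x hx
  rw [← hx]
  simp

lemma IsContRep.eqOn {n : ℕ} {ℓ : ℝ} (hℓ : 0 < ℓ) {u : EdgeL2 n ℓ}
    {w w' : ℝ → EuclideanSpace ℂ (Fin n)} (h : IsContRep u w) (h' : IsContRep u w') :
    EqOn w w' (Icc 0 ℓ) := by
  have e : w =ᵐ[volume.restrict (Ioo 0 ℓ)] w' := h.2.symm.trans h'.2
  have e1 : EqOn w w' (Ioo 0 ℓ) := Measure.eqOn_open_of_ae_eq e isOpen_Ioo
    (h.1.mono Ioo_subset_Icc_self) (h'.1.mono Ioo_subset_Icc_self)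
  exact e1.of_subset_closure h.1 h'.1 Ioo_subset_Icc_self (by rw [closure_Ioo hℓ.ne])

/-- Point evaluation `u ↦ u(p)` on `H¹(0,ℓ)^n`: the value of the continuous representative. -/
def evalH1 {n : ℕ} {ℓ : ℝ} (hℓ : 0 < ℓ) (p : ℝ) (hp : p ∈ Icc 0 ℓ) :
    H1 n ℓ →ₗ[ℂ] EuclideanSpace ℂ (Fin n) where
  toFun u := Classical.choose (exists_isContRep hℓ u) p
  map_add' u u' := by
    have a := Classical.choose_spec (exists_isContRep hℓ u)
    have b := Classical.choose_spec (exists_isContRep hℓ u')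
    refine (Classical.choose_spec (exists_isContRep hℓ (u + u'))).eqOn hℓ
      (w' := fun x => _ + _) ⟨a.1.add b.1, ?_⟩ hp
    filter_upwards [Lp.coeFn_add (u : EdgeL2 n ℓ) (u' : EdgeL2 n ℓ), a.2, b.2] with x h1 h2 h3
    rw [← h2, ← h3]
    exact h1
  map_smul' c u := by
    have a := Classical.choose_spec (exists_isContRep hℓ u)
    refine (Classical.choose_spec (exists_isContRep hℓ (c • u))).eqOn hℓ
      (w' := fun x => c • _) ⟨a.1.const_smul c, ?_⟩ hp
    filter_upwards [Lp.coeFn_smul c (u : EdgeL2 n ℓ), a.2] with x h1 h2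
    rw [← h2]
    exact h1

/-- Multiplication of `L²(0,ℓ)^n` by an essentially bounded matrix function. -/
lemma memLp_mulVec {n : ℕ} {ℓ : ℝ} {A : ℝ → Matrix (Fin n) (Fin n) ℂ}
    (hA : ∀ i j, MemLp (fun x => A x i j) ⊤ (volume.restrict (Ioo 0 ℓ))) (u : EdgeL2 n ℓ) :
    MemLp (fun x => Matrix.toEuclideanLin (A x) (u x)) 2 (volume.restrict (Ioo 0 ℓ)) := by
  rw [memLp_piLp_iff]
  intro i
  have hu := memLp_piLp_iff.1 (Lp.memLp u)
  have : (fun x => Matrix.toEuclideanLin (A x) (u x) i) = fun x => ∑ j, A x i j * u x j := by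
    ext1 x
    simp [Matrix.toLpLin_apply, Matrix.mulVec, dotProduct]
  rw [this]
  exact memLp_finsetSum _ fun j _ => (hu j).mul (hA i j)

/-- The operator `u ↦ A u` on `L²(0,ℓ)^n`, for an essentially bounded matrix function `A`. -/
def mulL2 {n : ℕ} {ℓ : ℝ} (A : ℝ → Matrix (Fin n) (Fin n) ℂ)
    (hA : ∀ i j, MemLp (fun x => A x i j) ⊤ (volume.restrict (Ioo 0 ℓ))) :
    EdgeL2 n ℓ →ₗ[ℂ] EdgeL2 n ℓ where
  toFun u := (memLp_mulVec hA u).toLp _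
  map_add' u u' := by
    apply Lp.ext
    filter_upwards [(memLp_mulVec hA (u + u')).coeFn_toLp, (memLp_mulVec hA u).coeFn_toLp,
      (memLp_mulVec hA u').coeFn_toLp, Lp.coeFn_add u u',
      Lp.coeFn_add ((memLp_mulVec hA u).toLp _) ((memLp_mulVec hA u').toLp _)] with x a b c d e
    rw [a, e, Pi.add_apply, b, c, d, Pi.add_apply, map_add]
  map_smul' t u := by
    apply Lp.ext
    filter_upwards [(memLp_mulVec hA (t • u)).coeFn_toLp, (memLp_mulVec hA u).coeFn_toLp,
      Lp.coeFn_smul t u, Lp.coeFn_smul t ((memLp_mulVec hA u).toLp _)] with x a b c d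
    rw [a, RingHom.id_apply, d, Pi.smul_apply, b, c, Pi.smul_apply, map_smul]

lemma memLp_top_of_lipschitz {ℓ : ℝ} {f : ℝ → ℂ} (h : ∃ K, LipschitzOnWith K f (Icc 0 ℓ)) :
    MemLp f ⊤ (volume.restrict (Ioo 0 ℓ)) := by
  obtain ⟨K, hK⟩ := h
  obtain ⟨C, hC⟩ := isCompact_Icc.exists_bound_of_continuousOn hK.continuousOn
  refine memLp_top_of_bound
    ((hK.continuousOn.mono Ioo_subset_Icc_self).aestronglyMeasurable measurableSet_Ioo) C ?_
  filter_upwards [ae_restrict_mem measurableSet_Ioo] with x hx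
  exact hC x (Ioo_subset_Icc_self hx)

/-! ### Networks -/

/-- A directed graph without loops, together with an edge length `ℓ_e > 0` and a number of
components `k_e ≥ 1` for each edge `e`; the edge `e` is identified with `[0, ℓ_e]`, directed from
`src e` (at `0`) to `tgt e` (at `ℓ_e`). -/
structure Network (V E : Type*) where
  src : E → V
  tgt : E → V
  src_ne_tgt : ∀ e, src e ≠ tgt e
  len : E → ℝ
  len_pos : ∀ e, 0 < len e
  dim : E → ℕ
  dim_pos : ∀ e, 0 < dim e

section
variable {V E : Type*} [DecidableEq V]

namespace Network

/-- The edges incident in `v`. -/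
abbrev Inc (G : Network V E) (v : V) : Type _ := {e : E // G.src e = v ∨ G.tgt e = v}

/-- The space `ℂ^{k_v}`, with one block of `k_e` coordinates for each edge `e` incident in `v`. -/
abbrev VertexSpace (G : Network V E) (v : V) : Type _ :=
  EuclideanSpace ℂ (Σ e : G.Inc v, Fin (G.dim e))

/-- The coordinate in `[0, ℓ_e]` of an endpoint `v` of `e`. -/
def coord (G : Network V E) (e : E) (v : V) : ℝ := if G.src e = v then 0 else G.len e

lemma coord_mem (G : Network V E) (e : E) (v : V) : G.coord e v ∈ Icc 0 (G.len e) := by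
  unfold coord
  split_ifs
  · exact ⟨le_rfl, (G.len_pos e).le⟩
  · exact ⟨(G.len_pos e).le, le_rfl⟩

/-- The entry `ι_{ve}` of the signed incidence matrix. -/
def incidence (G : Network V E) (v : V) (e : E) : ℂ :=
  (if G.tgt e = v then 1 else 0) - (if G.src e = v then 1 else 0)

variable [Fintype E]

/-- `L²(𝒢)`, the direct sum of the spaces `L²(0,ℓ_e)^{k_e}`. -/
abbrev L2 (G : Network V E) : Type _ := PiLp 2 fun e => EdgeL2 (G.dim e) (G.len e)

instance (G : Network V E) : NormedAddCommGroup G.L2 := PiLp.normedAddCommGroup 2 _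
instance (G : Network V E) : SeminormedAddCommGroup G.L2 :=
  NormedAddCommGroup.toSeminormedAddCommGroup
instance (G : Network V E) : NormedSpace ℂ G.L2 := PiLp.normedSpace 2 ℂ _

/-- `D_max`, the direct sum of the spaces `H¹(0,ℓ_e)^{k_e}`. -/
def Dmax (G : Network V E) : Submodule ℂ G.L2 where
  carrier := {u | ∀ e, u e ∈ H1 (G.dim e) (G.len e)}
  zero_mem' := fun _ => zero_mem _
  add_mem' := fun h h' e => add_mem (h e) (h' e)
  smul_mem' := fun c _ h e => Submodule.smul_mem _ c (h e)

/-- The restriction of `u ∈ D_max` to the edge `e`. -/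
def edgeH1 (G : Network V E) (e : E) : G.Dmax →ₗ[ℂ] H1 (G.dim e) (G.len e) where
  toFun u := ⟨(u : G.L2) e, u.2 e⟩
  map_add' _ _ := rfl
  map_smul' _ _ := rfl

/-- The trace `γ_v(u) = (u_e(v))_{e ∈ E_v}`. -/
def trace (G : Network V E) (v : V) : G.Dmax →ₗ[ℂ] G.VertexSpace v where
  toFun u := WithLp.toLp 2 fun i =>
    evalH1 (G.len_pos i.1) (G.coord i.1 v) (G.coord_mem i.1 v) (G.edgeH1 i.1 u) i.2
  map_add' _ _ := by ext i; simp
  map_smul' _ _ := by ext i; simp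

end Network

variable [Fintype V] [Fintype E] [DecidableEq E]

/-- Coefficients `M_e`, `N_e` of a hyperbolic system on a network, and Friedrichs symmetrizers
`Q_e`; Lipschitz continuity and essential boundedness of matrix functions are read entrywise. -/
structure HypSystem (G : Network V E) where
  M : ∀ e, ℝ → Matrix (Fin (G.dim e)) (Fin (G.dim e)) ℂ
  N : ∀ e, ℝ → Matrix (Fin (G.dim e)) (Fin (G.dim e)) ℂ
  Q : ∀ e, ℝ → Matrix (Fin (G.dim e)) (Fin (G.dim e)) ℂ
  lipschitz_M : ∀ e i j, ∃ K, LipschitzOnWith K (fun x => M e x i j) (Icc 0 (G.len e))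
  isUnit_M : ∀ e, ∀ x ∈ Icc 0 (G.len e), IsUnit (M e x)
  bounded_N : ∀ e i j, MemLp (fun x => N e x i j) ⊤ (volume.restrict (Ioo 0 (G.len e)))
  lipschitz_Q : ∀ e i j, ∃ K, LipschitzOnWith K (fun x => Q e x i j) (Icc 0 (G.len e))
  hermitian_Q : ∀ e, ∀ x ∈ Icc 0 (G.len e), (Q e x).IsHermitian
  hermitian_QM : ∀ e, ∀ x ∈ Icc 0 (G.len e), (Q e x * M e x).IsHermitian
  posDef_Q : ∀ e, ∃ q > 0, ∀ x ∈ Icc 0 (G.len e), ∀ ξ : EuclideanSpace ℂ (Fin (G.dim e)),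
    q * ‖ξ‖ ^ 2 ≤ (inner ℂ ξ (Matrix.toEuclideanLin (Q e x) ξ)).re

/-- The spaces `Y_v^{(d)} ⊆ Y_v ⊆ ℂ^{k_v}` and the operators `B_v : Y_v → Y_v^{(d)}` and
`C_v`, `Q_v` on `Y_v^{(d)}` that define dynamic vertex conditions; `Q_v` is Hermitian and positive
definite for the Euclidean inner product. -/
structure VertexConditions (G : Network V E) where
  Y : ∀ v, Submodule ℂ (G.VertexSpace v)
  Yd : ∀ v, Submodule ℂ (G.VertexSpace v)
  Yd_le : ∀ v, Yd v ≤ Y v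
  B : ∀ v, Y v →ₗ[ℂ] Yd v
  C : ∀ v, Yd v →ₗ[ℂ] Yd v
  Q : ∀ v, Yd v →ₗ[ℂ] Yd v
  symmetric_Q : ∀ v, ∀ x y : Yd v, inner ℂ (Q v x) y = inner ℂ x (Q v y)
  posDef_Q : ∀ v, ∀ x : Yd v, x ≠ 0 → 0 < (inner ℂ x (Q v x)).re

/-- The block-diagonal operator `T_v = diag(Q_e(v) M_e(v) ι_{ve})_{e ∈ E_v}` on `ℂ^{k_v}`. -/
def HypSystem.T {G : Network V E} (S : HypSystem G) (v : V) :
    G.VertexSpace v →ₗ[ℂ] G.VertexSpace v :=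
  Matrix.toEuclideanLin (Matrix.blockDiagonal' fun e : G.Inc v =>
    G.incidence v e • (S.Q e (G.coord e v) * S.M e (G.coord e v)))

namespace VertexConditions

variable {G : Network V E}

/-- The orthogonal projector `P_v^{(d)}` of `ℂ^{k_v}` onto `Y_v^{(d)}`. -/
def P (W : VertexConditions G) (v : V) : G.VertexSpace v →ₗ[ℂ] W.Yd v :=
  ((W.Yd v).orthogonalProjectionOnto : G.VertexSpace v →L[ℂ] W.Yd v).toLinearMap

/-- The orthogonal complement of `Y_v^{(d)}` in `Y_v`. -/
def YdPerp (W : VertexConditions G) (v : V) : Submodule ℂ (G.VertexSpace v) :=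
  W.Y v ⊓ (W.Yd v)ᗮ

/-- The orthogonal projector `P_v^{(d),⊥}` onto the orthogonal complement of `Y_v^{(d)}`
in `Y_v`. -/
def PPerp (W : VertexConditions G) (v : V) : G.VertexSpace v →ₗ[ℂ] W.YdPerp v :=
  ((W.YdPerp v).orthogonalProjectionOnto : G.VertexSpace v →L[ℂ] W.YdPerp v).toLinearMap

/-- The Euclidean adjoint `B_v^* : Y_v^{(d)} → Y_v`. -/
def Bstar (W : VertexConditions G) (v : V) : W.Yd v →ₗ[ℂ] W.Y v := LinearMap.adjoint (𝕜 := ℂ) (E := W.Y v) (F := W.Yd v) (W.B v)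

/-- The operator `T_v + Q_v B_v + B_v^* Q_v - λ P_v^{(d)} Q_v P_v^{(d)}` from `Y_v` to `ℂ^{k_v}`;
in the third summand `Q_v` is applied after `P_v^{(d)}`, so that `B_v^* Q_v` is the adjoint
of `Q_v B_v`. -/
def formOp (W : VertexConditions G) (S : HypSystem G) (v : V) (lam : ℝ) :
    W.Y v →ₗ[ℂ] G.VertexSpace v :=
  S.T v ∘ₗ (W.Y v).subtype
    + (W.Yd v).subtype ∘ₗ W.Q v ∘ₗ W.B v
    + (W.Y v).subtype ∘ₗ W.Bstar v ∘ₗ W.Q v ∘ₗ W.P v ∘ₗ (W.Y v).subtype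
    - (lam : ℂ) • ((W.Yd v).subtype ∘ₗ W.Q v ∘ₗ W.P v ∘ₗ (W.Y v).subtype)

/-- `Y_v` is contained in the null isotropic cone of the quadratic form associated with
`T_v + Q_v B_v + B_v^* Q_v - λ P_v^{(d)} Q_v P_v^{(d)}`. -/
def IsNull (W : VertexConditions G) (S : HypSystem G) (v : V) (lam : ℝ) : Prop :=
  ∀ ξ : W.Y v, inner ℂ (ξ : G.VertexSpace v) (W.formOp S v lam ξ) = 0

/-- The space `𝕐_v^* = Ker (P_v^{(d),⊥} T_v   P_v^{(d),⊥} B_v^* Q_v)` in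
`ℂ^{k_v} ⊕ Y_v^{(d)}`. -/
def adjY (W : VertexConditions G) (S : HypSystem G) (v : V) :
    Submodule ℂ (G.VertexSpace v × W.Yd v) :=
  LinearMap.ker (LinearMap.coprod (W.PPerp v ∘ₗ S.T v)
    (W.PPerp v ∘ₗ (W.Y v).subtype ∘ₗ W.Bstar v ∘ₗ W.Q v))

/-- The upper row `(-T_v - 2μ   T_v)` of the operator matrix on `ℂ^{k_v} ⊕ Y_v^{(d)}`. -/
def adjOpFst (W : VertexConditions G) (S : HypSystem G) (v : V) (mu : ℝ) :
    G.VertexSpace v × W.Yd v →ₗ[ℂ] G.VertexSpace v :=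
  LinearMap.coprod (-S.T v - (2 * mu : ℂ) • LinearMap.id) (S.T v ∘ₗ (W.Yd v).subtype)

/-- The lower row `(P_v^{(d)} T_v   (P_v^{(d)} B_v^* - μ) Q_v + Q_v (B_v - μ))` of the operator
matrix on `ℂ^{k_v} ⊕ Y_v^{(d)}`. -/
def adjOpSnd (W : VertexConditions G) (S : HypSystem G) (v : V) (mu : ℝ) :
    G.VertexSpace v × W.Yd v →ₗ[ℂ] W.Yd v :=
  LinearMap.coprod (W.P v ∘ₗ S.T v)
    ((W.P v ∘ₗ (W.Y v).subtype ∘ₗ W.Bstar v - (mu : ℂ) • LinearMap.id) ∘ₗ W.Q v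
      + W.Q v ∘ₗ (W.B v ∘ₗ Submodule.inclusion (W.Yd_le v) - (mu : ℂ) • LinearMap.id))

/-- `𝕐_v^*` is contained in the null isotropic cone of the quadratic form on
`ℂ^{k_v} ⊕ Y_v^{(d)}` associated with the operator matrix above. -/
def IsAdjNull (W : VertexConditions G) (S : HypSystem G) (v : V) (mu : ℝ) : Prop :=
  ∀ z ∈ W.adjY S v,
    inner ℂ z.1 (W.adjOpFst S v mu z) + inner ℂ z.2 (W.adjOpSnd S v mu z) = 0

/-- The Hilbert space `L²_d(𝒢) = L²(𝒢) ⊕ Y^{(d)}`, where `Y^{(d)}` is the direct sum of the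
spaces `Y_v^{(d)}`; as a topological vector space it carries the canonical Hilbert norm, which is
equivalent to the one given by `innerD` below. -/
abbrev L2d (W : VertexConditions G) : Type _ :=
  WithLp 2 (G.L2 × PiLp 2 fun v => W.Yd v)

instance (W : VertexConditions G) : NormedAddCommGroup W.L2d :=
  WithLp.instProdNormedAddCommGroup 2 G.L2 (PiLp 2 fun v => W.Yd v)
instance (W : VertexConditions G) : SeminormedAddCommGroup W.L2d :=
  NormedAddCommGroup.toSeminormedAddCommGroup
instance (W : VertexConditions G) : NormedSpace ℂ W.L2d :=
  WithLp.instProdNormedSpace 2 ℂ G.L2 (PiLp 2 fun v => W.Yd v)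

/-- The inner product `(U, U')_d = ∑_e ∫ Q_e u_e · ū'_e dx + ∑_v Q_v x_v · x̄'_v`, linear in the
first argument. -/
def innerD (W : VertexConditions G) (S : HypSystem G) (U U' : W.L2d) : ℂ :=
  (∑ e, ∫ x in Ioo 0 (G.len e),
      inner ℂ (U'.fst e x) (Matrix.toEuclideanLin (S.Q e x) (U.fst e x)))
    + ∑ v, inner ℂ (U'.snd v) (W.Q v (U.snd v))

/-- The domain of `𝔸`: the pairs `(u, x)` with `u ∈ D_max`, `γ_v(u) ∈ Y_v` and
`x_v = P_v^{(d)} γ_v(u)` for all `v`. -/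
def domA (W : VertexConditions G) : Submodule ℂ W.L2d where
  carrier := {U | ∃ h : U.fst ∈ G.Dmax, ∀ v,
    G.trace v ⟨U.fst, h⟩ ∈ W.Y v ∧ U.snd v = W.P v (G.trace v ⟨U.fst, h⟩)}
  zero_mem' := by
    refine ⟨zero_mem _, fun v => ?_⟩
    have : (⟨(0 : W.L2d).fst, zero_mem _⟩ : G.Dmax) = 0 := rfl
    rw [this, map_zero, map_zero]
    exact ⟨zero_mem _, rfl⟩
  add_mem' := by
    rintro U U' ⟨h, k⟩ ⟨h', k'⟩
    refine ⟨add_mem h h', fun v => ?_⟩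
    have : (⟨(U + U').fst, add_mem h h'⟩ : G.Dmax) = ⟨U.fst, h⟩ + ⟨U'.fst, h'⟩ := rfl
    rw [this, map_add, map_add, ← (k v).2, ← (k' v).2]
    exact ⟨add_mem (k v).1 (k' v).1, rfl⟩
  smul_mem' := by
    rintro c U ⟨h, k⟩
    refine ⟨Submodule.smul_mem _ c h, fun v => ?_⟩
    have : (⟨(c • U).fst, Submodule.smul_mem _ c h⟩ : G.Dmax) = c • ⟨U.fst, h⟩ := rfl
    rw [this, map_smul, map_smul, ← (k v).2]
    exact ⟨Submodule.smul_mem _ c (k v).1, rfl⟩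

/-- The first component `u ∈ D_max` of `(u, x) ∈ D(𝔸)`. -/
def fstA (W : VertexConditions G) : W.domA →ₗ[ℂ] G.Dmax where
  toFun U := ⟨(U : W.L2d).fst, U.2.choose⟩
  map_add' _ _ := rfl
  map_smul' _ _ := rfl

/-- The trace `γ_v(u) ∈ Y_v` of `(u, x) ∈ D(𝔸)`. -/
def traceA (W : VertexConditions G) (v : V) : W.domA →ₗ[ℂ] W.Y v :=
  LinearMap.codRestrict (W.Y v) (G.trace v ∘ₗ W.fstA) fun U => (U.2.choose_spec v).1

/-- The first component `(M_e u_e' + N_e u_e)_e` of `𝔸 (u, x)`. -/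
def edgeOp (W : VertexConditions G) (S : HypSystem G) : W.domA →ₗ[ℂ] G.L2 where
  toFun U := WithLp.toLp 2 fun e =>
    mulL2 (S.M e) (fun i j => memLp_top_of_lipschitz (S.lipschitz_M e i j))
        (weakDeriv (G.dim e) (G.len e) (G.edgeH1 e (W.fstA U)))
      + mulL2 (S.N e) (S.bounded_N e) (G.edgeH1 e (W.fstA U) : EdgeL2 (G.dim e) (G.len e))
  map_add' U U' := by
    ext1 e
    simp only [map_add, Submodule.coe_add, PiLp.add_apply]
    abel
  map_smul' c U := by
    ext1 e
    simp only [map_smul, Submodule.coe_smul, PiLp.smul_apply, smul_add, RingHom.id_apply]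

/-- The second component `(B_v γ_v(u) + C_v x_v)_v` of `𝔸 (u, x)`. -/
def vertexOp (W : VertexConditions G) : W.domA →ₗ[ℂ] PiLp 2 fun v => W.Yd v where
  toFun U := WithLp.toLp 2 fun v => W.B v (W.traceA v U) + W.C v ((U : W.L2d).snd v)
  map_add' U U' := by
    ext1 v
    have h : ((U + U' : W.domA) : W.L2d).snd v = (U : W.L2d).snd v + (U' : W.L2d).snd v := rfl
    simp only [h, map_add, PiLp.add_apply]
    abel
  map_smul' c U := by
    ext1 v
    have h : ((c • U : W.domA) : W.L2d).snd v = c • (U : W.L2d).snd v := rfl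
    simp only [h, map_smul, PiLp.smul_apply, smul_add, RingHom.id_apply]

/-- The operator `𝔸 (u, x) = ((M_e u_e' + N_e u_e)_e, (B_v γ_v(u) + C_v x_v)_v)` on `L²_d(𝒢)`
with domain `D(𝔸)`. -/
def opA (W : VertexConditions G) (S : HypSystem G) : W.L2d →ₗ.[ℂ] W.L2d where
  domain := W.domA
  toFun :=
    { toFun := fun U => WithLp.toLp 2 (W.edgeOp S U, W.vertexOp U)
      map_add' := fun U U' => by rw [map_add, map_add]; rfl
      map_smul' := fun c U => by rw [map_smul, map_smul]; rfl }

end VertexConditions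

end

/-! ### Quasi-m-dissipative operators and strongly continuous groups -/

section
variable {H : Type*} [NormedAddCommGroup H] [NormedSpace ℂ H]

/-- The operator `A - w`, with the domain of `A`. -/
def shift (A : H →ₗ.[ℂ] H) (w : ℝ) : H →ₗ.[ℂ] H where
  domain := A.domain
  toFun := A.toFun - (w : ℂ) • A.domain.subtype

/-- `A` is dissipative with respect to the inner product `ip` (linear in the first argument):
`Re (A u, u) ≤ 0` for all `u ∈ D(A)`. -/
def IsDissipative (ip : H → H → ℂ) (A : H →ₗ.[ℂ] H) : Prop :=
  ∀ u : A.domain, (ip (A u) u).re ≤ 0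

/-- `A` is m-dissipative: it is dissipative and `c - A` is surjective for all `c > 0`. -/
def IsMDissipative (ip : H → H → ℂ) (A : H →ₗ.[ℂ] H) : Prop :=
  IsDissipative ip A ∧ ∀ c : ℝ, 0 < c → ∀ f : H, ∃ u : A.domain, (c : ℂ) • (u : H) - A u = f

/-- `A` is quasi-m-dissipative: `A - w` is m-dissipative for some real `w`. -/
def IsQuasiMDissipative (ip : H → H → ℂ) (A : H →ₗ.[ℂ] H) : Prop :=
  ∃ w : ℝ, IsMDissipative ip (shift A w)

/-- `T` is a strongly continuous group of bounded linear operators. -/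
structure IsC0Group (T : ℝ → H →L[ℂ] H) : Prop where
  map_zero : T 0 = ContinuousLinearMap.id ℂ H
  map_add : ∀ s t, T (s + t) = (T s).comp (T t)
  continuous_orbit : ∀ x, Continuous fun t => T t x

/-- `A` is the infinitesimal generator of `T`: `x ∈ D(A)` and `A x = y` if and only if
`h⁻¹ (T(h) x - x) → y` as `h → 0`. -/
def IsGenerator (A : H →ₗ.[ℂ] H) (T : ℝ → H →L[ℂ] H) : Prop :=
  ∀ x y : H, (∃ hx : x ∈ A.domain, A ⟨x, hx⟩ = y) ↔
    Tendsto (fun h : ℝ => ((h : ℂ))⁻¹ • (T h x - x)) (𝓝[≠] 0) (𝓝 y)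

/-- `A` generates a strongly continuous group. -/
def GeneratesC0Group (A : H →ₗ.[ℂ] H) : Prop :=
  ∃ T : ℝ → H →L[ℂ] H, IsC0Group T ∧ IsGenerator A T

end

end

end NetworkDyn

namespace NetworkDyn

/-! ### Exponentials of bounded operators with bounded numerical real part -/

section BoundedGenerator
variable {H : Type*} [NormedAddCommGroup H] [InnerProductSpace ℂ H]

/-! The theorem rests on a two-sided energy estimate and a dimension count, after which an abstract
generation theorem applies.

Energy. On an edge, $2\operatorname{Re}\int Q_e M_e u_e'\cdot\bar u_e$ equals the boundary values of
$Q_eM_e u_e\cdot\bar u_e$ up to a term of order $\|u\|^2$, because $Q_eM_e$ is Hermitian and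
Lipschitz. Summed over edges, the boundary values regroup into $\sum_v
T_v\gamma_v(u)\cdot\overline{\gamma_v(u)}$ (`HypSystem.exists_abs_network_energy_le`). The first
null condition trades this, on $Y_v$, for
$-2\operatorname{Re}(Q_vB_v\gamma_v(u),x_v)+\lambda(Q_vx_v,x_v)$, whose first term cancels the
contribution of $B_v$ to $(\mathbb A U,U)_d$. Hence $|\operatorname{Re}(\mathbb
AU,U)_d|\le\kappa(U,U)_d$ (`exists_abs_re_innerD_opA_le`), with both signs at once since the
condition is an equality.

Range. For fixed $z$, choose linearly in the initial values $a\in\bigoplus_e\mathbb C^{k_e}$ a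
solution of $zu=Mu'+Nu$; this space has dimension $k=\sum_ek_e$. Solving $(z-\mathbb A)U=F$ then
becomes a finite linear system with values in $\bigoplus_v(Y_v^\perp\oplus Y_v^{(d)})$. It is
injective for $|z|>\kappa$ by the energy estimate, so it is enough that the target has dimension at
most $k$. As $\sum_vk_v=2k$, this says that the complements of $Y_v^{(d)}$ in $Y_v$ have total
dimension at least $k$. The second null condition gives this: tested on the vectors
$(\xi,0)\in\mathbb Y_v^*$, it makes $a\mapsto P_v^{(d),\perp}T_v\gamma_v(u)$ injective for large $z$
(`sum_dim_le_sum_finrank_YdPerp`). No adjoint operator has to be computed.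

Generation. In the norm of $(\cdot,\cdot)_d$, the bounded operators $A_z=z^2A(z^2-A^2)^{-1}$
commute, converge to $A$ on its domain, and satisfy $|\operatorname{Re}(A_zx,x)|\le8\kappa\|x\|^2$
uniformly in large $z$. Their exponentials are therefore controlled for both signs of time and
converge to a group generated by $A$ (`generatesC0Group_of_abs_re_inner_le`). The group is carried
back to the canonical norm by equivalence of norms (`generatesC0Group_of_core`). -/

lemma hasDerivAt_apply_vector {F : ℝ → H →L[ℂ] H} {F' : H →L[ℂ] H} {s : ℝ}
    (h : HasDerivAt F F' s) (x : H) : HasDerivAt (fun s => F s x) (F' x) s :=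
  ((ContinuousLinearMap.apply ℂ H x).restrictScalars ℝ).hasFDerivAt.comp_hasDerivAt s h

lemma abs_re_inner_smul_le {B : H →L[ℂ] H} {C : ℝ}
    (hB : ∀ x, |(inner ℂ (B x) x).re| ≤ C * ‖x‖ ^ 2) (t : ℝ) (x : H) :
    |(inner ℂ ((t • B) x) x).re| ≤ (C * |t|) * ‖x‖ ^ 2 := by
  have h : inner ℂ ((t • B) x) x = (t : ℂ) * inner ℂ (B x) x := by
    rw [smul_apply, RCLike.real_smul_eq_coe_smul (K := ℂ), inner_smul_left]
    simp
  rw [h, Complex.re_ofReal_mul, abs_mul]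
  calc |t| * |(inner ℂ (B x) x).re| ≤ |t| * (C * ‖x‖ ^ 2) :=
        mul_le_mul_of_nonneg_left (hB x) (abs_nonneg t)
    _ = _ := by ring

variable [CompleteSpace H]

/-- Along $y(s)=e^{sB}x$ one has $\frac{d}{ds}\|y\|^2=2\operatorname{Re}(By,y)\le2C\|y\|^2$, so
$e^{-2Cs}\|y(s)\|^2$ is non-increasing. Only the real part of the numerical range enters, not
$\|B\|$; the estimate thus survives for approximations whose norms blow up. -/
lemma norm_exp_smul_apply_le_of_nonneg {B : H →L[ℂ] H} {C : ℝ}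
    (hB : ∀ x, |(inner ℂ (B x) x).re| ≤ C * ‖x‖ ^ 2) {t : ℝ} (ht : 0 ≤ t) (x : H) :
    ‖NormedSpace.exp (t • B) x‖ ≤ Real.exp (C * t) * ‖x‖ := by
  let _ : InnerProductSpace ℝ H := InnerProductSpace.rclikeToReal ℂ H
  set y : ℝ → H := fun s => NormedSpace.exp (s • B) x with hy
  have hyd : ∀ s, HasDerivAt y (B (y s)) s := fun s => by
    simpa using hasDerivAt_apply_vector (hasDerivAt_exp_smul_const' (𝕂 := ℝ) B s) x
  have hφ : ∀ s, HasDerivAt (fun s => Real.exp (-(2 * C) * s) * ‖y s‖ ^ 2)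
      (Real.exp (-(2 * C) * s) * (-(2 * C)) * ‖y s‖ ^ 2 +
        Real.exp (-(2 * C) * s) * (2 * inner ℝ (y s) (B (y s)))) s := fun s => by
    have h1 : HasDerivAt (fun s => Real.exp (-(2 * C) * s))
        (Real.exp (-(2 * C) * s) * (-(2 * C))) s := by
      simpa using (((hasDerivAt_id s).const_mul (-(2 * C))).exp)
    exact h1.mul (hyd s).norm_sq
  have hanti : Antitone (fun s => Real.exp (-(2 * C) * s) * ‖y s‖ ^ 2) := by
    refine antitone_of_hasDerivAt_nonpos hφ fun s => ?_
    have h1 : inner ℝ (y s) (B (y s)) = (inner ℂ (B (y s)) (y s)).re := by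
      rw [real_inner_comm]; rfl
    have h2 := (abs_le.1 (hB (y s))).2
    have h3 := Real.exp_pos (-(2 * C) * s)
    rw [h1]
    change _ ≤ (0 : ℝ)
    nlinarith
  have h0 := hanti ht
  simp only [mul_zero, Real.exp_zero, one_mul] at h0
  have hy0 : y 0 = x := by simp [hy]
  rw [hy0] at h0
  have h4 : ‖y t‖ ^ 2 ≤ (Real.exp (C * t) * ‖x‖) ^ 2 := by
    have h5 : Real.exp (2 * C * t) * (Real.exp (-(2 * C) * t) * ‖y t‖ ^ 2) = ‖y t‖ ^ 2 := by
      rw [← mul_assoc, ← Real.exp_add]; simp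
    have h6 : (Real.exp (C * t)) ^ 2 = Real.exp (2 * C * t) := by
      rw [← Real.exp_nat_mul]; congr 1; push_cast; ring
    rw [mul_pow, h6, ← h5]
    exact mul_le_mul_of_nonneg_left h0 (Real.exp_pos _).le
  exact le_of_sq_le_sq h4 (by positivity)

lemma norm_exp_apply_le {B : H →L[ℂ] H} {C : ℝ}
    (hB : ∀ x, |(inner ℂ (B x) x).re| ≤ C * ‖x‖ ^ 2) (x : H) :
    ‖NormedSpace.exp B x‖ ≤ Real.exp C * ‖x‖ := by
  simpa using norm_exp_smul_apply_le_of_nonneg hB zero_le_one x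

/-- The sign of $t$ is absorbed into the operator: $tB$ satisfies the hypothesis with constant
$C|t|$ and is run up to time $1$. -/
lemma norm_exp_smul_apply_le {B : H →L[ℂ] H} {C : ℝ}
    (hB : ∀ x, |(inner ℂ (B x) x).re| ≤ C * ‖x‖ ^ 2) (t : ℝ) (x : H) :
    ‖NormedSpace.exp (t • B) x‖ ≤ Real.exp (C * |t|) * ‖x‖ :=
  norm_exp_apply_le (abs_re_inner_smul_le hB t) x

/-- Interpolate by $f(s)=e^{(1-s)B}e^{sB'}x$. Commutation turns the derivative into
$e^{(1-s)B}e^{sB'}(B'x-Bx)$, and the two exponential bounds multiply to $e^{C(1-s)}e^{Cs}=e^C$. -/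
lemma norm_exp_sub_exp_apply_le {B B' : H →L[ℂ] H} {C : ℝ}
    (hB : ∀ x, |(inner ℂ (B x) x).re| ≤ C * ‖x‖ ^ 2)
    (hB' : ∀ x, |(inner ℂ (B' x) x).re| ≤ C * ‖x‖ ^ 2) (hc : Commute B B') (x : H) :
    ‖NormedSpace.exp B' x - NormedSpace.exp B x‖ ≤ Real.exp C * ‖B' x - B x‖ := by
  set f : ℝ → H := fun s =>
    (NormedSpace.exp ((1 - s) • B) * NormedSpace.exp (s • B')) x with hf
  have hd : ∀ s, HasDerivAt f
      (NormedSpace.exp ((1 - s) • B) (NormedSpace.exp (s • B') (B' x - B x))) s := by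
    intro s
    have h1 : HasDerivAt (fun s : ℝ => NormedSpace.exp ((1 - s) • B))
        ((-1 : ℝ) • (NormedSpace.exp ((1 - s) • B) * B)) s := by
      exact (hasDerivAt_exp_smul_const (𝕂 := ℝ) B (1 - s)).scomp s
        ((hasDerivAt_id s).const_sub 1)
    have h2 := hasDerivAt_exp_smul_const (𝕂 := ℝ) B' s
    have h3 : HasDerivAt f _ s := hasDerivAt_apply_vector (h1.mul h2) x
    refine h3.congr_deriv (Eq.symm ?_)
    have hc' : B * NormedSpace.exp (s • B') = NormedSpace.exp (s • B') * B :=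
      ((hc.smul_right s).exp_right).eq
    simp only [neg_smul, one_smul, neg_mul, mul_assoc, hc', map_sub,
      add_apply, neg_apply, mul_apply_eq_comp]
    abel
  have hbound : ∀ s ∈ Ico (0 : ℝ) 1,
      ‖NormedSpace.exp ((1 - s) • B) (NormedSpace.exp (s • B') (B' x - B x))‖
        ≤ Real.exp C * ‖B' x - B x‖ := by
    intro s hs
    calc _ ≤ Real.exp (C * (1 - s)) * ‖NormedSpace.exp (s • B') (B' x - B x)‖ :=
          norm_exp_smul_apply_le_of_nonneg hB (by linarith [hs.2]) _
      _ ≤ Real.exp (C * (1 - s)) * (Real.exp (C * s) * ‖B' x - B x‖) := by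
          gcongr
          exact norm_exp_smul_apply_le_of_nonneg hB' hs.1 _
      _ = Real.exp C * ‖B' x - B x‖ := by
          rw [← mul_assoc, ← Real.exp_add]
          congr 2
          ring
  have := norm_image_sub_le_of_norm_deriv_le_segment_01' (fun s _ => (hd s).hasDerivWithinAt) hbound
  simpa [hf] using this

lemma norm_exp_smul_sub_exp_smul_apply_le {B B' : H →L[ℂ] H} {C : ℝ}
    (hB : ∀ x, |(inner ℂ (B x) x).re| ≤ C * ‖x‖ ^ 2)
    (hB' : ∀ x, |(inner ℂ (B' x) x).re| ≤ C * ‖x‖ ^ 2) (hc : Commute B B') (t : ℝ) (x : H) :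
    ‖NormedSpace.exp (t • B') x - NormedSpace.exp (t • B) x‖
      ≤ |t| * Real.exp (C * |t|) * ‖B' x - B x‖ := by
  refine (norm_exp_sub_exp_apply_le (abs_re_inner_smul_le hB t) (abs_re_inner_smul_le hB' t)
    ((hc.smul_left t).smul_right t) x).trans (le_of_eq ?_)
  rw [smul_apply, smul_apply, ← smul_sub, norm_smul,
    Real.norm_eq_abs]
  ring

end BoundedGenerator

/-! ### Resolvents and approximation by bounded operators -/

section Resolvent
variable {H : Type*} [NormedAddCommGroup H] [InnerProductSpace ℂ H]

/-- `R` is the resolvent `(z - A)⁻¹` of the operator with graph `Γ`. -/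
structure IsResolvent (Γ : Submodule ℂ (H × H)) (z : ℝ) (R : H →L[ℂ] H) : Prop where
  mem : ∀ f, (R f, (z : ℂ) • R f - f) ∈ Γ
  apply_sub : ∀ x y, (x, y) ∈ Γ → R ((z : ℂ) • x - y) = x

variable {Γ : Submodule ℂ (H × H)}

/-- Pair $zx-y$ with $x$ and use Cauchy–Schwarz. The bound on $\operatorname{Re}(y,x)$ is two-sided,
so $z$ may have either sign. -/
lemma norm_le_of_mem_graph {κ : ℝ} (hdis : ∀ x y, (x, y) ∈ Γ → |(inner ℂ y x).re| ≤ κ * ‖x‖ ^ 2)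
    {x y : H} (h : (x, y) ∈ Γ) (z : ℝ) : (|z| - κ) * ‖x‖ ≤ ‖(z : ℂ) • x - y‖ := by
  rcases eq_or_ne x 0 with rfl | hx
  · simp
  have h1 : (inner ℂ ((z : ℂ) • x - y) x).re = z * ‖x‖ ^ 2 - (inner ℂ y x).re := by
    rw [inner_sub_left, inner_smul_left, Complex.sub_re, Complex.conj_ofReal,
      Complex.re_ofReal_mul]
    congr 2
    exact inner_self_eq_norm_sq (𝕜 := ℂ) x
  have h2 : |(inner ℂ ((z : ℂ) • x - y) x).re| ≤ ‖(z : ℂ) • x - y‖ * ‖x‖ :=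
    (Complex.abs_re_le_norm _).trans (norm_inner_le_norm _ _)
  have h3 := hdis x y h
  have h4 : |z| * ‖x‖ ^ 2 ≤ |z * ‖x‖ ^ 2 - (inner ℂ y x).re| + |(inner ℂ y x).re| := by
    have := abs_add_le (z * ‖x‖ ^ 2 - (inner ℂ y x).re) (inner ℂ y x).re
    rwa [sub_add_cancel, abs_mul, abs_of_nonneg (sq_nonneg ‖x‖)] at this
  rw [h1] at h2
  have hx' : 0 < ‖x‖ := norm_pos_iff.2 hx
  refine le_of_mul_le_mul_right ?_ hx'
  nlinarith

/-- The a priori bound makes the solution of $zx-y=f$ unique; uniqueness makes the chosen solution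
map linear, and the same bound makes it continuous. The graph need not be known to be closed. -/
lemma exists_isResolvent {κ : ℝ}
    (hdis : ∀ x y, (x, y) ∈ Γ → |(inner ℂ y x).re| ≤ κ * ‖x‖ ^ 2) {z : ℝ} (hz : κ < |z|)
    (hsurj : ∀ f, ∃ x y, (x, y) ∈ Γ ∧ (z : ℂ) • x - y = f) :
    ∃ R, IsResolvent Γ z R ∧ ∀ f, (|z| - κ) * ‖R f‖ ≤ ‖f‖ := by
  choose r a hr ha using hsurj
  have huniq : ∀ x y f, (x, y) ∈ Γ → (z : ℂ) • x - y = f → x = r f := by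
    intro x y f hxy hf
    have h1 := norm_le_of_mem_graph hdis (Γ.sub_mem hxy (hr f)) z
    have h2 : (z : ℂ) • (x - r f) - (y - a f) = 0 := by
      rw [smul_sub, sub_sub_sub_comm, hf, ha, sub_self]
    change (|z| - κ) * ‖x - r f‖ ≤ ‖(z : ℂ) • (x - r f) - (y - a f)‖ at h1
    rw [h2, norm_zero] at h1
    have h3 : ‖x - r f‖ ≤ 0 := nonpos_of_mul_nonpos_right h1 (by linarith)
    exact sub_eq_zero.1 (norm_le_zero_iff.1 h3)
  have hb : ∀ f, (|z| - κ) * ‖r f‖ ≤ ‖f‖ := fun f => by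
    have := norm_le_of_mem_graph hdis (hr f) z
    rwa [ha] at this
  let R₀ : H →ₗ[ℂ] H :=
    { toFun := r
      map_add' := fun f g => (huniq _ _ _ (Γ.add_mem (hr f) (hr g)) (by
        simp only [smul_add]
        rw [add_sub_add_comm, ha, ha])).symm
      map_smul' := fun c f => (huniq _ _ _ (Γ.smul_mem c (hr f)) (by
        simp only
        rw [smul_comm, ← smul_sub, ha])).symm }
  refine ⟨R₀.mkContinuous (|z| - κ)⁻¹ fun f => ?_, ⟨fun f => ?_, fun x y h => ?_⟩, hb⟩
  · rw [← div_eq_inv_mul, le_div_iff₀ (by linarith), mul_comm]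
    exact hb f
  · have : (z : ℂ) • r f - f = a f := by
      nth_rewrite 2 [← ha f]
      abel
    change (r f, (z : ℂ) • r f - f) ∈ Γ
    rw [this]
    exact hr f
  · exact (huniq _ _ _ h rfl).symm

/-- The resolvent identity $(z-w)RS=S-R$ and its mirror image give $(z-w)(RS-SR)=0$; for $z=w$ the
identity itself forces $R=S$. -/
lemma IsResolvent.commute {z w : ℝ} {R S : H →L[ℂ] H} (hR : IsResolvent Γ z R)
    (hS : IsResolvent Γ w S) : Commute R S := by
  have key : ∀ x, ((z : ℂ) - w) • (R (S x)) = S x - R x := fun x => by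
    have h := hR.apply_sub _ _ (hS.mem x)
    have e : (z : ℂ) • S x - ((w : ℂ) • S x - x) = ((z : ℂ) - w) • S x + x := by
      rw [sub_smul]; abel
    rw [e, map_add, map_smul] at h
    exact eq_sub_of_add_eq h
  have key' : ∀ x, ((w : ℂ) - z) • (S (R x)) = R x - S x := fun x => by
    have h := hS.apply_sub _ _ (hR.mem x)
    have e : (w : ℂ) • R x - ((z : ℂ) • R x - x) = ((w : ℂ) - z) • R x + x := by
      rw [sub_smul]; abel
    rw [e, map_add, map_smul] at h
    exact eq_sub_of_add_eq h
  rcases eq_or_ne z w with rfl | hzw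
  · have : R = S := by
      ext x
      have := key x
      rw [sub_self, zero_smul] at this
      exact (sub_eq_zero.1 this.symm).symm
    rw [this]
  · ext x
    have h1 := key x
    have h2 := key' x
    have h3 : ((z : ℂ) - w) • (R (S x) - S (R x)) = 0 := by
      rw [smul_sub, h1, ← neg_sub (w : ℂ) z, neg_smul, h2]
      abel
    have h4 : (z : ℂ) - w ≠ 0 := sub_ne_zero.2 (by exact_mod_cast hzw)
    exact sub_eq_zero.1 ((smul_eq_zero.1 h3).resolve_left h4)

/-- The operator `z² A (z² - A²)⁻¹`, built from the resolvents `R = (z - A)⁻¹` and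
`S = (-z - A)⁻¹`. -/
noncomputable def boundedApprox (z : ℝ) (R S : H →L[ℂ] H) : H →L[ℂ] H :=
  ((z : ℂ) ^ 2 / 2) • (R + S)

/-- The operator `z² (z² - A²)⁻¹`, built from the resolvents `R = (z - A)⁻¹` and
`S = (-z - A)⁻¹`. -/
noncomputable def mollifier (z : ℝ) (R S : H →L[ℂ] H) : H →L[ℂ] H :=
  ((z : ℂ) / 2) • (R - S)

variable {z : ℝ} {R S : H →L[ℂ] H}

/-- With $J_z=z^2(z^2-A^2)^{-1}$ and $A_z$ the bounded approximation, this is $AJ_z=A_z$; the next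
lemma is $AA_z=z^2(J_z-1)$. Both are linear combinations of $AR=zR-1$ and $AS=-zS-1$. -/
lemma mollifier_mem (hR : IsResolvent Γ z R) (hS : IsResolvent Γ (-z) S) (x : H) :
    (mollifier z R S x, boundedApprox z R S x) ∈ Γ := by
  have h := Γ.smul_mem ((z : ℂ) / 2) (Γ.sub_mem (hR.mem x) (hS.mem x))
  convert h using 1
  refine Prod.ext (by simp [mollifier]) ?_
  simp only [boundedApprox, smul_apply, add_apply,
    Prod.smul_snd, Prod.snd_sub, Complex.ofReal_neg]
  module

lemma boundedApprox_mem (hR : IsResolvent Γ z R) (hS : IsResolvent Γ (-z) S) (x : H) :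
    (boundedApprox z R S x, (z : ℂ) ^ 2 • (mollifier z R S x - x)) ∈ Γ := by
  have h := Γ.smul_mem ((z : ℂ) ^ 2 / 2) (Γ.add_mem (hR.mem x) (hS.mem x))
  convert h using 1
  refine Prod.ext (by simp [boundedApprox]) ?_
  simp only [mollifier, smul_apply, sub_apply,
    Prod.smul_snd, Prod.snd_add, Complex.ofReal_neg]
  module

lemma norm_resolvent_le {κ : ℝ} (hz : 2 * κ ≤ z) (hz0 : 0 < z)
    (hR : ∀ f, (|z| - κ) * ‖R f‖ ≤ ‖f‖) (x : H) : z * ‖R x‖ ≤ 2 * ‖x‖ := by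
  have h1 := hR x
  rw [abs_of_pos hz0] at h1
  nlinarith [norm_nonneg (R x)]

lemma norm_mollifier_le {κ : ℝ} (hz : 2 * κ ≤ z) (hz0 : 0 < z)
    (hR : ∀ f, (|z| - κ) * ‖R f‖ ≤ ‖f‖) (hS : ∀ f, (|z| - κ) * ‖S f‖ ≤ ‖f‖) (x : H) :
    ‖mollifier z R S x‖ ≤ 2 * ‖x‖ := by
  have h1 := norm_resolvent_le hz hz0 hR x
  have h2 := norm_resolvent_le hz hz0 hS x
  have h3 : ‖((z : ℂ) / 2)‖ = z / 2 := by
    rw [norm_div, Complex.norm_real, Real.norm_of_nonneg hz0.le]; norm_num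
  rw [mollifier, smul_apply, norm_smul, h3, sub_apply]
  nlinarith [norm_sub_le (R x) (S x)]

lemma norm_boundedApprox_le {κ : ℝ} (hz : 2 * κ ≤ z) (hz0 : 0 < z)
    (hR : ∀ f, (|z| - κ) * ‖R f‖ ≤ ‖f‖) (hS : ∀ f, (|z| - κ) * ‖S f‖ ≤ ‖f‖) (x : H) :
    ‖boundedApprox z R S x‖ ≤ 2 * z * ‖x‖ := by
  have h1 := norm_resolvent_le hz hz0 hR x
  have h2 := norm_resolvent_le hz hz0 hS x
  have h3 : ‖((z : ℂ) ^ 2 / 2)‖ = z ^ 2 / 2 := by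
    rw [norm_div, norm_pow, Complex.norm_real, Real.norm_of_nonneg hz0.le]; norm_num
  rw [boundedApprox, smul_apply, norm_smul, h3, add_apply]
  have h4 : z * ‖R x + S x‖ ≤ 4 * ‖x‖ := by nlinarith [norm_add_le (R x) (S x)]
  nlinarith

/-- Put $y=J_zx$ and $v=A_zx$ and split $(v,x)=(v,y)-(v,y-x)$. Since $v=Ay$, the first term is at
most $\kappa\|y\|^2\le4\kappa\|x\|^2$. Since $Av=z^2(y-x)$, the second is $z^{-2}$ times a quantity
bounded by $\kappa\|v\|^2\le4\kappa z^2\|x\|^2$. The powers of $z$ cancel, which is why this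
symmetric approximation is used. -/
lemma abs_re_inner_boundedApprox_le {κ : ℝ} (hκ : 0 ≤ κ)
    (hdis : ∀ x y, (x, y) ∈ Γ → |(inner ℂ y x).re| ≤ κ * ‖x‖ ^ 2)
    (hz : 2 * κ ≤ z) (hz0 : 0 < z) (hR : IsResolvent Γ z R) (hS : IsResolvent Γ (-z) S)
    (hR' : ∀ f, (|z| - κ) * ‖R f‖ ≤ ‖f‖) (hS' : ∀ f, (|z| - κ) * ‖S f‖ ≤ ‖f‖) (x : H) :
    |(inner ℂ (boundedApprox z R S x) x).re| ≤ 8 * κ * ‖x‖ ^ 2 := by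
  set y := mollifier z R S x
  set v := boundedApprox z R S x
  have h1 := hdis _ _ (mollifier_mem hR hS x)
  have h2 := hdis _ _ (boundedApprox_mem hR hS x)
  have h3 : ‖y‖ ≤ 2 * ‖x‖ := norm_mollifier_le hz hz0 hR' hS' x
  have h4 : ‖v‖ ≤ 2 * z * ‖x‖ := norm_boundedApprox_le hz hz0 hR' hS' x
  have e1 : (inner ℂ ((z : ℂ) ^ 2 • (y - x)) v).re = z ^ 2 * (inner ℂ v (y - x)).re := by
    rw [inner_smul_left, ← inner_conj_symm v (y - x), map_pow, Complex.conj_ofReal,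
      ← Complex.ofReal_pow, Complex.re_ofReal_mul, Complex.conj_re]
  have e2 : (inner ℂ v x).re = (inner ℂ v y).re - (inner ℂ v (y - x)).re := by
    rw [inner_sub_right, Complex.sub_re]; ring
  have h5 : |(inner ℂ v (y - x)).re| ≤ 4 * κ * ‖x‖ ^ 2 := by
    change |(inner ℂ ((z : ℂ) ^ 2 • (y - x)) v).re| ≤ κ * ‖v‖ ^ 2 at h2
    rw [e1, abs_mul, abs_of_pos (by positivity : 0 < z ^ 2)] at h2
    have h6 : ‖v‖ ^ 2 ≤ (2 * z * ‖x‖) ^ 2 := pow_le_pow_left₀ (norm_nonneg _) h4 2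
    have h7 : z ^ 2 * |(inner ℂ v (y - x)).re| ≤ z ^ 2 * (4 * κ * ‖x‖ ^ 2) := by
      refine h2.trans ((mul_le_mul_of_nonneg_left h6 hκ).trans (le_of_eq ?_))
      ring
    exact le_of_mul_le_mul_left h7 (by positivity)
  have h8 : |(inner ℂ v y).re| ≤ 4 * κ * ‖x‖ ^ 2 := by
    refine h1.trans ?_
    have h6 : ‖y‖ ^ 2 ≤ (2 * ‖x‖) ^ 2 := pow_le_pow_left₀ (norm_nonneg _) h3 2
    nlinarith
  rw [e2]
  calc _ ≤ |(inner ℂ v y).re| + |(inner ℂ v (y - x)).re| := abs_sub _ _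
    _ ≤ _ := by linarith

/-- On the domain $A_zx=J_zAx$, so convergence of $A_zx$ to $Ax$ reduces to strong convergence of
$J_z$ to the identity. -/
lemma boundedApprox_apply_of_mem (hR : IsResolvent Γ z R) (hS : IsResolvent Γ (-z) S) {x y : H}
    (h : (x, y) ∈ Γ) : boundedApprox z R S x = mollifier z R S y := by
  have h1 := hR.apply_sub _ _ h
  have h2 := hS.apply_sub _ _ h
  rw [map_sub, map_smul, sub_eq_iff_eq_add] at h1 h2
  have e1 : R y = (z : ℂ) • R x - x := by rw [h1]; abel
  have e2 : S y = ((-z : ℝ) : ℂ) • S x - x := by rw [h2]; abel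
  simp only [mollifier, boundedApprox, smul_apply,
    sub_apply, add_apply, e1, e2, Complex.ofReal_neg]
  module

/-- For $(x,y)$ in the graph, $J_zx-x=\frac12(Ry+Sy)$, and both resolvents are of size $2/z$. -/
lemma norm_mollifier_sub_le {κ : ℝ} (hz : 2 * κ ≤ z) (hz0 : 0 < z) (hR : IsResolvent Γ z R)
    (hS : IsResolvent Γ (-z) S)
    (hR' : ∀ f, (|z| - κ) * ‖R f‖ ≤ ‖f‖) (hS' : ∀ f, (|z| - κ) * ‖S f‖ ≤ ‖f‖) {x y : H}
    (h : (x, y) ∈ Γ) : ‖mollifier z R S x - x‖ ≤ 2 * ‖y‖ / z := by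
  have h1 := hR.apply_sub _ _ h
  have h2 := hS.apply_sub _ _ h
  rw [map_sub, map_smul, sub_eq_iff_eq_add] at h1 h2
  have e1 : R y = (z : ℂ) • R x - x := by rw [h1]; abel
  have e2 : S y = ((-z : ℝ) : ℂ) • S x - x := by rw [h2]; abel
  have e : mollifier z R S x - x = (1 / 2 : ℂ) • (R y + S y) := by
    simp only [mollifier, smul_apply,
      sub_apply, e1, e2, Complex.ofReal_neg]
    module
  rw [e, norm_smul, le_div_iff₀ hz0]
  have h3 := norm_resolvent_le hz hz0 hR' y
  have h4 := norm_resolvent_le hz hz0 hS' y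
  have h5 : ‖(1 / 2 : ℂ)‖ = 1 / 2 := by norm_num
  rw [h5]
  nlinarith [norm_add_le (R y) (S y)]

end Resolvent

/-! ### Generation of strongly continuous groups -/

section Generation
variable {H : Type*} [NormedAddCommGroup H] [InnerProductSpace ℂ H]

lemma exists_boundedApprox {Γ : Submodule ℂ (H × H)} {κ : ℝ} (hκ : 0 ≤ κ)
    (hdis : ∀ x y, (x, y) ∈ Γ → |(inner ℂ y x).re| ≤ κ * ‖x‖ ^ 2)
    (hsurj : ∀ z : ℝ, κ < |z| → ∀ f, ∃ x y, (x, y) ∈ Γ ∧ (z : ℂ) • x - y = f)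
    (hdense : Dense {x | ∃ y, (x, y) ∈ Γ}) :
    ∃ B : ℕ → H →L[ℂ] H, (∀ n x, |(inner ℂ (B n x) x).re| ≤ 8 * κ * ‖x‖ ^ 2) ∧
      (∀ n m, Commute (B n) (B m)) ∧
      (∀ x y, (x, y) ∈ Γ → Tendsto (fun n => B n x) atTop (𝓝 y)) ∧
      ∃ z R, IsResolvent Γ z R ∧ ∀ n, Commute R (B n) := by
  have hres : ∀ z : ℝ, κ < |z| → ∃ R, IsResolvent Γ z R ∧ ∀ f, (|z| - κ) * ‖R f‖ ≤ ‖f‖ :=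
    fun z hz => exists_isResolvent hdis hz (hsurj z hz)
  -- Any sequence tending to infinity with $z_n\ge2\kappa$ would do; the $1$ keeps $z_n$ positive
  -- when $\kappa=0$.
  let z : ℕ → ℝ := fun n => 2 * κ + 1 + n
  have hz0 : ∀ n, 0 < z n := fun n => by positivity
  have hz : ∀ n, 2 * κ ≤ z n := fun n => by
    have : (0 : ℝ) ≤ n := n.cast_nonneg
    change 2 * κ ≤ 2 * κ + 1 + n
    linarith
  have hz1 : ∀ n, κ < |z n| := fun n => by
    rw [abs_of_pos (hz0 n)]
    have : (0 : ℝ) ≤ n := n.cast_nonneg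
    change κ < 2 * κ + 1 + n
    linarith
  choose R hR hR' using fun n => hres (z n) (hz1 n)
  choose S hS hS' using fun n => hres (-z n) ((hz1 n).trans_eq (abs_neg _).symm)
  simp only [abs_neg] at hS'
  have hcomm : ∀ (w : ℝ) (T : H →L[ℂ] H), IsResolvent Γ w T →
      ∀ n, Commute T (boundedApprox (z n) (R n) (S n)) := fun w T hT n =>
    ((hT.commute (hR n)).add_right (hT.commute (hS n))).smul_right _
  refine ⟨fun n => boundedApprox (z n) (R n) (S n), fun n x =>
    abs_re_inner_boundedApprox_le hκ hdis (hz n) (hz0 n) (hR n) (hS n) (hR' n) (hS' n) x,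
    fun n m => ((hcomm _ _ (hR n) m).add_left (hcomm _ _ (hS n) m)).smul_left _, ?_,
    z 0, R 0, hR 0, hcomm _ _ (hR 0)⟩
  intro x y hxy
  have e : ∀ n, boundedApprox (z n) (R n) (S n) x = mollifier (z n) (R n) (S n) y := fun n =>
    boundedApprox_apply_of_mem (hR n) (hS n) hxy
  simp only [e]
  have hzt : Tendsto z atTop atTop := tendsto_atTop_add_const_left _ _ tendsto_natCast_atTop_atTop
  rw [Metric.tendsto_atTop]
  intro ε hε
  -- $J_z\to1$ is known only on the domain, so $y$ is replaced by a nearby $y'$ in it. As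
  -- $\|J_z\|\le2$, the error budget is $2\cdot\varepsilon/6+\varepsilon/2+\varepsilon/6$.
  obtain ⟨y', ⟨w, hw⟩, hy'⟩ := hdense.exists_dist_lt y (by positivity : 0 < ε / 6)
  rw [dist_eq_norm] at hy'
  have h1 : Tendsto (fun n => 2 * ‖w‖ / z n) atTop (𝓝 0) := hzt.const_div_atTop _
  obtain ⟨N, hN⟩ := (h1.eventually_lt_const (by positivity : 0 < ε / 2)).exists_forall_of_atTop
  refine ⟨N, fun n hn => ?_⟩
  have h2 := norm_mollifier_sub_le (hz n) (hz0 n) (hR n) (hS n) (hR' n) (hS' n) hw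
  have h3 := norm_mollifier_le (hz n) (hz0 n) (hR' n) (hS' n) (y - y')
  have h4 := hN n hn
  rw [dist_eq_norm]
  have e2 : mollifier (z n) (R n) (S n) y - y = mollifier (z n) (R n) (S n) (y - y') +
      (mollifier (z n) (R n) (S n) y' - y') - (y - y') := by
    rw [map_sub]; abel
  rw [e2]
  calc _ ≤ ‖mollifier (z n) (R n) (S n) (y - y')‖ + ‖mollifier (z n) (R n) (S n) y' - y'‖
        + ‖y - y'‖ := (norm_sub_le _ _).trans (by gcongr; exact norm_add_le _ _)
    _ < ε := by linarith

variable [CompleteSpace H]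

/-- The exponentials of a sequence of commuting bounded operators converge to a strongly continuous
group, if the operators converge strongly on a dense set and the real parts of their numerical
ranges are uniformly bounded. -/
lemma exists_isC0Group_of_tendsto {B : ℕ → H →L[ℂ] H} {C : ℝ} (hC : 0 ≤ C)
    (hB : ∀ n x, |(inner ℂ (B n x) x).re| ≤ C * ‖x‖ ^ 2) (hc : ∀ n m, Commute (B n) (B m))
    {D : Set H} (hD : Dense D) (hlim : ∀ x ∈ D, CauchySeq fun n => B n x) :
    ∃ T : ℝ → H →L[ℂ] H, IsC0Group T ∧
      ∀ t x, Tendsto (fun n => NormedSpace.exp (t • B n) x) atTop (𝓝 (T t x)) := by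
  let _ : NormedAlgebra ℚ (H →L[ℂ] H) := .restrictScalars ℚ ℂ _
  have hcau : ∀ (N : ℝ) (x : H), UniformCauchySeqOn
      (fun n t => NormedSpace.exp (t • B n) x) atTop (Icc (-N) N) := by
    intro N x
    rw [Metric.uniformCauchySeqOn_iff]
    intro ε hε
    set K := Real.exp (C * |N|)
    have hK : 0 < K := Real.exp_pos _
    -- The exponentials are bounded by $K$ on $[-N,N]$: moving from $x$ to $x'\in D$ costs less than
    -- $\varepsilon/4$ for each of the two indices, and the Duhamel estimate at $x'$ less than
    -- $\varepsilon/2$.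
    obtain ⟨x', hx', hxx'⟩ := hD.exists_dist_lt x (by positivity : 0 < ε / (4 * K))
    rw [dist_eq_norm, lt_div_iff₀ (by positivity)] at hxx'
    obtain ⟨n₀, hn₀⟩ := Metric.cauchySeq_iff.1 (hlim x' hx') (ε / (2 * (|N| + 1) * K))
      (by positivity)
    refine ⟨n₀, fun m hm n hn t ht => ?_⟩
    have ht' : |t| ≤ |N| := (abs_le.2 ht).trans (le_abs_self N)
    have hexp : Real.exp (C * |t|) ≤ K := Real.exp_le_exp.2 (by gcongr)
    have h1 : ∀ k, ‖NormedSpace.exp (t • B k) (x - x')‖ ≤ K * ‖x - x'‖ := fun k =>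
      (norm_exp_smul_apply_le (hB k) t _).trans (by gcongr)
    have h2 : ‖NormedSpace.exp (t • B m) x' - NormedSpace.exp (t • B n) x'‖
        ≤ (|N| + 1) * K * ‖B m x' - B n x'‖ :=
      (norm_exp_smul_sub_exp_smul_apply_le (hB n) (hB m) (hc n m) t x').trans (by
        gcongr
        linarith)
    have h3 := hn₀ m hm n hn
    rw [dist_eq_norm, lt_div_iff₀ (by positivity)] at h3
    rw [dist_eq_norm]
    have e : NormedSpace.exp (t • B m) x - NormedSpace.exp (t • B n) x =
        NormedSpace.exp (t • B m) (x - x') +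
          (NormedSpace.exp (t • B m) x' - NormedSpace.exp (t • B n) x') -
          NormedSpace.exp (t • B n) (x - x') := by
      rw [map_sub, map_sub]; abel
    rw [e]
    calc _ ≤ ‖NormedSpace.exp (t • B m) (x - x')‖ +
          ‖NormedSpace.exp (t • B m) x' - NormedSpace.exp (t • B n) x'‖ +
          ‖NormedSpace.exp (t • B n) (x - x')‖ :=
          (norm_sub_le _ _).trans (by gcongr; exact norm_add_le _ _)
      _ < ε := by nlinarith [h1 m, h1 n]
  have hex : ∀ (t : ℝ) (x : H), ∃ y, Tendsto (fun n => NormedSpace.exp (t • B n) x) atTop (𝓝 y) := by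
    intro t x
    exact cauchySeq_tendsto_of_complete ((hcau |t| x).cauchySeq (abs_le.1 le_rfl))
  choose L hL using hex
  have hL' : ∀ t : ℝ, Tendsto (fun n x => NormedSpace.exp (t • B n) x) atTop (𝓝 (L t)) := fun t =>
    tendsto_pi_nhds.2 (hL t)
  -- Continuity of the pointwise limit is the Banach–Steinhaus theorem.
  let T : ℝ → H →L[ℂ] H := fun t => continuousLinearMapOfTendsto _ (hL' t)
  have hT : ∀ t x, Tendsto (fun n => NormedSpace.exp (t • B n) x) atTop (𝓝 (T t x)) := hL
  refine ⟨T, ⟨?_, ?_, ?_⟩, hT⟩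
  · ext x
    refine tendsto_nhds_unique (hT 0 x) ?_
    simp
  · intro s t
    ext x
    refine tendsto_nhds_unique (hT (s + t) x) ?_
    -- In the product of exponentials, the inner one is replaced by its limit; the error is carried
    -- by an exponential bounded uniformly in $n$ and tends to zero.
    have e : ∀ n, NormedSpace.exp ((s + t) • B n) x =
        NormedSpace.exp (s • B n) (NormedSpace.exp (t • B n) x - T t x) +
          NormedSpace.exp (s • B n) (T t x) := fun n => by
      rw [add_smul, NormedSpace.exp_add_of_commute
        (((Commute.refl (B n)).smul_left s).smul_right t), mul_apply_eq_comp, map_sub]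
      abel
    simp only [e]
    rw [ContinuousLinearMap.comp_apply]
    rw [← zero_add ((T s) ((T t) x))]
    refine Tendsto.add ?_ (hT s _)
    refine squeeze_zero_norm (fun n => norm_exp_smul_apply_le (hB n) s _) ?_
    have h0 : Tendsto (fun n => NormedSpace.exp (t • B n) x - T t x) atTop (𝓝 0) := by
      simpa using (hT t x).sub_const (T t x)
    simpa using h0.norm.const_mul (Real.exp (C * |s|))
  · intro x
    rw [continuous_iff_continuousAt]
    intro t
    -- Convergence is uniform on an interval containing $t$ in its interior, so continuity of the
    -- orbits passes to the limit.
    have hu := (hcau (|t| + 1) x).tendstoUniformlyOn_of_tendsto (fun s _ => hT s x)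
    refine (hu.continuousOn (Eventually.of_forall fun n => ?_).frequently).continuousAt ?_
    · have : Continuous fun s => NormedSpace.exp (s • B n) x :=
        continuous_iff_continuousAt.2 fun s =>
          (hasDerivAt_apply_vector (hasDerivAt_exp_smul_const (𝕂 := ℝ) (B n) s) x).continuousAt
      exact this.continuousOn
    · have := abs_le.1 (le_refl |t|)
      exact Icc_mem_nhds (by linarith) (by linarith)

lemma exp_smul_apply_eq_add_integral (B : H →L[ℂ] H) (x : H) (t : ℝ) :
    NormedSpace.exp (t • B) x = x + ∫ s in (0 : ℝ)..t, NormedSpace.exp (s • B) (B x) := by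
  have h : ∀ s, HasDerivAt (fun s : ℝ => NormedSpace.exp (s • B) x)
      (NormedSpace.exp (s • B) (B x)) s := fun s =>
    hasDerivAt_apply_vector (hasDerivAt_exp_smul_const (𝕂 := ℝ) B s) x
  have hc : Continuous fun s : ℝ => NormedSpace.exp (s • B) (B x) :=
    continuous_iff_continuousAt.2 fun s =>
      (hasDerivAt_apply_vector (hasDerivAt_exp_smul_const (𝕂 := ℝ) B s) (B x)).continuousAt
  rw [intervalIntegral.integral_eq_sub_of_hasDerivAt (fun s _ => h s) (hc.intervalIntegrable _ _)]
  simp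

/-- On the graph of $A$ the formula $T_tx=x+\int_0^tT_sAx\,ds$ is inherited from the approximations,
so the generator extends $A$. It is no larger, because the resolvent of $A$ commutes with the group
and turns any difference quotient into one taken at a point of the domain. -/
lemma isGenerator_of_tendsto {A : H →ₗ.[ℂ] H} {B : ℕ → H →L[ℂ] H} {C : ℝ} (hC : 0 ≤ C)
    (hB : ∀ n x, |(inner ℂ (B n x) x).re| ≤ C * ‖x‖ ^ 2)
    (hlim : ∀ x y, (x, y) ∈ A.graph → Tendsto (fun n => B n x) atTop (𝓝 y))
    {z : ℝ} {R : H →L[ℂ] H} (hR : IsResolvent A.graph z R) (hRB : ∀ n, Commute R (B n))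
    {T : ℝ → H →L[ℂ] H} (hT : IsC0Group T)
    (hTB : ∀ t x, Tendsto (fun n => NormedSpace.exp (t • B n) x) atTop (𝓝 (T t x))) :
    IsGenerator A T := by
  have fwd : ∀ x y, (x, y) ∈ A.graph →
      Tendsto (fun h : ℝ => ((h : ℂ))⁻¹ • (T h x - x)) (𝓝[≠] 0) (𝓝 y) := by
    intro x y hxy
    -- Dominated convergence in the identity for $e^{tB_n}$; the dominating constant uses that the
    -- convergent sequence $B_nx$ is bounded.
    have hint : ∀ t, T t x = x + ∫ s in (0 : ℝ)..t, T s y := by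
      intro t
      refine tendsto_nhds_unique (hTB t x) ?_
      simp only [fun n => exp_smul_apply_eq_add_integral (B n) x t]
      refine tendsto_const_nhds.add ?_
      obtain ⟨b, hb⟩ := (hlim x y hxy).norm.bddAbove_range
      refine intervalIntegral.tendsto_integral_filter_of_dominated_convergence
        (fun _ => Real.exp (C * |t|) * b) (Eventually.of_forall fun n => ?_)
        (Eventually.of_forall fun n => Eventually.of_forall fun s hs => ?_) (by simp)
        (Eventually.of_forall fun s _ => ?_)
      · have : Continuous fun s => NormedSpace.exp (s • B n) (B n x) :=
          continuous_iff_continuousAt.2 fun s => (hasDerivAt_apply_vector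
            (hasDerivAt_exp_smul_const (𝕂 := ℝ) (B n) s) (B n x)).continuousAt
        exact this.aestronglyMeasurable
      · have hst : |s| ≤ |t| := by
          have h := abs_sub_left_of_mem_uIcc (uIoc_subset_uIcc hs)
          simpa using h
        refine (norm_exp_smul_apply_le (hB n) s _).trans ?_
        have hbn : ‖B n x‖ ≤ b := hb ⟨n, rfl⟩
        gcongr
      · have e : ∀ n, NormedSpace.exp (s • B n) (B n x) =
            NormedSpace.exp (s • B n) (B n x - y) + NormedSpace.exp (s • B n) y := fun n => by
          rw [map_sub]; abel
        simp only [e]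
        rw [← zero_add (T s y)]
        refine Tendsto.add ?_ (hTB s y)
        refine squeeze_zero_norm (fun n => norm_exp_smul_apply_le (hB n) s _) ?_
        have h0 : Tendsto (fun n => B n x - y) atTop (𝓝 0) := by
          simpa using (hlim x y hxy).sub_const y
        simpa using h0.norm.const_mul (Real.exp (C * |s|))
    have hd : HasDerivAt (fun t => T t x) y 0 := by
      have h1 : HasDerivAt (fun t => x + ∫ s in (0 : ℝ)..t, T s y) (T 0 y) 0 :=
        ((hT.continuous_orbit y).integral_hasStrictDerivAt 0 0).hasDerivAt.const_add x
      rw [hT.map_zero] at h1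
      exact h1.congr_of_eventuallyEq (Eventually.of_forall hint)
    rw [hasDerivAt_iff_tendsto_slope_zero] at hd
    refine hd.congr fun t => ?_
    rw [zero_add, hT.map_zero, RCLike.real_smul_eq_coe_smul (K := ℂ)]
    simp
  have hgraph : ∀ x y, (∃ hx : x ∈ A.domain, A ⟨x, hx⟩ = y) ↔ (x, y) ∈ A.graph := by
    intro x y
    rw [LinearPMap.mem_graph_iff]
    exact ⟨fun ⟨hx, h⟩ => ⟨⟨x, hx⟩, rfl, h⟩, fun ⟨⟨x', hx'⟩, h1, h2⟩ => by
      obtain rfl : x' = x := h1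
      exact ⟨hx', h2⟩⟩
  intro x y
  rw [hgraph]
  refine ⟨fwd x y, fun h => ?_⟩
  have hRT : ∀ t x, R (T t x) = T t (R x) := by
    intro t x
    refine tendsto_nhds_unique ((R.continuous.tendsto _).comp (hTB t x)) ?_
    refine (hTB t (R x)).congr fun n => ?_
    exact (congrArg (fun Z : H →L[ℂ] H => Z x) ((hRB n).smul_right t).exp_right.eq).symm
  have h1 := (R.continuous.tendsto _).comp h
  have h2 := fwd _ _ (hR.mem x)
  -- Two computations of the derivative of $T_hRx$ at $h=0$: as $R$ applied to the given limit, and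
  -- as $ARx$. Rearranged, $x=R(zx-y)$, so $x$ lies in the range of the resolvent and $Ax=y$.
  have h3 : R y = (z : ℂ) • R x - x := by
    refine tendsto_nhds_unique h1 (h2.congr fun t => ?_)
    simp [hRT]
  have h4 : x = R ((z : ℂ) • x - y) := by
    rw [map_sub, map_smul, h3]; abel
  have h5 := hR.mem ((z : ℂ) • x - y)
  rw [← h4] at h5
  simpa using h5

theorem generatesC0Group_of_abs_re_inner_le {A : H →ₗ.[ℂ] H} {κ : ℝ} (hκ : 0 ≤ κ)
    (hdis : ∀ x y, (x, y) ∈ A.graph → |(inner ℂ y x).re| ≤ κ * ‖x‖ ^ 2)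
    (hsurj : ∀ z : ℝ, κ < |z| → ∀ f, ∃ x y, (x, y) ∈ A.graph ∧ (z : ℂ) • x - y = f) :
    GeneratesC0Group A := by
  -- Density follows from the range condition. If $x$ is orthogonal to the domain and
  -- $(\kappa+1)u-Au=x$, then $0=\operatorname{Re}(x,u)\ge\|u\|^2$, hence $u=0$ and $x=0$.
  have hdense : Dense {x | ∃ y, (x, y) ∈ A.graph} := by
    have e : {x | ∃ y, (x, y) ∈ A.graph} = (A.domain : Set H) := by
      ext x
      exact LinearPMap.mem_domain_iff.symm
    rw [e, Submodule.dense_iff_topologicalClosure_eq_top, Submodule.topologicalClosure_eq_top_iff,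
      Submodule.eq_bot_iff]
    intro x hx
    obtain ⟨u, y, huy, hux⟩ := hsurj (κ + 1) (by rw [abs_of_pos] <;> linarith) x
    have h0 : inner ℂ u x = 0 := hx u (LinearPMap.mem_domain_iff.2 ⟨y, huy⟩)
    have hre : (inner ℂ x u).re = 0 := by
      rw [← inner_conj_symm, h0]; simp
    have h1 : (inner ℂ (((κ + 1 : ℝ) : ℂ) • u - y) u).re
        = (κ + 1) * ‖u‖ ^ 2 - (inner ℂ y u).re := by
      rw [inner_sub_left, inner_smul_left, Complex.sub_re, Complex.conj_ofReal,
        Complex.re_ofReal_mul]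
      congr 2
      exact inner_self_eq_norm_sq (𝕜 := ℂ) u
    rw [hux, hre] at h1
    have h2 := (abs_le.1 (hdis u y huy)).2
    have h3 : ‖u‖ ^ 2 ≤ 0 := by linarith
    have h4 : u = 0 := norm_eq_zero.1 (pow_eq_zero_iff two_ne_zero |>.1
      (le_antisymm h3 (sq_nonneg _)))
    subst h4
    have h5 : y = 0 := A.graph_fst_eq_zero_snd huy rfl
    rw [← hux, h5, smul_zero, sub_zero]
  obtain ⟨B, hB, hc, hlim, z, R, hR, hRB⟩ := exists_boundedApprox hκ hdis hsurj hdense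
  obtain ⟨T, hT, hTB⟩ := exists_isC0Group_of_tendsto (by positivity) hB hc hdense
    (fun x ⟨y, hxy⟩ => (hlim x y hxy).cauchySeq)
  exact ⟨T, hT, isGenerator_of_tendsto (by positivity) hB hlim hR hRB hT hTB⟩

end Generation

/-! ### Transfer of generation to an equivalent inner product -/

section Renorm
variable {H : Type*} [NormedAddCommGroup H] [NormedSpace ℂ H]

/-- The vector space `H`, with the norm given by the inner product `core`. -/
def Renormed (_core : InnerProductSpace.Core ℂ H) : Type _ := H

noncomputable instance (core : InnerProductSpace.Core ℂ H) : NormedAddCommGroup (Renormed core) :=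
  core.toNormedAddCommGroup

noncomputable instance (core : InnerProductSpace.Core ℂ H) :
    InnerProductSpace ℂ (Renormed core) :=
  InnerProductSpace.ofCore core.toCore

lemma Renormed.norm_sq (core : InnerProductSpace.Core ℂ H) (x : Renormed core) :
    ‖x‖ ^ 2 = (core.inner x x).re := (inner_self_eq_norm_sq (𝕜 := ℂ) x).symm

lemma generatesC0Group_of_continuousLinearEquiv {H' : Type*} [NormedAddCommGroup H']
    [NormedSpace ℂ H'] (e : H ≃L[ℂ] H') {A : H →ₗ.[ℂ] H} {A' : H' →ₗ.[ℂ] H'}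
    (h : ∀ x y, (∃ hx : x ∈ A.domain, A ⟨x, hx⟩ = y) ↔
      ∃ hx : e x ∈ A'.domain, A' ⟨e x, hx⟩ = e y)
    (hA' : GeneratesC0Group A') : GeneratesC0Group A := by
  obtain ⟨T, hT, hG⟩ := hA'
  refine ⟨fun t => (e.symm : H' →L[ℂ] H) ∘L T t ∘L (e : H →L[ℂ] H'), ⟨?_, ?_, ?_⟩, ?_⟩
  · ext x; simp [hT.map_zero]
  · intro s t
    ext x; simp [hT.map_add]
  · intro x
    exact e.symm.continuous.comp (hT.continuous_orbit (e x))
  · intro x y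
    rw [h, hG]
    constructor
    · intro hh
      have := (e.symm.continuous.tendsto _).comp hh
      simpa [Function.comp_def] using this
    · intro hh
      have := (e.continuous.tendsto _).comp hh
      simpa [Function.comp_def] using this

theorem generatesC0Group_of_core [CompleteSpace H] (core : InnerProductSpace.Core ℂ H) {c C : ℝ}
    (hc : 0 < c) (hlower : ∀ x, c * ‖x‖ ^ 2 ≤ (core.inner x x).re)
    (hupper : ∀ x, (core.inner x x).re ≤ C * ‖x‖ ^ 2) {A : H →ₗ.[ℂ] H} {κ : ℝ} (hκ : 0 ≤ κ)
    (hdis : ∀ u : A.domain, |(core.inner (A u) u).re| ≤ κ * (core.inner (u : H) u).re)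
    (hsurj : ∀ z : ℝ, κ < |z| → ∀ f, ∃ u : A.domain, (z : ℂ) • (u : H) - A u = f) :
    GeneratesC0Group A := by
  let e₀ : H ≃ₗ[ℂ] Renormed core := LinearEquiv.refl ℂ H
  let e : H ≃L[ℂ] Renormed core := e₀.toContinuousLinearEquivOfBounds (Real.sqrt |C|)
    (Real.sqrt c⁻¹) (fun x => by
      refine le_of_sq_le_sq ?_ (by positivity)
      rw [Renormed.norm_sq, mul_pow, Real.sq_sqrt (abs_nonneg C)]
      exact (hupper x).trans (by gcongr; exact le_abs_self C)) (fun x => by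
      refine le_of_sq_le_sq ?_ (by positivity)
      rw [mul_pow, Real.sq_sqrt (by positivity), Renormed.norm_sq, ← div_eq_inv_mul,
        le_div_iff₀ hc, mul_comm]
      exact hlower x)
  -- Both spaces have the same underlying vector space, so the operator and its graph are unchanged;
  -- only norm and topology differ.
  let A' : Renormed core →ₗ.[ℂ] Renormed core := A
  have : CompleteSpace (Renormed core) := (completeSpace_congr (e := e.toEquiv) e.isUniformEmbedding).1 inferInstance
  refine generatesC0Group_of_continuousLinearEquiv e (A' := A') (fun x y => Iff.rfl)
    (generatesC0Group_of_abs_re_inner_le hκ ?_ ?_)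
  · intro x y hxy
    obtain ⟨u, hu, hAu⟩ := (LinearPMap.mem_graph_iff A').1 hxy
    dsimp only at hu hAu
    rw [← hu, ← hAu, Renormed.norm_sq]
    exact hdis u
  · intro z hz f
    obtain ⟨u, hu⟩ := hsurj z hz f
    exact ⟨_, _, A'.mem_graph u, hu⟩

end Renorm

/-! ### The energy identity on an edge -/

/-- A function whose increments are dominated by those of an absolutely continuous one inherits
absolute continuity. This avoids a product rule for the vector- and operator-valued factors of the
energy density. -/
lemma absolutelyContinuousOnInterval_of_dist_le {X Y : Type*} [PseudoMetricSpace X]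
    [PseudoMetricSpace Y] {f : ℝ → X} {F : ℝ → Y} {a b C : ℝ}
    (hF : AbsolutelyContinuousOnInterval F a b)
    (h : ∀ x ∈ uIcc a b, ∀ y ∈ uIcc a b, dist (f x) (f y) ≤ C * dist (F x) (F y)) :
    AbsolutelyContinuousOnInterval f a b := by
  rw [absolutelyContinuousOnInterval_iff] at hF ⊢
  intro ε hε
  obtain ⟨δ, hδ, hF⟩ := hF (ε / (|C| + 1)) (by positivity)
  refine ⟨δ, hδ, fun I hI hlt => ?_⟩
  have h1 := hF I hI hlt
  rw [lt_div_iff₀ (by positivity)] at h1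
  refine lt_of_le_of_lt ?_ h1
  rw [Finset.sum_mul]
  refine Finset.sum_le_sum fun i hi => ?_
  obtain ⟨hx, hy⟩ := hI.1 i hi
  refine (h _ hx _ hy).trans ?_
  rw [mul_comm]
  gcongr
  linarith [le_abs_self C]

section Energy
variable {E : Type*} [NormedAddCommGroup E] [InnerProductSpace ℂ E]

/-- Symmetry of $H(x)$ makes the two terms containing $w'$ complex conjugates, so their real parts
add up to twice one of them. -/
lemma hasDerivAt_re_inner_apply {Hf : ℝ → E →L[ℂ] E} {H' : E →L[ℂ] E} {w : ℝ → E} {g : E} {x : ℝ}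
    (hH : HasDerivAt Hf H' x) (hw : HasDerivAt w g x)
    (hsymm : ∀ a b, inner ℂ (Hf x a) b = inner ℂ a (Hf x b)) :
    HasDerivAt (fun x => (inner ℂ (w x) (Hf x (w x))).re)
      (2 * (inner ℂ (w x) (Hf x g)).re + (inner ℂ (w x) (H' (w x))).re) x := by
  have h1 : HasDerivAt (fun x => (Hf x).restrictScalars ℝ) (H'.restrictScalars ℝ) x :=
    (ContinuousLinearMap.restrictScalarsL ℂ E E ℝ ℝ).hasFDerivAt.comp_hasDerivAt x hH
  have h2 : HasDerivAt (fun x => Hf x (w x)) (H' (w x) + Hf x g) x := h1.clm_apply hw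
  have h3 := (hw.inner ℂ h2)
  have h4 : HasDerivAt (fun x => (inner ℂ (w x) (Hf x (w x))).re)
      (inner ℂ (w x) (H' (w x) + Hf x g) + inner ℂ g (Hf x (w x))).re x :=
    Complex.reCLM.hasFDerivAt.comp_hasDerivAt x h3
  refine h4.congr_deriv ?_
  rw [← hsymm g (w x), ← inner_conj_symm (Hf x g) (w x), inner_add_right, Complex.add_re,
    Complex.add_re, Complex.conj_re]
  ring

/-- The density $f=\operatorname{Re}(w,Hw)$ is absolutely continuous, with
$f'=2\operatorname{Re}(w,Hg)+\operatorname{Re}(w,H'w)$ almost everywhere and $\|H'\|\le K$. The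
fundamental theorem of calculus leaves only the last term as error, and it contains no derivative of
$w$. -/
lemma abs_energy_sub_le [FiniteDimensional ℂ E] {ℓ : ℝ} (hℓ : 0 < ℓ) {Hf : ℝ → E →L[ℂ] E} {K : NNReal}
    (hH : LipschitzOnWith K Hf (Icc 0 ℓ))
    (hsymm : ∀ x ∈ Icc 0 ℓ, ∀ a b, inner ℂ (Hf x a) b = inner ℂ a (Hf x b))
    {w g : ℝ → E} (hg : IntervalIntegrable g volume 0 ℓ)
    (hw : ∀ x ∈ Icc 0 ℓ, w x = w 0 + ∫ t in (0 : ℝ)..x, g t) :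
    |(inner ℂ (w ℓ) (Hf ℓ (w ℓ))).re - (inner ℂ (w 0) (Hf 0 (w 0))).re
      - 2 * ∫ x in (0 : ℝ)..ℓ, (inner ℂ (w x) (Hf x (g x))).re|
      ≤ K * ∫ x in (0 : ℝ)..ℓ, ‖w x‖ ^ 2 := by
  have hI : uIcc 0 ℓ = Icc 0 ℓ := uIcc_of_le hℓ.le
  have h0 : (0 : ℝ) ∈ Icc 0 ℓ := ⟨le_rfl, hℓ.le⟩
  have hgx : ∀ x ∈ Icc 0 ℓ, ∀ y ∈ Icc 0 ℓ, IntervalIntegrable g volume x y := fun x hx y hy =>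
    hg.mono_set ((uIcc_subset_uIcc (by rwa [hI]) (by rwa [hI])))
  have hdiff : ∀ x ∈ Icc 0 ℓ, ∀ y ∈ Icc 0 ℓ, w y - w x = ∫ t in x..y, g t := by
    intro x hx y hy
    rw [hw x hx, hw y hy, add_sub_add_left_eq_sub,
      intervalIntegral.integral_interval_sub_left (hgx 0 h0 y hy) (hgx 0 h0 x hx)]
  have hwc : ContinuousOn w (Icc 0 ℓ) := by
    have h1 : ContinuousOn (fun x => w 0 + ∫ t in (0 : ℝ)..x, g t) (Icc 0 ℓ) := by
      rw [← hI]
      exact continuousOn_const.add (intervalIntegral.continuousOn_primitive_interval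
        (by rw [hI, integrableOn_Icc_iff_integrableOn_Ioc]
            exact (intervalIntegrable_iff_integrableOn_Ioc_of_le hℓ.le).1 hg))
    exact h1.congr hw
  obtain ⟨W, hW⟩ := isCompact_Icc.exists_bound_of_continuousOn hwc
  obtain ⟨L, hL⟩ := isCompact_Icc.exists_bound_of_continuousOn hH.continuousOn
  have hW0 : 0 ≤ W := (norm_nonneg _).trans (hW 0 h0)
  have hL0 : 0 ≤ L := (norm_nonneg _).trans (hL 0 h0)
  set f : ℝ → ℝ := fun x => (inner ℂ (w x) (Hf x (w x))).re with hf
  -- absolute continuity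
  let F : ℝ → ℝ := fun x => (∫ t in (0 : ℝ)..x, ‖g t‖) + x
  have hFac : AbsolutelyContinuousOnInterval F 0 ℓ :=
    (hg.norm.absolutelyContinuousOnInterval_intervalIntegral left_mem_uIcc).add
      (LipschitzWith.id.lipschitzOnWith.absolutelyContinuousOnInterval)
  have hFd : ∀ x ∈ Icc 0 ℓ, ∀ y ∈ Icc 0 ℓ, x ≤ y →
      ‖w y - w x‖ ≤ dist (F x) (F y) ∧ y - x ≤ dist (F x) (F y) := by
    intro x hx y hy hxy
    have e : F y - F x = (∫ t in x..y, ‖g t‖) + (y - x) := by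
      change (∫ t in (0 : ℝ)..y, ‖g t‖) + y - ((∫ t in (0 : ℝ)..x, ‖g t‖) + x) = _
      rw [← intervalIntegral.integral_interval_sub_left (hgx 0 h0 y hy).norm (hgx 0 h0 x hx).norm]
      ring
    have hn : 0 ≤ ∫ t in x..y, ‖g t‖ :=
      intervalIntegral.integral_nonneg hxy fun _ _ => norm_nonneg _
    have h1 : ‖w y - w x‖ ≤ ∫ t in x..y, ‖g t‖ := by
      rw [hdiff x hx y hy]
      exact intervalIntegral.norm_integral_le_integral_norm hxy
    have h2 : dist (F x) (F y) = (∫ t in x..y, ‖g t‖) + (y - x) := by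
      rw [dist_comm, Real.dist_eq, e, abs_of_nonneg (by linarith)]
    rw [h2]
    constructor <;> linarith
  have hfd : ∀ x ∈ Icc 0 ℓ, ∀ y ∈ Icc 0 ℓ, x ≤ y →
      dist (f x) (f y) ≤ (2 * W * L + W ^ 2 * K) * dist (F x) (F y) := by
    intro x hx y hy hxy
    obtain ⟨h1, h2⟩ := hFd x hx y hy hxy
    have e : f y - f x = (inner ℂ (w y - w x) (Hf y (w y))).re +
        (inner ℂ (w x) ((Hf y - Hf x) (w y))).re + (inner ℂ (w x) (Hf x (w y - w x))).re := by
      simp only [hf, inner_sub_left, inner_sub_right, sub_apply, map_sub, Complex.sub_re]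
      ring
    have b1 : |(inner ℂ (w y - w x) (Hf y (w y))).re| ≤ dist (F x) (F y) * (L * W) :=
      (Complex.abs_re_le_norm _).trans <| (norm_inner_le_norm _ _).trans <|
        mul_le_mul h1 (((Hf y).le_opNorm _).trans
          (mul_le_mul (hL y hy) (hW y hy) (norm_nonneg _) hL0)) (norm_nonneg _) dist_nonneg
    have b2 : |(inner ℂ (w x) ((Hf y - Hf x) (w y))).re| ≤ W * (K * dist (F x) (F y) * W) := by
      refine (Complex.abs_re_le_norm _).trans <| (norm_inner_le_norm _ _).trans <|
        mul_le_mul (hW x hx) (((Hf y - Hf x).le_opNorm _).trans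
          (mul_le_mul ?_ (hW y hy) (norm_nonneg _) (by positivity))) (norm_nonneg _) hW0
      rw [← dist_eq_norm]
      refine (hH.dist_le_mul y hy x hx).trans ?_
      gcongr
      rwa [Real.dist_eq, abs_of_nonneg (by linarith)]
    have b3 : |(inner ℂ (w x) (Hf x (w y - w x))).re| ≤ W * (L * dist (F x) (F y)) :=
      (Complex.abs_re_le_norm _).trans <| (norm_inner_le_norm _ _).trans <|
        mul_le_mul (hW x hx) (((Hf x).le_opNorm _).trans
          (mul_le_mul (hL x hx) h1 (norm_nonneg _) hL0)) (norm_nonneg _) hW0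
    rw [dist_comm (f x), Real.dist_eq, e]
    refine (abs_add_three _ _ _).trans ?_
    linarith
  have hfac : AbsolutelyContinuousOnInterval f 0 ℓ := by
    refine absolutelyContinuousOnInterval_of_dist_le hFac
      (C := 2 * W * L + W ^ 2 * K) fun x hx y hy => ?_
    rw [hI] at hx hy
    rcases le_total x y with hxy | hxy
    · exact hfd x hx y hy hxy
    · rw [dist_comm (f x), dist_comm (F x)]
      exact hfd y hy x hx hxy
  -- the derivative
  have hderiv : ∀ᵐ x, x ∈ Ioo 0 ℓ → ‖deriv f x - 2 * (inner ℂ (w x) (Hf x (g x))).re‖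
      ≤ K * ‖w x‖ ^ 2 := by
    filter_upwards [hg.ae_hasDerivAt_integral, hH.ae_differentiableWithinAt_of_mem]
      with x hx1 hx2 hx
    have hxI := Ioo_subset_Icc_self hx
    have hnhds : Icc 0 ℓ ∈ 𝓝 x := Icc_mem_nhds hx.1 hx.2
    have d1 : HasDerivAt w (g x) x := by
      have := (hx1 (by rwa [hI]) 0 (by rwa [hI])).const_add (w 0)
      refine this.congr_of_eventuallyEq ?_
      filter_upwards [hnhds] with y hy using hw y hy
    have d2 := ((hx2 hxI).differentiableAt hnhds).hasDerivAt
    have d3 := norm_deriv_le_of_lipschitzOn hnhds hH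
    rw [(hasDerivAt_re_inner_apply d2 d1 (hsymm x hxI)).deriv, add_sub_cancel_left,
      Real.norm_eq_abs]
    calc _ ≤ ‖w x‖ * ‖deriv Hf x (w x)‖ :=
          (Complex.abs_re_le_norm _).trans (norm_inner_le_norm _ _)
      _ ≤ ‖w x‖ * (K * ‖w x‖) := by
          gcongr
          exact (deriv Hf x).le_of_opNorm_le d3 _
      _ = _ := by ring
  have hint : IntervalIntegrable (fun x => 2 * (inner ℂ (w x) (Hf x (g x))).re) volume 0 ℓ := by
    refine IntervalIntegrable.const_mul ?_ 2
    rw [intervalIntegrable_iff_integrableOn_Ioc_of_le hℓ.le] at hg ⊢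
    have m1 : AEStronglyMeasurable w (volume.restrict (Ioc 0 ℓ)) :=
      (hwc.mono Ioc_subset_Icc_self).aestronglyMeasurable measurableSet_Ioc
    have m2 : AEStronglyMeasurable Hf (volume.restrict (Ioc 0 ℓ)) :=
      (hH.continuousOn.mono Ioc_subset_Icc_self).aestronglyMeasurable measurableSet_Ioc
    have m3 := (ContinuousLinearMap.id ℂ (E →L[ℂ] E)).aestronglyMeasurable_comp₂ m2
      hg.aestronglyMeasurable
    refine Integrable.mono' (hg.norm.const_mul (W * L))
      (Complex.continuous_re.comp_aestronglyMeasurable (m1.inner m3)) ?_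
    filter_upwards [ae_restrict_mem measurableSet_Ioc] with x hx
    have hxI := Ioc_subset_Icc_self hx
    calc _ ≤ ‖w x‖ * ‖Hf x (g x)‖ := (Complex.abs_re_le_norm _).trans (norm_inner_le_norm _ _)
      _ ≤ W * (L * ‖g x‖) := mul_le_mul (hW x hxI)
          ((Hf x).le_of_opNorm_le (hL x hxI) _) (norm_nonneg _) hW0
      _ = _ := by ring
  have hwint : IntervalIntegrable (fun x => ‖w x‖ ^ 2) volume 0 ℓ :=
    ContinuousOn.intervalIntegrable (by rw [hI]; exact hwc.norm.pow 2)
  rw [← hfac.integral_deriv_eq_sub, ← intervalIntegral.integral_const_mul,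
    ← intervalIntegral.integral_sub hfac.intervalIntegrable_deriv hint,
    ← intervalIntegral.integral_const_mul]
  rw [← Real.norm_eq_abs]
  refine intervalIntegral.norm_integral_le_of_norm_le hℓ.le ?_ (hwint.const_mul _)
  filter_upwards [hderiv, (show ∀ᵐ x : ℝ, x ≠ ℓ by simp [ae_iff, measure_singleton])]
    with x hx hne hxI
  exact hx ⟨hxI.1, lt_of_le_of_ne hxI.2 hne⟩

end Energy

/-! ### Linear Carathéodory equations -/

/-- Banach's fixed point theorem on $C([0,\ell])$. The weight makes one step contract on the whole
interval, so no gluing of short-time solutions is needed. -/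
lemma exists_integral_eq_add {E : Type*} [NormedAddCommGroup E] [NormedSpace ℂ E] [CompleteSpace E]
    {ℓ : ℝ} (hℓ : 0 < ℓ) {A : ℝ → E →L[ℂ] E} {C : ℝ}
    (hA : AEStronglyMeasurable A (volume.restrict (Ioo 0 ℓ)))
    (hAC : ∀ᵐ x ∂volume.restrict (Ioo 0 ℓ), ‖A x‖ ≤ C)
    {f : ℝ → E} (hf : IntegrableOn f (Ioo 0 ℓ)) (a : E) :
    ∃ w : ℝ → E, Continuous w ∧
      ∀ x ∈ Icc 0 ℓ, w x = a + ∫ t in (0 : ℝ)..x, (A t (w t) + f t) := by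
  wlog hC : 0 ≤ C generalizing C
  · exact this (C := |C|) (hAC.mono fun x hx => hx.trans (le_abs_self C)) (abs_nonneg C)
  -- The contraction constant is $C/\kappa\le1/2$; the $+1$ keeps $\kappa$ positive when $C=0$.
  set κ : ℝ := 2 * C + 1 with hκ
  have hκ0 : 0 < κ := by positivity
  have h0 : (0 : ℝ) ∈ Icc 0 ℓ := ⟨le_rfl, hℓ.le⟩
  have hI : uIcc 0 ℓ = Icc 0 ℓ := uIcc_of_le hℓ.le
  have hint : ∀ v : ℝ → E, Continuous v →
      IntervalIntegrable (fun t => A t (v t)) volume 0 ℓ := by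
    intro v hv
    rw [intervalIntegrable_iff_integrableOn_Ioo_of_le hℓ.le]
    obtain ⟨b, hb⟩ := isCompact_Icc.exists_bound_of_continuousOn (s := Icc 0 ℓ) hv.continuousOn
    refine Integrable.mono' (integrable_const (C * b))
      ((ContinuousLinearMap.id ℂ (E →L[ℂ] E)).aestronglyMeasurable_comp₂ hA
        hv.aestronglyMeasurable) ?_
    filter_upwards [hAC, ae_restrict_mem measurableSet_Ioo] with x hx hx'
    exact (A x).le_of_opNorm_le_of_le hx (hb x (Ioo_subset_Icc_self hx'))
  have hfi : IntervalIntegrable f volume 0 ℓ :=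
    (intervalIntegrable_iff_integrableOn_Ioo_of_le hℓ.le).2 hf
  -- the weight `exp (κ t)` turns the integral equation into a contraction
  let ext : C(Icc (0 : ℝ) ℓ, E) → ℝ → E := fun v t => Real.exp (κ * t) • IccExtend hℓ.le v t
  have hext : ∀ v, Continuous (ext v) := fun v => by
    have : Continuous (IccExtend hℓ.le v) := v.continuous.Icc_extend'
    fun_prop
  have hsum : ∀ v, IntervalIntegrable (fun t => A t (ext v t) + f t) volume 0 ℓ := fun v =>
    (hint _ (hext v)).add hfi
  let Φ : C(Icc (0 : ℝ) ℓ, E) → C(Icc (0 : ℝ) ℓ, E) := fun v =>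
    ⟨fun x => Real.exp (-(κ * x)) • (a + ∫ t in (0 : ℝ)..x, (A t (ext v t) + f t)), by
      have h1 : ContinuousOn (fun x => ∫ t in (0 : ℝ)..x, (A t (ext v t) + f t)) (Icc 0 ℓ) := by
        rw [← hI]
        exact intervalIntegral.continuousOn_primitive_interval
          (by rw [hI, integrableOn_Icc_iff_integrableOn_Ioc]
              exact (intervalIntegrable_iff_integrableOn_Ioc_of_le hℓ.le).1 (hsum v))
      have h2 := continuousOn_iff_continuous_domRestrict.1 h1
      have h3 : Continuous fun x : Icc (0 : ℝ) ℓ => Real.exp (-(κ * x)) := by fun_prop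
      exact h3.smul (continuous_const.add h2)⟩
  have hΦ : ContractingWith (1 / 2) Φ := by
    refine ⟨by norm_num, LipschitzWith.of_dist_le_mul fun v v' => ?_⟩
    rw [ContinuousMap.dist_le (by positivity)]
    intro x
    have hx := x.2
    have hsub : ∀ {F : ℝ → E}, IntervalIntegrable F volume 0 ℓ →
        IntervalIntegrable F volume 0 x := fun hF => hF.mono_set
      (uIcc_subset_uIcc (by rw [hI]; exact h0) (by rw [hI]; exact hx))
    have e : Φ v x - Φ v' x = Real.exp (-(κ * x)) •
        ∫ t in (0 : ℝ)..x, (A t (ext v t - ext v' t)) := by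
      change Real.exp (-(κ * x)) • (a + ∫ t in (0 : ℝ)..x, (A t (ext v t) + f t)) -
        Real.exp (-(κ * x)) • (a + ∫ t in (0 : ℝ)..x, (A t (ext v' t) + f t)) = _
      rw [← smul_sub, add_sub_add_left_eq_sub,
        ← intervalIntegral.integral_sub (hsub (hsum v)) (hsub (hsum v'))]
      simp only [add_sub_add_right_eq_sub, map_sub]
    have hb : ‖∫ t in (0 : ℝ)..x, A t (ext v t - ext v' t)‖ ≤
        ∫ t in (0 : ℝ)..x, C * dist v v' * Real.exp (κ * t) := by
      refine intervalIntegral.norm_integral_le_of_norm_le hx.1 ?_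
        ((Continuous.intervalIntegrable (by fun_prop)) _ _)
      have h1 := (ae_restrict_iff' measurableSet_Ioo).1 hAC
      filter_upwards [h1, (show ∀ᵐ x : ℝ, x ≠ ℓ by simp [ae_iff, measure_singleton])]
        with t ht htne htx
      have ht' : t ∈ Ioo 0 ℓ := ⟨htx.1, lt_of_le_of_ne (htx.2.trans hx.2) htne⟩
      have h2 : ‖ext v t - ext v' t‖ ≤ Real.exp (κ * t) * dist v v' := by
        change ‖Real.exp (κ * t) • IccExtend hℓ.le v t - Real.exp (κ * t) • IccExtend hℓ.le v' t‖ ≤ _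
        rw [← smul_sub, norm_smul, Real.norm_of_nonneg (Real.exp_pos _).le, ← dist_eq_norm]
        gcongr
        exact ContinuousMap.dist_apply_le_dist _
      calc _ ≤ C * (Real.exp (κ * t) * dist v v') := (A t).le_of_opNorm_le_of_le (ht ht') h2
        _ = _ := by ring
    have hexp : ∫ t in (0 : ℝ)..x, C * dist v v' * Real.exp (κ * t) =
        C * dist v v' * ((Real.exp (κ * x) - 1) / κ) := by
      rw [intervalIntegral.integral_const_mul]
      congr 1
      have hd : ∀ t, HasDerivAt (fun t => Real.exp (κ * t) / κ) (Real.exp (κ * t)) t := fun t => by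
        have := (((hasDerivAt_id t).const_mul κ).exp).div_const κ
        refine this.congr_deriv ?_
        simp [hκ0.ne']
      rw [intervalIntegral.integral_eq_sub_of_hasDerivAt (fun t _ => hd t)
        (Continuous.intervalIntegrable (by fun_prop) _ _)]
      simp [sub_div]
    rw [dist_eq_norm, e, norm_smul, Real.norm_of_nonneg (Real.exp_pos _).le]
    rw [hexp] at hb
    have h5 : Real.exp (-(κ * x)) * Real.exp (κ * x) = 1 := by
      rw [← Real.exp_add]; simp
    have h6 : C / κ ≤ 1 / 2 := by
      rw [div_le_div_iff₀ hκ0 two_pos, hκ]; linarith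
    have hd0 : 0 ≤ dist v v' := dist_nonneg
    calc _ ≤ Real.exp (-(κ * x)) * (C * dist v v' * ((Real.exp (κ * x) - 1) / κ)) := by gcongr
      _ = (C / κ) * dist v v' * (Real.exp (-(κ * x)) * Real.exp (κ * x) - Real.exp (-(κ * x))) := by
          ring
      _ ≤ (C / κ) * dist v v' * 1 := by
          gcongr
          rw [h5]
          linarith [Real.exp_pos (-(κ * x))]
      _ ≤ 1 / 2 * dist v v' := by rw [mul_one]; gcongr
  obtain ⟨v, hv⟩ : ∃ v, Φ v = v := ⟨_, hΦ.fixedPoint_isFixedPt⟩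
  refine ⟨ext v, hext v, fun x hx => ?_⟩
  have h1 : Φ v ⟨x, hx⟩ = v ⟨x, hx⟩ := by rw [hv]
  change Real.exp (κ * x) • IccExtend hℓ.le v x = _
  rw [IccExtend_of_mem _ _ hx, ← h1]
  change Real.exp (κ * x) • Real.exp (-(κ * x)) •
    (a + ∫ t in (0 : ℝ)..x, (A t (ext v t) + f t)) = _
  rw [smul_smul, ← Real.exp_add, add_neg_cancel, Real.exp_zero, one_smul]

/-! ### Sobolev functions as primitives -/

section Sobolev
variable {n : ℕ} {ℓ : ℝ}

lemma intervalIntegrable_edge (hℓ : 0 < ℓ) (g : EdgeL2 n ℓ) :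
    IntervalIntegrable g volume 0 ℓ :=
  (intervalIntegrable_iff_integrableOn_Ioo_of_le hℓ.le).2 (integrableOn_edge g)

lemma integral_Iic_indicator_eq {E : Type*} [NormedAddCommGroup E] [NormedSpace ℝ E]
    (g : ℝ → E) {x : ℝ} (hx : x ∈ Icc 0 ℓ) :
    ∫ t in Iic x, (Ioo 0 ℓ).indicator g t = ∫ t in (0 : ℝ)..x, g t := by
  rw [intervalIntegral.integral_of_le hx.1, setIntegral_indicator measurableSet_Ioo,
    integral_Ioc_eq_integral_Ioo]
  refine setIntegral_congr_set ?_
  have h : (Iic x ∩ Ioo 0 ℓ) \ {x} = Ioo 0 x \ {x} := by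
    ext t
    simp only [Set.mem_sdiff, mem_inter_iff, mem_Iic, mem_Ioo, mem_singleton_iff]
    exact ⟨fun ⟨⟨h1, h2, _⟩, h4⟩ => ⟨⟨h2, lt_of_le_of_ne h1 h4⟩, h4⟩,
      fun ⟨⟨h1, h2⟩, h3⟩ => ⟨⟨h2.le, h1, h2.trans_le hx.2⟩, h3⟩⟩
  have h1 : ∀ s : Set ℝ, (s \ {x} : Set ℝ) =ᵐ[volume] s := fun s =>
    sdiff_null_ae_eq_self (measure_singleton x)
  exact (h1 _).symm.trans (h ▸ h1 _)

lemma isContRep_primitive (hℓ : 0 < ℓ) (g : EdgeL2 n ℓ) (a : EuclideanSpace ℂ (Fin n)) :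
    ContinuousOn (fun x => a + ∫ t in (0 : ℝ)..x, g t) (Icc 0 ℓ) := by
  rw [← uIcc_of_le hℓ.le]
  exact continuousOn_const.add (intervalIntegral.continuousOn_primitive_interval
    (by rw [uIcc_of_le hℓ.le, integrableOn_Icc_iff_integrableOn_Ioc]
        exact (intervalIntegrable_iff_integrableOn_Ioc_of_le hℓ.le).1
          (intervalIntegrable_edge hℓ g)))

lemma isWeakDeriv_const (a : EuclideanSpace ℂ (Fin n)) : IsWeakDeriv ℓ (fun _ => a) 0 := by
  intro φ h1 h2 h3
  have e1 : ∫ x in Ioo 0 ℓ, deriv φ x • a = ∫ x, deriv φ x • a := by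
    rw [setIntegral_eq_integral_of_forall_compl_eq_zero]
    intro x hx
    have : deriv φ x = 0 := image_eq_zero_of_notMem_tsupport
      (fun hh => hx (h3 (tsupport_deriv_subset hh)))
    rw [this, zero_smul]
  have hd : Continuous (deriv φ) := h1.continuous_deriv (by simp)
  have e2 : ∫ x, deriv φ x = 0 :=
    integral_eq_zero_of_hasDerivAt_of_integrable
      (fun x => (h1.differentiable (by simp)).differentiableAt.hasDerivAt)
      (hd.integrable_of_hasCompactSupport h2.deriv)
      (h1.continuous.integrable_of_hasCompactSupport h2)
  rw [e1, integral_smul_const, e2]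
  simp

lemma isWeakDeriv_add_primitive (g : EdgeL2 n ℓ) (a : EuclideanSpace ℂ (Fin n)) :
    IsWeakDeriv ℓ (fun x => a + ∫ t in (0 : ℝ)..x, g t) g := by
  have hGi : Integrable ((Ioo (0 : ℝ) ℓ).indicator g) :=
    (integrable_indicator_iff measurableSet_Ioo).2 (integrableOn_edge g)
  have hb : IntegrableOn (fun x => ∫ t in Iic x, (Ioo (0 : ℝ) ℓ).indicator g t) (Ioo 0 ℓ) := by
    have hc : Continuous fun x => ∫ t in Iic x, (Ioo (0 : ℝ) ℓ).indicator g t := by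
      have hh : (fun x => ∫ t in Iic x, (Ioo (0 : ℝ) ℓ).indicator g t) =
          fun x => (∫ t in Iic (0 : ℝ), (Ioo 0 ℓ).indicator g t) +
            ∫ t in (0 : ℝ)..x, (Ioo 0 ℓ).indicator g t := by
        ext1 x
        rw [← intervalIntegral.integral_Iic_sub_Iic hGi.integrableOn hGi.integrableOn]
        simp
      rw [hh]
      exact continuous_const.add
        (intervalIntegral.continuous_primitive (fun _ _ => hGi.intervalIntegrable) 0)
    exact hc.continuousOn.integrableOn_Icc.mono_set Ioo_subset_Icc_self
  refine ((isWeakDeriv_const a).add (isWeakDeriv_primitive (integrableOn_edge g))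
    (by simp) hb (integrable_zero _ _ _) (integrableOn_edge g)).congr ?_ (by simp)
  filter_upwards [ae_restrict_mem measurableSet_Ioo] with x hx
  simp [integral_Iic_indicator_eq g (Ioo_subset_Icc_self hx)]

/-- The primitive of `g` with value `a` at `0` lies in `H¹`. -/
lemma exists_H1_primitive (hℓ : 0 < ℓ) (g : EdgeL2 n ℓ) (a : EuclideanSpace ℂ (Fin n)) :
    ∃ u : H1 n ℓ, weakDeriv n ℓ u = g ∧
      IsContRep (u : EdgeL2 n ℓ) fun x => a + ∫ t in (0 : ℝ)..x, g t := by
  have hc := isContRep_primitive hℓ g a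
  obtain ⟨b, hb⟩ := isCompact_Icc.exists_bound_of_continuousOn hc
  have hm : MemLp (fun x => a + ∫ t in (0 : ℝ)..x, g t) 2 (volume.restrict (Ioo 0 ℓ)) :=
    MemLp.of_bound ((hc.mono Ioo_subset_Icc_self).aestronglyMeasurable measurableSet_Ioo) b <| by
      filter_upwards [ae_restrict_mem measurableSet_Ioo] with x hx
      exact hb x (Ioo_subset_Icc_self hx)
  have hw : IsWeakDeriv ℓ (hm.toLp _) g :=
    (isWeakDeriv_add_primitive g a).congr hm.coeFn_toLp.symm EventuallyEq.rfl
  let u : H1 n ℓ := ⟨hm.toLp _, g, hw⟩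
  exact ⟨u, weakDeriv_ext (isWeakDeriv_weakDeriv u) hw, hc, hm.coeFn_toLp⟩

lemma evalH1_eq_of_isContRep (hℓ : 0 < ℓ) {u : H1 n ℓ} {w : ℝ → EuclideanSpace ℂ (Fin n)}
    (hw : IsContRep (u : EdgeL2 n ℓ) w) (p : ℝ) (hp : p ∈ Icc 0 ℓ) : evalH1 hℓ p hp u = w p :=
  (Classical.choose_spec (exists_isContRep hℓ u)).eqOn hℓ hw hp

/-- A Sobolev function is the primitive of its weak derivative. -/
lemma isContRep_add_integral (hℓ : 0 < ℓ) (u : H1 n ℓ) :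
    IsContRep (u : EdgeL2 n ℓ) fun x =>
      evalH1 hℓ 0 (left_mem_Icc.2 hℓ.le) u + ∫ t in (0 : ℝ)..x, weakDeriv n ℓ u t := by
  set g := weakDeriv n ℓ u
  -- The function and this primitive have the same weak derivative, so they differ by a constant,
  -- which evaluation at $0$ identifies.
  obtain ⟨v, hv, hvr⟩ := exists_H1_primitive hℓ g 0
  have hz : IsWeakDeriv ℓ (((u : EdgeL2 n ℓ) : ℝ → EuclideanSpace ℂ (Fin n)) +
      (-1 : ℂ) • ((v : EdgeL2 n ℓ) : ℝ → EuclideanSpace ℂ (Fin n))) 0 := by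
    have := (isWeakDeriv_weakDeriv u).add ((isWeakDeriv_weakDeriv v).const_smul (-1))
      (integrableOn_edge _) ((integrableOn_edge _).smul (-1 : ℂ)) (integrableOn_edge _)
      ((integrableOn_edge _).smul (-1 : ℂ))
    refine this.congr EventuallyEq.rfl (Eventually.of_forall fun x => ?_)
    simp [g, hv]
  obtain ⟨c, hc⟩ := ae_const_of_isWeakDeriv_zero hℓ
    ((integrableOn_edge _).add ((integrableOn_edge _).smul (-1 : ℂ))) hz
  have hrep : IsContRep (u : EdgeL2 n ℓ) fun x => c + ∫ t in (0 : ℝ)..x, g t := by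
    refine ⟨isContRep_primitive hℓ g c, ?_⟩
    filter_upwards [hc, hvr.2] with x hx hx'
    rw [← hx]
    simp [hx']
  have h0 := evalH1_eq_of_isContRep hℓ hrep 0 (left_mem_Icc.2 hℓ.le)
  rw [intervalIntegral.integral_same, add_zero] at h0
  rwa [h0]

end Sobolev

/-! ### Matrix functions as operator functions -/

section MatrixFunctions
variable {n : ℕ} {ℓ : ℝ}

/-- The passage from the entries of a matrix to the operator on Euclidean space. -/
noncomputable def entriesToCLM (n : ℕ) :
    (Fin n → Fin n → ℂ) →L[ℂ] (EuclideanSpace ℂ (Fin n) →L[ℂ] EuclideanSpace ℂ (Fin n)) :=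
  LinearMap.toContinuousLinearMap
    { toFun := fun A => Matrix.toEuclideanCLM (𝕜 := ℂ) (Matrix.of A)
      map_add' := fun A B => map_add (Matrix.toEuclideanCLM (n := Fin n) (𝕜 := ℂ))
        (Matrix.of A) (Matrix.of B)
      map_smul' := fun c A => map_smul (Matrix.toEuclideanCLM (n := Fin n) (𝕜 := ℂ)) c
        (Matrix.of A) }

lemma entriesToCLM_apply (A : Matrix (Fin n) (Fin n) ℂ) (x : EuclideanSpace ℂ (Fin n)) :
    entriesToCLM n A x = Matrix.toEuclideanLin A x := rfl

lemma exists_lipschitzOnWith_entriesToCLM {s : Set ℝ} {A : ℝ → Matrix (Fin n) (Fin n) ℂ}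
    (hA : ∀ i j, ∃ K, LipschitzOnWith K (fun x => A x i j) s) :
    ∃ K, LipschitzOnWith K (fun x => entriesToCLM n (A x)) s := by
  choose K hK using hA
  refine ⟨‖entriesToCLM n‖₊ * ∑ i, ∑ j, K i j,
    (entriesToCLM n).lipschitz.comp_lipschitzOnWith (LipschitzOnWith.of_dist_le_mul ?_)⟩
  intro x hx y hy
  refine (dist_pi_le_iff (by positivity)).2 fun i => (dist_pi_le_iff (by positivity)).2 fun j => ?_
  refine ((hK i j).dist_le_mul x hx y hy).trans ?_
  gcongr
  exact (Finset.single_le_sum (f := fun j => K i j) (fun _ _ => zero_le)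
    (Finset.mem_univ j)).trans (Finset.single_le_sum (f := fun i => ∑ j, K i j)
      (fun _ _ => zero_le) (Finset.mem_univ i))

lemma aestronglyMeasurable_entriesToCLM {A : ℝ → Matrix (Fin n) (Fin n) ℂ}
    (hA : ∀ i j, MemLp (fun x => A x i j) ⊤ (volume.restrict (Ioo 0 ℓ))) :
    AEStronglyMeasurable (fun x => entriesToCLM n (A x)) (volume.restrict (Ioo 0 ℓ)) := by
  refine (entriesToCLM n).continuous.comp_aestronglyMeasurable (AEMeasurable.aestronglyMeasurable ?_)
  exact aemeasurable_pi_lambda _ fun i => aemeasurable_pi_lambda _ fun j =>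
    (hA i j).aestronglyMeasurable.aemeasurable

lemma exists_ae_norm_entriesToCLM_le {A : ℝ → Matrix (Fin n) (Fin n) ℂ}
    (hA : ∀ i j, MemLp (fun x => A x i j) ⊤ (volume.restrict (Ioo 0 ℓ))) :
    ∃ C, 0 ≤ C ∧ ∀ᵐ x ∂volume.restrict (Ioo 0 ℓ), ‖entriesToCLM n (A x)‖ ≤ C := by
  have h : ∀ i j, ∃ c : NNReal, ∀ᵐ x ∂volume.restrict (Ioo 0 ℓ), ‖A x i j‖ ≤ c := fun i j => by
    have h1 := (hA i j).2
    rw [eLpNorm_exponent_top, eLpNormEssSup_lt_top_iff_isBoundedUnder] at h1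
    obtain ⟨c, hc⟩ := h1
    exact ⟨c, (eventually_map.1 hc).mono fun x hx => by exact_mod_cast hx⟩
  choose c hc using h
  refine ⟨‖entriesToCLM n‖ * ∑ i, ∑ j, c i j, by positivity, ?_⟩
  filter_upwards [ae_all_iff.2 fun i => ae_all_iff.2 (hc i)] with x hx
  refine (entriesToCLM n).le_of_opNorm_le_of_le le_rfl ?_
  refine (pi_norm_le_iff_of_nonneg (by positivity)).2 fun i =>
    (pi_norm_le_iff_of_nonneg (by positivity)).2 fun j => ?_
  refine (hx i j).trans ?_
  exact_mod_cast (Finset.single_le_sum (f := fun j => c i j) (fun _ _ => zero_le)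
    (Finset.mem_univ j)).trans (Finset.single_le_sum (f := fun i => ∑ j, c i j)
      (fun _ _ => zero_le) (Finset.mem_univ i))

lemma coeFn_mulL2 {A : ℝ → Matrix (Fin n) (Fin n) ℂ}
    (hA : ∀ i j, MemLp (fun x => A x i j) ⊤ (volume.restrict (Ioo 0 ℓ))) (u : EdgeL2 n ℓ) :
    mulL2 A hA u =ᵐ[volume.restrict (Ioo 0 ℓ)] fun x => Matrix.toEuclideanLin (A x) (u x) :=
  (memLp_mulVec hA u).coeFn_toLp

/-- Linear systems `u' = A u + f` with bounded coefficients are solvable in `H¹`. -/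
lemma exists_weakDeriv_eq_mulL2_add (hℓ : 0 < ℓ) {A : ℝ → Matrix (Fin n) (Fin n) ℂ}
    (hA : ∀ i j, MemLp (fun x => A x i j) ⊤ (volume.restrict (Ioo 0 ℓ))) (f : EdgeL2 n ℓ)
    (a : EuclideanSpace ℂ (Fin n)) :
    ∃ u : H1 n ℓ, weakDeriv n ℓ u = mulL2 A hA u + f ∧
      evalH1 hℓ 0 (left_mem_Icc.2 hℓ.le) u = a := by
  obtain ⟨C, hC, hAC⟩ := exists_ae_norm_entriesToCLM_le hA
  obtain ⟨w, hwc, hw⟩ := exists_integral_eq_add hℓ (aestronglyMeasurable_entriesToCLM hA) hAC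
    (integrableOn_edge f) a
  obtain ⟨b, hb⟩ := isCompact_Icc.exists_bound_of_continuousOn (s := Icc 0 ℓ) hwc.continuousOn
  have hwm : MemLp w 2 (volume.restrict (Ioo 0 ℓ)) :=
    MemLp.of_bound hwc.aestronglyMeasurable b <| by
      filter_upwards [ae_restrict_mem measurableSet_Ioo] with x hx
      exact hb x (Ioo_subset_Icc_self hx)
  set v : EdgeL2 n ℓ := hwm.toLp _ with hv
  obtain ⟨u, hu, hur⟩ := exists_H1_primitive hℓ (mulL2 A hA v + f) a
  have hae : (mulL2 A hA v + f : EdgeL2 n ℓ) =ᵐ[volume.restrict (Ioo 0 ℓ)]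
      fun t => entriesToCLM n (A t) (w t) + f t := by
    filter_upwards [Lp.coeFn_add (mulL2 A hA v) f, coeFn_mulL2 hA v, hwm.coeFn_toLp]
      with x h1 h2 h3
    rw [h1, Pi.add_apply, h2, hv, h3, entriesToCLM_apply]
  -- The primitive of $Av+f$ with value $a$ at $0$ is $w$ itself, by the integral equation, so the
  -- $H^1$ function built from $v$ has $v$ as its class.
  have huv : (u : EdgeL2 n ℓ) = v := by
    refine Lp.ext ?_
    filter_upwards [hur.2, hwm.coeFn_toLp, ae_restrict_mem measurableSet_Ioo] with x h1 h2 hx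
    rw [h1, hv, h2, hw x (Ioo_subset_Icc_self hx)]
    congr 1
    refine intervalIntegral.integral_congr_ae ?_
    filter_upwards [(ae_restrict_iff' measurableSet_Ioo).1 hae] with t ht ht'
    rw [uIoc_of_le hx.1.le] at ht'
    exact ht ⟨ht'.1, ht'.2.trans_lt hx.2⟩
  refine ⟨u, by rw [hu, huv], ?_⟩
  rw [evalH1_eq_of_isContRep hℓ hur, intervalIntegral.integral_same, add_zero]

lemma memLp_top_of_continuousOn {f : ℝ → ℂ} (hf : ContinuousOn f (Icc 0 ℓ)) :
    MemLp f ⊤ (volume.restrict (Ioo 0 ℓ)) := by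
  obtain ⟨C, hC⟩ := isCompact_Icc.exists_bound_of_continuousOn hf
  refine memLp_top_of_bound
    ((hf.mono Ioo_subset_Icc_self).aestronglyMeasurable measurableSet_Ioo) C ?_
  filter_upwards [ae_restrict_mem measurableSet_Ioo] with x hx
  exact hC x (Ioo_subset_Icc_self hx)

/-- Cramer's formula: the inverse is the adjugate divided by a determinant that does not vanish on
$s$. -/
lemma continuousOn_inv_apply {M : ℝ → Matrix (Fin n) (Fin n) ℂ} {s : Set ℝ}
    (hM : ∀ i j, ContinuousOn (fun x => M x i j) s) (hu : ∀ x ∈ s, IsUnit (M x)) (i j : Fin n) :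
    ContinuousOn (fun x => (M x)⁻¹ i j) s := by
  have hMc : ContinuousOn M s := continuousOn_pi.2 fun i => continuousOn_pi.2 fun j => hM i j
  have hadj : ContinuousOn (fun x => (M x).adjugate i j) s := by
    have : Continuous fun A : Matrix (Fin n) (Fin n) ℂ => A.adjugate i j :=
      (continuous_id.matrix_adjugate).matrix_elem i j
    exact this.comp_continuousOn hMc
  have hdet : ContinuousOn (fun x => (M x).det) s :=
    (continuous_id.matrix_det).comp_continuousOn hMc
  have h : ∀ x, (M x)⁻¹ i j = ((M x).det)⁻¹ * (M x).adjugate i j := fun x => by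
    rw [Matrix.inv_def, Matrix.smul_apply, smul_eq_mul, Ring.inverse_eq_inv']
  simp only [h]
  exact (hdet.inv₀ fun x hx => ((Matrix.isUnit_iff_isUnit_det _).1 (hu x hx)).ne_zero).mul hadj

/-- Boundary value `0` and right-hand side can be prescribed for `z u - M u' - N u`. -/
lemma exists_H1_resolvent_eq (hℓ : 0 < ℓ) {M N : ℝ → Matrix (Fin n) (Fin n) ℂ}
    (hM : ∀ i j, ∃ K, LipschitzOnWith K (fun x => M x i j) (Icc 0 ℓ))
    (hMu : ∀ x ∈ Icc 0 ℓ, IsUnit (M x))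
    (hN : ∀ i j, MemLp (fun x => N x i j) ⊤ (volume.restrict (Ioo 0 ℓ)))
    (z : ℂ) (f : EdgeL2 n ℓ) (a : EuclideanSpace ℂ (Fin n)) :
    ∃ u : H1 n ℓ, z • (u : EdgeL2 n ℓ) -
        (mulL2 M (fun i j => memLp_top_of_lipschitz (hM i j)) (weakDeriv n ℓ u) + mulL2 N hN u) = f ∧
      evalH1 hℓ 0 (left_mem_Icc.2 hℓ.le) u = a := by
  have hMi : ∀ i j, MemLp (fun x => (M x)⁻¹ i j) ⊤ (volume.restrict (Ioo 0 ℓ)) := fun i j =>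
    memLp_top_of_continuousOn (continuousOn_inv_apply
      (fun i j => (hM i j).choose_spec.continuousOn) hMu i j)
  -- The equation is put in the explicit form $u'=M^{-1}(z-N)u-M^{-1}f$, whose coefficient is
  -- bounded because $M^{-1}$ is continuous on $[0,\ell]$.
  have hA : ∀ i j, MemLp (fun x => ((M x)⁻¹ * (z • (1 : Matrix (Fin n) (Fin n) ℂ) - N x)) i j) ⊤
      (volume.restrict (Ioo 0 ℓ)) := fun i j => by
    simp only [Matrix.mul_apply]
    refine memLp_finsetSum _ fun k _ => MemLp.mul (p := ⊤) (q := ⊤) ?_ (hMi i k)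
    exact (memLp_const _).sub (hN k j)
  obtain ⟨u, hu, hu0⟩ := exists_weakDeriv_eq_mulL2_add hℓ hA (-mulL2 _ hMi f) a
  refine ⟨u, ?_, hu0⟩
  set M' := mulL2 M (fun i j => memLp_top_of_lipschitz (hM i j))
  refine Lp.ext ?_
  rw [hu]
  set g := mulL2 _ hA (u : EdgeL2 n ℓ)
  set f' := mulL2 _ hMi f
  filter_upwards [Lp.coeFn_sub (z • (u : EdgeL2 n ℓ)) (M' (g + -f') + mulL2 N hN u),
    Lp.coeFn_smul z (u : EdgeL2 n ℓ), Lp.coeFn_add (M' (g + -f')) (mulL2 N hN u),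
    coeFn_mulL2 (fun i j => memLp_top_of_lipschitz (hM i j)) (g + -f'), coeFn_mulL2 hN u,
    Lp.coeFn_add g (-f'), Lp.coeFn_neg f', coeFn_mulL2 hA u, coeFn_mulL2 hMi f,
    ae_restrict_mem measurableSet_Ioo] with x h1 h2 h3 h4 h5 h6 h7 h8 h9 hx
  have hunit := (Matrix.isUnit_iff_isUnit_det _).1 (hMu x (Ioo_subset_Icc_self hx))
  rw [h1, Pi.sub_apply, h2, h3, Pi.add_apply, h4, h5, h6, Pi.add_apply, h7, Pi.neg_apply,
    h8, h9, Pi.smul_apply, map_add, map_neg]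
  have hcomp : ∀ (P R : Matrix (Fin n) (Fin n) ℂ) y, Matrix.toEuclideanLin P
      (Matrix.toEuclideanLin R y) = Matrix.toEuclideanLin (P * R) y := fun P R y => by
    rw [Matrix.toLpLin_mul_same]; rfl
  rw [hcomp, hcomp, ← Matrix.mul_assoc, Matrix.mul_nonsing_inv _ hunit, Matrix.one_mul,
    map_sub, map_smul, Matrix.toLpLin_one, LinearMap.sub_apply, LinearMap.smul_apply,
    LinearMap.id_apply]
  abel

end MatrixFunctions

/-! ### Weighted inner products on an edge -/

section EdgeForm
variable {n : ℕ} {ℓ : ℝ}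

lemma inner_mulL2_eq {Q : ℝ → Matrix (Fin n) (Fin n) ℂ}
    (hQ : ∀ i j, MemLp (fun x => Q x i j) ⊤ (volume.restrict (Ioo 0 ℓ))) (u v : EdgeL2 n ℓ) :
    inner ℂ v (mulL2 Q hQ u) =
      ∫ x in Ioo 0 ℓ, inner ℂ (v x) (Matrix.toEuclideanLin (Q x) (u x)) := by
  rw [L2.inner_def]
  refine integral_congr_ae ?_
  filter_upwards [coeFn_mulL2 hQ u] with x hx
  rw [hx]

lemma edge_norm_sq_eq (u : EdgeL2 n ℓ) : ‖u‖ ^ 2 = ∫ x in Ioo 0 ℓ, ‖u x‖ ^ 2 := by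
  rw [← inner_self_eq_norm_sq (𝕜 := ℂ) u, L2.inner_def, ← integral_re (L2.integrable_inner u u)]
  exact integral_congr_ae (Eventually.of_forall fun x => inner_self_eq_norm_sq (𝕜 := ℂ) (u x))

lemma integrable_edge_norm_sq (u : EdgeL2 n ℓ) :
    Integrable (fun x => ‖u x‖ ^ 2) (volume.restrict (Ioo 0 ℓ)) :=
  (Lp.memLp u).integrable_norm_pow (by norm_num)

lemma exists_norm_mulL2_le {A : ℝ → Matrix (Fin n) (Fin n) ℂ}
    (hA : ∀ i j, MemLp (fun x => A x i j) ⊤ (volume.restrict (Ioo 0 ℓ))) :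
    ∃ C, 0 ≤ C ∧ ∀ u : EdgeL2 n ℓ, ‖mulL2 A hA u‖ ≤ C * ‖u‖ := by
  obtain ⟨C, hC, hAC⟩ := exists_ae_norm_entriesToCLM_le hA
  refine ⟨C, hC, fun u => Lp.norm_le_mul_norm_of_ae_le_mul ?_⟩
  filter_upwards [coeFn_mulL2 hA u, hAC] with x hx hx'
  rw [hx]
  exact (entriesToCLM n (A x)).le_of_opNorm_le hx' _

lemma inner_toEuclideanLin_of_isHermitian {A : Matrix (Fin n) (Fin n) ℂ} (hA : A.IsHermitian)
    (a b : EuclideanSpace ℂ (Fin n)) :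
    inner ℂ (Matrix.toEuclideanLin A a) b = inner ℂ a (Matrix.toEuclideanLin A b) :=
  Matrix.isSymmetric_toEuclideanLin_iff.2 hA a b

lemma inner_mulL2_symm {Q : ℝ → Matrix (Fin n) (Fin n) ℂ}
    (hQ : ∀ i j, MemLp (fun x => Q x i j) ⊤ (volume.restrict (Ioo 0 ℓ)))
    (hs : ∀ x ∈ Icc 0 ℓ, (Q x).IsHermitian) (u v : EdgeL2 n ℓ) :
    inner ℂ (mulL2 Q hQ v) u = inner ℂ v (mulL2 Q hQ u) := by
  rw [inner_mulL2_eq, L2.inner_def]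
  refine integral_congr_ae ?_
  filter_upwards [coeFn_mulL2 hQ v, ae_restrict_mem measurableSet_Ioo] with x hx hx'
  rw [hx, inner_toEuclideanLin_of_isHermitian (hs x (Ioo_subset_Icc_self hx'))]

lemma le_re_inner_mulL2 {Q : ℝ → Matrix (Fin n) (Fin n) ℂ}
    (hQ : ∀ i j, MemLp (fun x => Q x i j) ⊤ (volume.restrict (Ioo 0 ℓ))) {q : ℝ}
    (hq : ∀ x ∈ Icc 0 ℓ, ∀ ξ : EuclideanSpace ℂ (Fin n),
      q * ‖ξ‖ ^ 2 ≤ (inner ℂ ξ (Matrix.toEuclideanLin (Q x) ξ)).re) (u : EdgeL2 n ℓ) :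
    q * ‖u‖ ^ 2 ≤ (inner ℂ u (mulL2 Q hQ u)).re := by
  have hi := L2.integrable_inner (𝕜 := ℂ) u (mulL2 Q hQ u)
  rw [L2.inner_def, edge_norm_sq_eq, ← integral_const_mul]
  change _ ≤ RCLike.re (∫ x in Ioo 0 ℓ, inner ℂ (u x) (mulL2 Q hQ u x))
  rw [← integral_re hi]
  refine integral_mono_ae ((integrable_edge_norm_sq u).const_mul q) hi.re ?_
  filter_upwards [coeFn_mulL2 hQ u, ae_restrict_mem measurableSet_Ioo] with x hx hx'
  rw [hx]
  exact hq x (Ioo_subset_Icc_self hx') (u x)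

lemma exists_lipschitzOnWith_mul_apply {M Q : ℝ → Matrix (Fin n) (Fin n) ℂ}
    (hM : ∀ i j, ∃ K, LipschitzOnWith K (fun x => M x i j) (Icc 0 ℓ))
    (hQ : ∀ i j, ∃ K, LipschitzOnWith K (fun x => Q x i j) (Icc 0 ℓ)) (i j : Fin n) :
    ∃ K, LipschitzOnWith K (fun x => (Q x * M x) i j) (Icc 0 ℓ) := by
  choose K hK using hM
  choose L hL using hQ
  choose a ha using fun i j => isCompact_Icc.exists_bound_of_continuousOn (hK i j).continuousOn
  choose b hb using fun i j => isCompact_Icc.exists_bound_of_continuousOn (hL i j).continuousOn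
  refine ⟨(∑ k, (|b i k| * K k j + |a k j| * L i k)).toNNReal,
    LipschitzOnWith.of_dist_le_mul fun x hx y hy => ?_⟩
  rw [Real.coe_toNNReal _ (by positivity), Matrix.mul_apply, Matrix.mul_apply, dist_eq_norm,
    ← Finset.sum_sub_distrib, Finset.sum_mul]
  refine norm_sum_le_of_le _ fun k _ => ?_
  have e : Q x i k * M x k j - Q y i k * M y k j =
      Q x i k * (M x k j - M y k j) + (Q x i k - Q y i k) * M y k j := by ring
  have h1 := (hK k j).dist_le_mul x hx y hy
  have h2 := (hL i k).dist_le_mul x hx y hy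
  rw [dist_eq_norm] at h1 h2
  rw [e, add_mul]
  refine norm_add_le_of_le ?_ ?_
  · rw [norm_mul, mul_assoc]
    exact mul_le_mul ((hb i k x hx).trans (le_abs_self _)) h1 (norm_nonneg _) (abs_nonneg _)
  · rw [norm_mul, mul_comm, mul_assoc]
    exact mul_le_mul ((ha k j y hy).trans (le_abs_self _)) h2 (norm_nonneg _) (abs_nonneg _)

/-- The energy identity for `M ∂ + N` on an edge, up to terms of order zero. -/
lemma exists_abs_edge_energy_le (hℓ : 0 < ℓ) {M N Q : ℝ → Matrix (Fin n) (Fin n) ℂ}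
    (hM : ∀ i j, ∃ K, LipschitzOnWith K (fun x => M x i j) (Icc 0 ℓ))
    (hQ : ∀ i j, ∃ K, LipschitzOnWith K (fun x => Q x i j) (Icc 0 ℓ))
    (hN : ∀ i j, MemLp (fun x => N x i j) ⊤ (volume.restrict (Ioo 0 ℓ)))
    (hQM : ∀ x ∈ Icc 0 ℓ, (Q x * M x).IsHermitian) :
    ∃ K, 0 ≤ K ∧ ∀ u : H1 n ℓ,
      |(inner ℂ (evalH1 hℓ ℓ (right_mem_Icc.2 hℓ.le) u)
          (Matrix.toEuclideanLin (Q ℓ * M ℓ) (evalH1 hℓ ℓ (right_mem_Icc.2 hℓ.le) u))).re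
        - (inner ℂ (evalH1 hℓ 0 (left_mem_Icc.2 hℓ.le) u)
          (Matrix.toEuclideanLin (Q 0 * M 0) (evalH1 hℓ 0 (left_mem_Icc.2 hℓ.le) u))).re
        - 2 * (inner ℂ (u : EdgeL2 n ℓ) (mulL2 Q (fun i j => memLp_top_of_lipschitz (hQ i j))
            (mulL2 M (fun i j => memLp_top_of_lipschitz (hM i j)) (weakDeriv n ℓ u)
              + mulL2 N hN u))).re| ≤ K * ‖(u : EdgeL2 n ℓ)‖ ^ 2 := by
  have hQM' := exists_lipschitzOnWith_mul_apply hM hQ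
  obtain ⟨K, hK⟩ := exists_lipschitzOnWith_entriesToCLM hQM'
  have hQ' := fun i j => memLp_top_of_lipschitz (hQ i j)
  have hM' := fun i j => memLp_top_of_lipschitz (hM i j)
  obtain ⟨a, ha, hQa⟩ := exists_norm_mulL2_le hQ'
  obtain ⟨b, hb, hNb⟩ := exists_norm_mulL2_le hN
  -- $K$ is a Lipschitz constant of $QM$; $2ab$ accounts for the zero-order term $QN$ inside the
  -- doubled inner product.
  refine ⟨K + 2 * (a * b), by positivity, fun u => ?_⟩
  set g := weakDeriv n ℓ u
  have hrep := isContRep_add_integral hℓ u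
  set w : ℝ → EuclideanSpace ℂ (Fin n) := fun x =>
    evalH1 hℓ 0 (left_mem_Icc.2 hℓ.le) u + ∫ t in (0 : ℝ)..x, g t with hw
  have hw0 : w 0 = evalH1 hℓ 0 (left_mem_Icc.2 hℓ.le) u := by simp [hw]
  have hE := abs_energy_sub_le hℓ hK (fun x hx => inner_toEuclideanLin_of_isHermitian (hQM x hx))
    (intervalIntegrable_edge hℓ g) (w := w) (fun x _ => by rw [hw0])
  have e1 : ∫ x in (0 : ℝ)..ℓ, ‖w x‖ ^ 2 = ‖(u : EdgeL2 n ℓ)‖ ^ 2 := by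
    rw [edge_norm_sq_eq, intervalIntegral.integral_of_le hℓ.le, integral_Ioc_eq_integral_Ioo]
    refine integral_congr_ae ?_
    filter_upwards [hrep.2] with x hx
    rw [hx]
  have e2 : ∫ x in (0 : ℝ)..ℓ, (inner ℂ (w x) (entriesToCLM n (Q x * M x) (g x))).re =
      (inner ℂ (u : EdgeL2 n ℓ) (mulL2 Q hQ' (mulL2 M hM' g))).re := by
    have hi := L2.integrable_inner (𝕜 := ℂ) (u : EdgeL2 n ℓ) (mulL2 Q hQ' (mulL2 M hM' g))
    rw [intervalIntegral.integral_of_le hℓ.le, integral_Ioc_eq_integral_Ioo, L2.inner_def]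
    refine Eq.trans ?_ (integral_re hi)
    refine integral_congr_ae ?_
    filter_upwards [hrep.2, coeFn_mulL2 hQ' (mulL2 M hM' g), coeFn_mulL2 hM' g] with x h1 h2 h3
    rw [h1, h2, h3, entriesToCLM_apply, Matrix.toLpLin_mul_same]
    rfl
  have e3 : (inner ℂ (u : EdgeL2 n ℓ) (mulL2 Q hQ' (mulL2 M hM' g + mulL2 N hN u))).re =
      (inner ℂ (u : EdgeL2 n ℓ) (mulL2 Q hQ' (mulL2 M hM' g))).re +
        (inner ℂ (u : EdgeL2 n ℓ) (mulL2 Q hQ' (mulL2 N hN u))).re := by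
    rw [map_add, inner_add_right, Complex.add_re]
  have h4 : |(inner ℂ (u : EdgeL2 n ℓ) (mulL2 Q hQ' (mulL2 N hN u))).re| ≤
      (a * b) * ‖(u : EdgeL2 n ℓ)‖ ^ 2 := by
    refine (Complex.abs_re_le_norm _).trans ((norm_inner_le_norm _ _).trans ?_)
    calc _ ≤ ‖(u : EdgeL2 n ℓ)‖ * (a * (b * ‖(u : EdgeL2 n ℓ)‖)) := by
          gcongr
          exact (hQa _).trans (by gcongr; exact hNb _)
      _ = _ := by ring
  rw [e1, e2] at hE
  rw [e3, evalH1_eq_of_isContRep hℓ hrep ℓ, ← hw0]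
  change |(inner ℂ (w ℓ) (entriesToCLM n (Q ℓ * M ℓ) (w ℓ))).re -
    (inner ℂ (w 0) (entriesToCLM n (Q 0 * M 0) (w 0))).re - _| ≤ _
  rw [abs_le] at hE h4 ⊢
  constructor <;> linarith [hE.1, hE.2, h4.1, h4.2]

end EdgeForm

/-! ### The energy identity on a network -/

section NetworkEnergy

attribute [-instance] WithCStarModule.instCStarModuleComplex

variable {V E : Type*} {G : Network V E}

/-- The values at `0` on all edges of `u ∈ D_max`. -/
noncomputable def Network.initialValue (G : Network V E) :
    G.Dmax →ₗ[ℂ] (∀ e, EuclideanSpace ℂ (Fin (G.dim e))) :=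
  LinearMap.pi fun e =>
    evalH1 (G.len_pos e) 0 (left_mem_Icc.2 (G.len_pos e).le) ∘ₗ G.edgeH1 e

/-- The component of `ξ ∈ ℂ^{k_v}` that belongs to an incident edge. -/
noncomputable def Network.vertexBlock {v : V} (ξ : G.VertexSpace v) (e : G.Inc v) :
    EuclideanSpace ℂ (Fin (G.dim e)) := WithLp.toLp 2 fun k => ξ ⟨e, k⟩

namespace HypSystem
variable (S : HypSystem G)

/-- The operator of multiplication by `Q_e` on `L²(0,ℓ_e)^{k_e}`. -/
noncomputable def mulQ (e : E) : EdgeL2 (G.dim e) (G.len e) →ₗ[ℂ] EdgeL2 (G.dim e) (G.len e) :=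
  mulL2 (S.Q e) fun i j => memLp_top_of_lipschitz (S.lipschitz_Q e i j)

/-- The operator `u ↦ (M_e u_e' + N_e u_e)_e` on `D_max`. -/
noncomputable def edgeDiff : G.Dmax →ₗ[ℂ] G.L2 where
  toFun u := WithLp.toLp 2 fun e =>
    mulL2 (S.M e) (fun i j => memLp_top_of_lipschitz (S.lipschitz_M e i j))
        (weakDeriv (G.dim e) (G.len e) (G.edgeH1 e u))
      + mulL2 (S.N e) (S.bounded_N e) (G.edgeH1 e u : EdgeL2 (G.dim e) (G.len e))
  map_add' u u' := by
    ext1 e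
    simp only [map_add, Submodule.coe_add, PiLp.add_apply]
    abel
  map_smul' c u := by
    ext1 e
    simp only [map_smul, Submodule.coe_smul, PiLp.smul_apply, smul_add, RingHom.id_apply]

lemma exists_edgeDiff_eq (z : ℂ) (f : G.L2) (a : ∀ e, EuclideanSpace ℂ (Fin (G.dim e))) :
    ∃ u : G.Dmax, z • (u : G.L2) - S.edgeDiff u = f ∧ G.initialValue u = a := by
  choose u hu hu0 using fun e => exists_H1_resolvent_eq (G.len_pos e) (S.lipschitz_M e)
    (S.isUnit_M e) (S.bounded_N e) z (f e) (a e)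
  refine ⟨⟨WithLp.toLp 2 fun e => (u e : EdgeL2 (G.dim e) (G.len e)), fun e => (u e).2⟩, ?_, ?_⟩
  · ext1 e
    exact hu e
  · ext1 e
    exact hu0 e

lemma exists_le_sum_inner_mulQ [Fintype E] : ∃ c, 0 < c ∧ ∀ u : G.L2,
    c * ‖u‖ ^ 2 ≤ ∑ e, (inner ℂ (u e) (S.mulQ e (u e))).re := by
  choose q hq0 hq using S.posDef_Q
  obtain ⟨c, hc0, hc⟩ : ∃ c, 0 < c ∧ ∀ e, c ≤ q e := by
    rcases isEmpty_or_nonempty E with hE | hE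
    · exact ⟨1, one_pos, fun e => hE.elim e⟩
    · obtain ⟨e₀, he₀⟩ := Finite.exists_min q
      exact ⟨q e₀, hq0 e₀, he₀⟩
  refine ⟨c, hc0, fun u => ?_⟩
  rw [PiLp.norm_sq_eq_of_L2, Finset.mul_sum]
  refine Finset.sum_le_sum fun e _ => ?_
  exact (mul_le_mul_of_nonneg_right (hc e) (by positivity)).trans (le_re_inner_mulL2 _ (hq e) (u e))

end HypSystem

variable [DecidableEq V] [Fintype E]

/-- After exchanging the sums, each edge is seen only from its terminal endpoint with sign $+$ and
its initial one with sign $-$. Absence of loops ensures that these are different vertices and that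
the terminal one has coordinate $\ell_e$. -/
lemma Network.sum_incidence_mul [Fintype V] (G : Network V E) (c : E → ℝ → ℂ) :
    ∑ v, ∑ e : G.Inc v, G.incidence v e * c e (G.coord e v) = ∑ e, (c e (G.len e) - c e 0) := by
  have h1 : ∀ v, ∑ e : G.Inc v, G.incidence v e * c e (G.coord e v) =
      ∑ e, G.incidence v e * c e (G.coord e v) := fun v => by
    rw [← Finset.sum_subtype (Finset.univ.filter fun e => G.src e = v ∨ G.tgt e = v) (by simp)
      (fun e => G.incidence v e * c e (G.coord e v))]
    refine Finset.sum_filter_of_ne fun e _ he => ?_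
    by_contra hh
    rw [not_or] at hh
    simp [Network.incidence, hh.1, hh.2] at he
  simp only [h1]
  rw [Finset.sum_comm]
  refine Finset.sum_congr rfl fun e _ => ?_
  simp only [Network.incidence, sub_mul, ite_mul, one_mul, zero_mul, Finset.sum_sub_distrib,
    Finset.sum_ite_eq, Finset.mem_univ, if_true]
  simp [Network.coord, G.src_ne_tgt e]

variable [DecidableEq E]

lemma Network.inner_toEuclideanLin_blockDiagonal' {v : V}
    (D : ∀ e : G.Inc v, Matrix (Fin (G.dim e)) (Fin (G.dim e)) ℂ) (ξ : G.VertexSpace v) :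
    inner ℂ ξ (Matrix.toEuclideanLin (Matrix.blockDiagonal' D) ξ) =
      ∑ e, inner ℂ (vertexBlock ξ e) (Matrix.toEuclideanLin (D e) (vertexBlock ξ e)) := by
  rw [PiLp.inner_apply, Fintype.sum_sigma]
  refine Finset.sum_congr rfl fun e _ => ?_
  rw [PiLp.inner_apply]
  refine Finset.sum_congr rfl fun k _ => ?_
  congr 1
  simp only [Matrix.toLpLin_apply, Matrix.mulVec, dotProduct, Fintype.sum_sigma]
  rw [Finset.sum_eq_single e]
  · simp [vertexBlock, Matrix.blockDiagonal'_apply_eq]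
  · intro e' _ he'
    refine Finset.sum_eq_zero fun j _ => ?_
    rw [Matrix.blockDiagonal'_apply_ne _ _ _ he'.symm, zero_mul]
  · simp

namespace HypSystem
variable (S : HypSystem G) [Fintype V]

/-- The bridge between the boundary terms of integration by parts on the edges and the forms $T_v$
of the vertex conditions; the signs come from the incidence numbers inside $T_v$. -/
lemma sum_inner_trace (u : G.Dmax) :
    ∑ v, inner ℂ (G.trace v u) (S.T v (G.trace v u)) = ∑ e,
      (inner ℂ (evalH1 (G.len_pos e) (G.len e) (right_mem_Icc.2 (G.len_pos e).le) (G.edgeH1 e u))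
          (Matrix.toEuclideanLin (S.Q e (G.len e) * S.M e (G.len e))
            (evalH1 (G.len_pos e) (G.len e) (right_mem_Icc.2 (G.len_pos e).le) (G.edgeH1 e u)))
        - inner ℂ (evalH1 (G.len_pos e) 0 (left_mem_Icc.2 (G.len_pos e).le) (G.edgeH1 e u))
          (Matrix.toEuclideanLin (S.Q e 0 * S.M e 0)
            (evalH1 (G.len_pos e) 0 (left_mem_Icc.2 (G.len_pos e).le) (G.edgeH1 e u)))) := by
  choose w hw using fun e => exists_isContRep (G.len_pos e) (G.edgeH1 e u)
  have hev : ∀ e p hp, evalH1 (G.len_pos e) p hp (G.edgeH1 e u) = w e p := fun e p hp =>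
    evalH1_eq_of_isContRep (G.len_pos e) (hw e) p hp
  simp only [hev]
  rw [← G.sum_incidence_mul fun e p =>
    inner ℂ (w e p) (Matrix.toEuclideanLin (S.Q e p * S.M e p) (w e p))]
  refine Finset.sum_congr rfl fun v _ => ?_
  rw [HypSystem.T, Network.inner_toEuclideanLin_blockDiagonal']
  refine Finset.sum_congr rfl fun e _ => ?_
  have hb : Network.vertexBlock (G.trace v u) e = w e (G.coord e v) := by
    rw [← hev e _ (G.coord_mem e v)]
    rfl
  rw [hb, map_smul, LinearMap.smul_apply, inner_smul_right]

/-- Integration by parts on the network, before any vertex condition is imposed. It serves twice: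
for dissipativity, and for the dimension count, where the functions do not belong to the domain of
$\mathbb A$. -/
lemma exists_abs_network_energy_le : ∃ K, 0 ≤ K ∧ ∀ u : G.Dmax,
    |∑ v, (inner ℂ (G.trace v u) (S.T v (G.trace v u))).re
      - 2 * ∑ e, (inner ℂ ((u : G.L2) e) (S.mulQ e (S.edgeDiff u e))).re|
      ≤ K * ‖(u : G.L2)‖ ^ 2 := by
  choose K hK0 hK using fun e => exists_abs_edge_energy_le (G.len_pos e) (S.lipschitz_M e)
    (S.lipschitz_Q e) (S.bounded_N e) (S.hermitian_QM e)
  refine ⟨∑ e, K e, Finset.sum_nonneg fun e _ => hK0 e, fun u => ?_⟩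
  have h := congrArg Complex.re (S.sum_inner_trace u)
  rw [Complex.re_sum, Complex.re_sum] at h
  rw [h, Finset.mul_sum, ← Finset.sum_sub_distrib, PiLp.norm_sq_eq_of_L2, Finset.sum_mul]
  refine (Finset.abs_sum_le_sum_abs _ _).trans (Finset.sum_le_sum fun e _ => ?_)
  rw [Complex.sub_re]
  refine (hK e (G.edgeH1 e u)).trans ?_
  exact mul_le_mul_of_nonneg_left (Finset.single_le_sum
    (f := fun e => ‖(u : G.L2) e‖ ^ 2) (fun _ _ => by positivity) (Finset.mem_univ e)) (hK0 e)

end HypSystem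

end NetworkEnergy

/-! ### The Hilbert space `L²_d` -/

section Dissipativity

attribute [-instance] WithCStarModule.instCStarModuleComplex

/-- The form attains a positive minimum on the compact unit sphere; homogeneity extends the bound.
-/
lemma exists_le_re_inner_of_pos {F : Type*} [NormedAddCommGroup F] [InnerProductSpace ℂ F]
    [FiniteDimensional ℂ F] (Q : F →ₗ[ℂ] F) (hQ : ∀ x, x ≠ 0 → 0 < (inner ℂ x (Q x)).re) :
    ∃ c, 0 < c ∧ ∀ x, c * ‖x‖ ^ 2 ≤ (inner ℂ x (Q x)).re := by
  rcases subsingleton_or_nontrivial F with hs | hn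
  · refine ⟨1, one_pos, fun x => ?_⟩
    rw [Subsingleton.elim x 0]
    simp
  have : ProperSpace F := FiniteDimensional.proper ℂ F
  have hc : Continuous fun x => (inner ℂ x (Q x)).re :=
    Complex.continuous_re.comp (continuous_id.inner Q.continuous_of_finiteDimensional)
  let _ : NormedSpace ℝ F := NormedSpace.restrictScalars ℝ ℂ F
  obtain ⟨x₀, hx₀, hmin⟩ := (isCompact_sphere (0 : F) 1).exists_isMinOn
    (NormedSpace.sphere_nonempty.2 zero_le_one) hc.continuousOn
  have hx0 : x₀ ≠ 0 := by
    rintro rfl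
    simp at hx₀
  refine ⟨_, hQ x₀ hx0, fun x => ?_⟩
  rcases eq_or_ne x 0 with rfl | hx
  · simp
  have hxn : ‖x‖ ≠ 0 := norm_ne_zero_iff.2 hx
  have h1 : (‖x‖⁻¹ : ℂ) • x ∈ Metric.sphere (0 : F) 1 := by
    rw [mem_sphere_zero_iff_norm, norm_smul]
    simp [hxn]
  have h2 := hmin h1
  simp only [mem_ofPred_eq, map_smul, inner_smul_left, inner_smul_right] at h2
  have h3 : (starRingEnd ℂ) (‖x‖⁻¹ : ℂ) * ((‖x‖⁻¹ : ℂ) * inner ℂ x (Q x)) =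
      ((‖x‖ ^ 2)⁻¹ : ℝ) * inner ℂ x (Q x) := by
    rw [map_inv₀, Complex.conj_ofReal]
    push_cast
    ring
  rw [mul_left_comm, h3, Complex.re_ofReal_mul, ← div_eq_inv_mul, le_div_iff₀ (by positivity)] at h2
  exact h2

variable {V E : Type*} [DecidableEq V] [Fintype V] [Fintype E] [DecidableEq E] {G : Network V E}

namespace VertexConditions
variable (W : VertexConditions G) (S : HypSystem G)

lemma innerD_eq (U U' : W.L2d) : W.innerD S U U' =
    (∑ e, inner ℂ (U'.fst e) (S.mulQ e (U.fst e))) + ∑ v, inner ℂ (U'.snd v) (W.Q v (U.snd v)) := by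
  rw [innerD]
  congr 1
  exact Finset.sum_congr rfl fun e _ => (inner_mulL2_eq _ _ _).symm

lemma norm_sq_eq (U : W.L2d) : ‖U‖ ^ 2 = ‖U.fst‖ ^ 2 + ∑ v, ‖U.snd v‖ ^ 2 := by
  rw [WithLp.prod_norm_sq_eq_of_L2, PiLp.norm_sq_eq_of_L2 (x := U.snd)]

lemma exists_le_re_inner_Q :
    ∃ c, 0 < c ∧ ∀ v (x : W.Yd v), c * ‖x‖ ^ 2 ≤ (inner ℂ x (W.Q v x)).re := by
  choose c hc0 hc using fun v =>
    exists_le_re_inner_of_pos (F := W.Yd v) (W.Q v) (W.posDef_Q v)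
  rcases isEmpty_or_nonempty V with hE | hE
  · exact ⟨1, one_pos, fun v => hE.elim v⟩
  · obtain ⟨v₀, hv₀⟩ := Finite.exists_min c
    exact ⟨c v₀, hc0 v₀, fun v x =>
      (mul_le_mul_of_nonneg_right (hv₀ v) (by positivity)).trans (hc v x)⟩

lemma exists_le_re_innerD : ∃ c, 0 < c ∧ ∀ U : W.L2d, c * ‖U‖ ^ 2 ≤ (W.innerD S U U).re := by
  obtain ⟨a, ha, hSa⟩ := S.exists_le_sum_inner_mulQ
  obtain ⟨b, hb, hWb⟩ := W.exists_le_re_inner_Q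
  refine ⟨min a b, lt_min ha hb, fun U => ?_⟩
  rw [innerD_eq, norm_sq_eq, Complex.add_re, Complex.re_sum, Complex.re_sum, mul_add,
    Finset.mul_sum]
  refine add_le_add ?_ (Finset.sum_le_sum fun v _ => ?_)
  · exact (mul_le_mul_of_nonneg_right (min_le_left a b) (by positivity)).trans (hSa U.fst)
  · exact (mul_le_mul_of_nonneg_right (min_le_right a b) (by positivity)).trans (hWb v _)

lemma exists_norm_vertexMap_le (L : ∀ v, W.Yd v →ₗ[ℂ] W.Yd v) :
    ∃ c, 0 ≤ c ∧ ∀ x : ∀ v, W.Yd v, ∑ v, |(inner ℂ (x v) (L v (x v))).re| ≤ c * ∑ v, ‖x v‖ ^ 2 := by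
  refine ⟨∑ v, ‖(L v).toContinuousLinearMap‖, by positivity, fun x => ?_⟩
  rw [Finset.mul_sum]
  refine Finset.sum_le_sum fun v _ => ?_
  calc _ ≤ ‖x v‖ * ‖L v (x v)‖ := (Complex.abs_re_le_norm _).trans (norm_inner_le_norm _ _)
    _ ≤ ‖x v‖ * (‖(L v).toContinuousLinearMap‖ * ‖x v‖) := by
        gcongr
        exact (L v).toContinuousLinearMap.le_opNorm (x v)
    _ = ‖(L v).toContinuousLinearMap‖ * ‖x v‖ ^ 2 := by ring
    _ ≤ _ := by
        gcongr
        exact Finset.single_le_sum (f := fun v => ‖(L v).toContinuousLinearMap‖)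
          (fun _ _ => by positivity) (Finset.mem_univ v)

lemma exists_re_innerD_le : ∃ C, ∀ U : W.L2d, (W.innerD S U U).re ≤ C * ‖U‖ ^ 2 := by
  choose a ha0 ha using fun e => exists_norm_mulL2_le
    (fun i j => memLp_top_of_lipschitz (S.lipschitz_Q e i j))
  obtain ⟨b, hb, hWb⟩ := W.exists_norm_vertexMap_le W.Q
  refine ⟨(∑ e, a e) + b, fun U => ?_⟩
  have h0 : 0 ≤ ∑ e, a e := Finset.sum_nonneg fun e _ => ha0 e
  have h1 : ∑ e, (inner ℂ (U.fst e) (S.mulQ e (U.fst e))).re ≤ (∑ e, a e) * ‖U.fst‖ ^ 2 := by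
    rw [PiLp.norm_sq_eq_of_L2, Finset.mul_sum]
    refine Finset.sum_le_sum fun e _ => ?_
    calc _ ≤ ‖U.fst e‖ * ‖S.mulQ e (U.fst e)‖ :=
          (Complex.re_le_norm _).trans (norm_inner_le_norm _ _)
      _ ≤ ‖U.fst e‖ * (a e * ‖U.fst e‖) := by
          gcongr
          exact ha e _
      _ = a e * ‖U.fst e‖ ^ 2 := by ring
      _ ≤ _ := by
          gcongr
          exact Finset.single_le_sum (fun e _ => ha0 e) (Finset.mem_univ e)
  have h2 : ∑ v, (inner ℂ (U.snd v) (W.Q v (U.snd v))).re ≤ b * ∑ v, ‖U.snd v‖ ^ 2 :=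
    (Finset.sum_le_sum fun v _ => le_abs_self _).trans (hWb fun v => U.snd v)
  rw [innerD_eq, norm_sq_eq, Complex.add_re, Complex.re_sum, Complex.re_sum]
  have h3 : 0 ≤ ∑ v, ‖U.snd v‖ ^ 2 := by positivity
  nlinarith [mul_nonneg h0 h3, mul_nonneg hb (sq_nonneg ‖U.fst‖)]

/-- The inner product `(·,·)_d` as an inner product in Mathlib's sense. -/
@[reducible] noncomputable def innerDCore : InnerProductSpace.Core ℂ W.L2d where
  -- The arguments are exchanged because $(\cdot,\cdot)_d$ is linear in the first one, whereas
  -- `inner` is linear in the second.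
  inner U U' := W.innerD S U' U
  conj_inner_symm U U' := by
    rw [innerD_eq, innerD_eq, map_add, map_sum, map_sum]
    congr 1
    · refine Finset.sum_congr rfl fun e _ => ?_
      rw [inner_conj_symm]
      exact inner_mulL2_symm _ (S.hermitian_Q e) _ _
    · refine Finset.sum_congr rfl fun v _ => ?_
      rw [inner_conj_symm, W.symmetric_Q]
  re_inner_nonneg U := by
    obtain ⟨c, hc, h⟩ := W.exists_le_re_innerD S
    exact le_trans (by positivity) (h U)
  add_left U U' U'' := by
    simp only [innerD_eq]
    have h1 : (U + U').fst = U.fst + U'.fst := rfl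
    have h2 : (U + U').snd = U.snd + U'.snd := rfl
    simp only [h1, h2, PiLp.add_apply, inner_add_left, Finset.sum_add_distrib]
    ring
  smul_left U U' c := by
    simp only [innerD_eq]
    have h1 : (c • U).fst = c • U.fst := rfl
    have h2 : (c • U).snd = c • U.snd := rfl
    rw [h1, h2, mul_add, Finset.mul_sum, Finset.mul_sum]
    exact congrArg₂ _ (Finset.sum_congr rfl fun e _ => inner_smul_left _ _ _)
      (Finset.sum_congr rfl fun v _ =>
        inner_smul_left (𝕜 := ℂ) (E := W.Yd v) (U.snd v) (W.Q v (U'.snd v)) c)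
  definite U hU := by
    obtain ⟨c, hc, h⟩ := W.exists_le_re_innerD S
    have h1 := h U
    rw [hU, Complex.zero_re] at h1
    exact norm_eq_zero.1 (pow_eq_zero_iff two_ne_zero |>.1
      (le_antisymm (nonpos_of_mul_nonpos_right h1 hc) (sq_nonneg _)))

/-! ### Dissipativity -/

lemma inner_coe_eq_inner_P (v : V) (ξ : G.VertexSpace v) (y : W.Yd v) :
    inner ℂ ξ (y : G.VertexSpace v) = inner ℂ (W.P v ξ) y :=
  (Submodule.inner_orthogonalProjectionOnto_eq_of_mem_right y ξ).symm

/-- The terms with $Q_vB_v$ and $B_v^*Q_v$ are complex conjugates, since $Q_v$ is symmetric, so the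
real part of the null identity contains twice one of them. -/
lemma re_inner_T_add_of_isNull {v : V} {lam : ℝ} (h : W.IsNull S v lam) (ξ : W.Y v) :
    (inner ℂ (ξ : G.VertexSpace v) (S.T v ξ)).re +
      2 * (inner ℂ (W.P v ξ) (W.Q v (W.B v ξ))).re =
        lam * (inner ℂ (W.P v ξ) (W.Q v (W.P v ξ))).re := by
  have h1 := congrArg Complex.re (h ξ)
  simp only [formOp, LinearMap.sub_apply, LinearMap.add_apply, LinearMap.smul_apply,
    LinearMap.comp_apply, Submodule.subtype_apply, inner_sub_right, inner_add_right,
    inner_smul_right, inner_coe_eq_inner_P] at h1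
  have h2 : inner ℂ (ξ : G.VertexSpace v) (W.Bstar v (W.Q v (W.P v ξ)) : G.VertexSpace v) =
      (starRingEnd ℂ) (inner ℂ (W.P v ξ) (W.Q v (W.B v ξ))) := by
    rw [← Submodule.coe_inner, Bstar, LinearMap.adjoint_inner_right, inner_conj_symm,
      W.symmetric_Q]
  rw [h2, Complex.sub_re, Complex.add_re, Complex.add_re, Complex.conj_re,
    Complex.re_ofReal_mul, Complex.zero_re] at h1
  linarith

lemma innerD_opA (U : W.domA) : W.innerD S (W.opA S U) U =
    (∑ e, inner ℂ ((W.fstA U : G.L2) e) (S.mulQ e (S.edgeDiff (W.fstA U) e))) +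
      ∑ v, inner ℂ ((U : W.L2d).snd v) (W.Q v (W.B v (W.traceA v U) + W.C v ((U : W.L2d).snd v))) :=
  innerD_eq W S _ _

lemma snd_eq_P_traceA (U : W.domA) (v : V) :
    (U : W.L2d).snd v = W.P v (W.traceA v U : G.VertexSpace v) := (U.2.choose_spec v).2

/-- The arithmetic of the energy estimate. Here $r$ is the edge term, $s$ and $w$ are the
contributions of $B$ and $C$, $t$ is the $\lambda$-term, $p=\|u\|^2$ and $q=\sum_v\|x_v\|^2$. The
first bound contains $-2(r+s)+t$, so $r+s$ is controlled although $r$ and $s$ separately are not. -/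
lemma abs_energy_le_of_abs_le {K a b p q r s t w : ℝ} (hK : 0 ≤ K) (ha : 0 ≤ a) (hb : 0 ≤ b)
    (hp : 0 ≤ p) (hq : 0 ≤ q) (h1 : |(t - 2 * s) - 2 * r| ≤ K * p) (h2 : |t| ≤ a * q)
    (h3 : |w| ≤ b * q) : |r + (s + w)| ≤ (K + a + 2 * b) * (p + q) := by
  have q1 := mul_nonneg hK hq
  have q2 := mul_nonneg ha hp
  have q3 := mul_nonneg hb hp
  have q4 := mul_nonneg hK hp
  have q5 := mul_nonneg ha hq
  have q6 := mul_nonneg hb hq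
  rw [abs_le] at h1 h2 h3 ⊢
  constructor <;> linarith [h1.1, h1.2, h2.1, h2.2, h3.1, h3.2]

/-- By the null condition the boundary form at $v$ is the $\lambda$-term minus twice the $B_v$-term;
the latter cancels the $B_v$-term of $\mathbb A$, and everything left is of order zero. Dividing by
the coercivity constant $c$ expresses the bound in the norm of $(\cdot,\cdot)_d$. -/
lemma exists_abs_re_innerD_opA_le (hY : ∀ v, ∃ lam : ℝ, 0 ≤ lam ∧ W.IsNull S v lam) :
    ∃ κ, 0 ≤ κ ∧ ∀ U : W.domA,
      |(W.innerD S (W.opA S U) U).re| ≤ κ * (W.innerD S (U : W.L2d) U).re := by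
  choose lam hlam hnull using hY
  obtain ⟨K, hK, hE⟩ := S.exists_abs_network_energy_le
  obtain ⟨a, ha, hWa⟩ := W.exists_norm_vertexMap_le fun v => (lam v : ℂ) • W.Q v
  obtain ⟨b, hb, hWb⟩ := W.exists_norm_vertexMap_le fun v => W.Q v ∘ₗ W.C v
  obtain ⟨c, hc, hlow⟩ := W.exists_le_re_innerD S
  refine ⟨(K + a + 2 * b) / c, by positivity, fun U => ?_⟩
  have h1 := hE (W.fstA U)
  set x := fun v => (U : W.L2d).snd v with hx
  have h2 := (Finset.abs_sum_le_sum_abs (fun v => (inner ℂ (x v) (((lam v : ℂ) • W.Q v) (x v))).re)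
    Finset.univ).trans (hWa x)
  have h3 := (Finset.abs_sum_le_sum_abs (fun v => (inner ℂ (x v) ((W.Q v ∘ₗ W.C v) (x v))).re)
    Finset.univ).trans (hWb x)
  have h4 : ∀ v, (inner ℂ (G.trace v (W.fstA U)) (S.T v (G.trace v (W.fstA U)))).re =
      (inner ℂ (x v) (((lam v : ℂ) • W.Q v) (x v))).re -
        2 * (inner ℂ (x v) (W.Q v (W.B v (W.traceA v U)))).re := fun v => by
    have := W.re_inner_T_add_of_isNull S (hnull v) (W.traceA v U)
    rw [← W.snd_eq_P_traceA U v] at this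
    have h := congrArg Complex.re (inner_smul_right (x v) (W.Q v (x v)) (lam v : ℂ))
    rw [Complex.re_ofReal_mul] at h
    rw [LinearMap.smul_apply, h]
    exact eq_sub_of_add_eq this
  have h5 := W.norm_sq_eq (U : W.L2d)
  have h6 : (W.innerD S (W.opA S U) U).re =
      (∑ e, (inner ℂ ((W.fstA U : G.L2) e) (S.mulQ e (S.edgeDiff (W.fstA U) e))).re) +
        ((∑ v, (inner ℂ (x v) (W.Q v (W.B v (W.traceA v U)))).re) +
          ∑ v, (inner ℂ (x v) ((W.Q v ∘ₗ W.C v) (x v))).re) := by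
    rw [innerD_opA, Complex.add_re, Complex.re_sum, Complex.re_sum, ← Finset.sum_add_distrib]
    simp only [map_add, inner_add_right, Complex.add_re, LinearMap.comp_apply, hx]
  simp only [h4, Finset.sum_sub_distrib, ← Finset.mul_sum] at h1
  have h7 : |(W.innerD S (W.opA S U) U).re| ≤ (K + a + 2 * b) * ‖(U : W.L2d)‖ ^ 2 := by
    rw [h6, h5]
    refine abs_energy_le_of_abs_le hK ha hb (by positivity) (by positivity) h1 h2 h3
  refine h7.trans ?_
  rw [div_mul_eq_mul_div, le_div_iff₀ hc, mul_assoc]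
  refine mul_le_mul_of_nonneg_left ?_ (by positivity)
  rw [mul_comm]
  exact hlow U

end VertexConditions
end Dissipativity

/-! ### The range condition -/

section RangeCondition

attribute [-instance] WithCStarModule.instCStarModuleComplex

variable {V E : Type*} {G : Network V E}

/-- Solutions of the homogeneous equation take all initial values, so a linear right inverse of the
initial-value map can be chosen on them. Uniqueness of solutions plays no role. -/
lemma HypSystem.exists_initialValue_section (S : HypSystem G) (z : ℂ) :
    ∃ s : (∀ e, EuclideanSpace ℂ (Fin (G.dim e))) →ₗ[ℂ] G.Dmax,
      ∀ a, z • (s a : G.L2) - S.edgeDiff (s a) = 0 ∧ G.initialValue (s a) = a := by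
  let N := LinearMap.ker (z • G.Dmax.subtype - S.edgeDiff)
  obtain ⟨r, hr⟩ := (G.initialValue.domRestrict N).exists_rightInverse_of_surjective
    (LinearMap.range_eq_top.2 fun a => by
      obtain ⟨u, hu, hu0⟩ := S.exists_edgeDiff_eq z 0 a
      exact ⟨⟨u, hu⟩, hu0⟩)
  exact ⟨N.subtype ∘ₗ r, fun a => ⟨(r a).2, LinearMap.congr_fun hr a⟩⟩

variable [DecidableEq V] [Fintype V] [Fintype E]

/-- Every edge is counted once at each of its two distinct endpoints. -/
lemma Network.sum_finrank_vertexSpace (G : Network V E) :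
    ∑ v, Module.finrank ℂ (G.VertexSpace v) = 2 * ∑ e, G.dim e := by
  have h1 : ∀ v, Module.finrank ℂ (G.VertexSpace v) =
      ∑ e, ((if G.src e = v then G.dim e else 0) + if G.tgt e = v then G.dim e else 0) :=
    fun v => by
    rw [finrank_euclideanSpace, Fintype.card_sigma]
    simp only [Fintype.card_fin]
    rw [← Finset.sum_subtype (Finset.univ.filter fun e => G.src e = v ∨ G.tgt e = v) (by simp)
      (fun e => G.dim e), Finset.sum_filter]
    refine Finset.sum_congr rfl fun e _ => ?_
    have := G.src_ne_tgt e
    by_cases h : G.src e = v <;> by_cases h' : G.tgt e = v <;> simp_all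
  simp only [h1]
  rw [Finset.sum_comm, Finset.mul_sum]
  refine Finset.sum_congr rfl fun e _ => ?_
  rw [Finset.sum_add_distrib]
  simp [two_mul]

variable [DecidableEq E]

namespace VertexConditions
variable (W : VertexConditions G) (S : HypSystem G)

lemma innerD_add_left (x y w : W.L2d) :
    W.innerD S (x + y) w = W.innerD S x w + W.innerD S y w := by
  have h1 : (x + y).fst = x.fst + y.fst := rfl
  have h2 : (x + y).snd = x.snd + y.snd := rfl
  simp only [innerD_eq, h1, h2, PiLp.add_apply, map_add, inner_add_right, Finset.sum_add_distrib]
  ring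

lemma innerD_smul_left (c : ℂ) (x w : W.L2d) : W.innerD S (c • x) w = c * W.innerD S x w := by
  have h1 : (c • x).fst = c • x.fst := rfl
  have h2 : (c • x).snd = c • x.snd := rfl
  rw [innerD_eq, innerD_eq, h1, h2, mul_add, Finset.mul_sum, Finset.mul_sum]
  refine congrArg₂ _ (Finset.sum_congr rfl fun e _ => ?_) (Finset.sum_congr rfl fun v _ => ?_)
  · rw [PiLp.smul_apply, map_smul, inner_smul_right]
  · rw [PiLp.smul_apply, map_smul]
    exact inner_smul_right (𝕜 := ℂ) (E := W.Yd v) (w.snd v) (W.Q v (x.snd v)) c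

/-- The hypothesis says $(\xi,0)\in\mathbb Y_v^*$, and on such vectors the form reduces to
$-(T_v\xi,\xi)-2\mu\|\xi\|^2=0$. -/
lemma re_inner_T_nonpos_of_isAdjNull {v : V} {mu : ℝ} (hmu : 0 ≤ mu) (h : W.IsAdjNull S v mu)
    {ξ : G.VertexSpace v} (hξ : W.PPerp v (S.T v ξ) = 0) : (inner ℂ ξ (S.T v ξ)).re ≤ 0 := by
  have h1 := congrArg Complex.re (h (ξ, 0) (by simp [adjY, hξ]))
  have h2 : inner ℂ (0 : W.Yd v) (W.adjOpSnd S v mu (ξ, 0)) = 0 :=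
    inner_zero_left (E := W.Yd v) _
  simp only [h2, adjOpFst, LinearMap.coprod_apply, map_zero, add_zero, LinearMap.sub_apply,
    LinearMap.neg_apply, LinearMap.smul_apply, LinearMap.id_apply, inner_sub_right,
    inner_neg_right, inner_smul_right, Complex.zero_re, Complex.sub_re, Complex.neg_re] at h1
  rw [inner_self_eq_norm_sq_to_K] at h1
  have h3 : ((2 * mu : ℂ) * ((‖ξ‖ : ℂ)) ^ 2).re = 2 * mu * ‖ξ‖ ^ 2 := by
    rw [← Complex.ofReal_re (2 * mu * ‖ξ‖ ^ 2)]
    push_cast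
    rfl
  have h4 : 0 ≤ 2 * mu * ‖ξ‖ ^ 2 := by positivity
  have h5 := h3 ▸ h1
  linarith [h5]

/-- For $z$ large, the map from initial values to $P_v^{(d),\perp}T_v\gamma_v(u)$, $u$ the chosen
homogeneous solution, is injective. On its kernel the boundary form is nonpositive, so the energy
estimate gives $2z\sum_e(Q_eu_e,u_e)\le K\|u\|^2$, which forces $u=0$. -/
lemma sum_dim_le_sum_finrank_YdPerp (hYstar : ∀ v, ∃ mu : ℝ, 0 ≤ mu ∧ W.IsAdjNull S v mu) :
    ∑ e, G.dim e ≤ ∑ v, Module.finrank ℂ (W.YdPerp v) := by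
  choose mu hmu hnull using hYstar
  obtain ⟨K, hK, hE⟩ := S.exists_abs_network_energy_le
  obtain ⟨c, hc, hlow⟩ := S.exists_le_sum_inner_mulQ
  -- With $c$ the lower bound of the $Q_e$, this gives $2z\sum_e(Q_eu_e,u_e)\ge2(K+1)\|u\|^2$, which
  -- beats the error $K\|u\|^2$.
  set z : ℝ := (K + 1) / c with hz
  obtain ⟨s, hs⟩ := S.exists_initialValue_section z
  let L : (∀ e, EuclideanSpace ℂ (Fin (G.dim e))) →ₗ[ℂ] ∀ v, W.YdPerp v :=
    LinearMap.pi fun v => W.PPerp v ∘ₗ S.T v ∘ₗ G.trace v ∘ₗ s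
  have hinj : Function.Injective L := by
    refine (injective_iff_map_eq_zero L).2 fun a ha => ?_
    obtain ⟨h1, h2⟩ := hs a
    have h3 : ∑ v, (inner ℂ (G.trace v (s a)) (S.T v (G.trace v (s a)))).re ≤ 0 :=
      Finset.sum_nonpos fun v _ =>
        W.re_inner_T_nonpos_of_isAdjNull S (hmu v) (hnull v) (congrFun ha v)
    have h4 := (abs_le.1 (hE (s a))).1
    have h5 := hlow (s a)
    have h6 : ∑ e, (inner ℂ ((s a : G.L2) e) (S.mulQ e (S.edgeDiff (s a) e))).re =
        z * ∑ e, (inner ℂ ((s a : G.L2) e) (S.mulQ e ((s a : G.L2) e))).re := by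
      rw [Finset.mul_sum]
      refine Finset.sum_congr rfl fun e _ => ?_
      rw [← sub_eq_zero.1 h1, PiLp.smul_apply, map_smul, inner_smul_right, Complex.re_ofReal_mul]
    have h7 : z * (c * ‖(s a : G.L2)‖ ^ 2) ≤ z * _ := mul_le_mul_of_nonneg_left h5 (by positivity)
    have h8 : z * (c * ‖(s a : G.L2)‖ ^ 2) = (K + 1) * ‖(s a : G.L2)‖ ^ 2 := by
      rw [hz]
      field_simp
    rw [h6] at h4
    have h9 : ‖(s a : G.L2)‖ ^ 2 ≤ 0 := by
      have := mul_nonneg hK (sq_nonneg ‖(s a : G.L2)‖)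
      linarith [sq_nonneg ‖(s a : G.L2)‖]
    have h10 : s a = 0 := Subtype.ext (norm_eq_zero.1 (pow_eq_zero_iff two_ne_zero |>.1
      (le_antisymm h9 (sq_nonneg _))))
    rw [← h2, h10, map_zero]
  have := LinearMap.finrank_le_finrank_of_injective hinj
  simpa [Module.finrank_pi_fintype] using this

/-- For `u ∈ D_max`, the component of `γ_v(u)` orthogonal to `Y_v`, and the vertex component of
`(z - 𝔸) (u, P γ(u))`. -/
noncomputable def vertexResidual (z : ℂ) : G.Dmax →ₗ[ℂ] ∀ v, ((W.Y v)ᗮ : Submodule ℂ _) × W.Yd v :=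
  LinearMap.pi fun v =>
    (LinearMap.prod ((W.Y v)ᗮ.orthogonalProjectionOnto).toLinearMap
      (z • W.P v - W.B v ∘ₗ ((W.Y v).orthogonalProjectionOnto).toLinearMap - W.C v ∘ₗ W.P v)) ∘ₗ
        G.trace v

/-- Vanishing of the first residual puts the trace in $Y_v^{\perp\perp}=Y_v$. The projection onto
$Y_v$, inserted before $B_v$ to define the residual on all of $D_{\max}$, then acts as the identity.
-/
lemma exists_smul_sub_opA_eq {z : ℂ} {u : G.Dmax} {f : G.L2} {ψ : ∀ v, W.Yd v}
    (hf : z • (u : G.L2) - S.edgeDiff u = f) (hψ : W.vertexResidual z u = fun v => (0, ψ v)) :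
    ∃ U : W.domA, W.fstA U = u ∧
      z • (U : W.L2d) - W.opA S U = WithLp.toLp 2 (f, WithLp.toLp 2 ψ) := by
  have hmem : ∀ v, G.trace v u ∈ W.Y v := fun v => by
    have h := congrArg Prod.fst (congrFun hψ v)
    rw [← (W.Y v).orthogonal_orthogonal]
    exact Submodule.orthogonalProjectionOnto_eq_zero_iff.1 h
  let U : W.domA := ⟨WithLp.toLp 2 ((u : G.L2), WithLp.toLp 2 fun v => W.P v (G.trace v u)),
    u.2, fun v => ⟨hmem v, rfl⟩⟩
  refine ⟨U, rfl, ?_⟩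
  refine (WithLp.equiv 2 _).injective (Prod.ext hf ?_)
  change (z • (U : W.L2d) - W.opA S U).snd = _
  ext1 v
  have h := congrArg Prod.snd (congrFun hψ v)
  have h1 : (W.Y v).orthogonalProjectionOnto (G.trace v u) = W.traceA v U :=
    Submodule.orthogonalProjectionOnto_mem_subspace_eq_self (W.traceA v U)
  change z • W.P v (G.trace v u) - W.B v ((W.Y v).orthogonalProjectionOnto (G.trace v u)) -
    W.C v (W.P v (G.trace v u)) = ψ v at h
  rw [h1] at h
  change z • W.P v (G.trace v u) - (W.B v (W.traceA v U) + W.C v (W.P v (G.trace v u))) = ψ v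
  rw [← sub_sub, h]

/-- $\mathbb C^{k_v}$ splits into $Y_v^\perp$, $Y_v^{(d)}$ and the complement of $Y_v^{(d)}$ in
$Y_v$. The total dimension is $2k$ and the third pieces take up at least $k$ of it. -/
lemma finrank_residual_le (hYstar : ∀ v, ∃ mu : ℝ, 0 ≤ mu ∧ W.IsAdjNull S v mu) :
    Module.finrank ℂ (∀ v, ((W.Y v)ᗮ : Submodule ℂ _) × W.Yd v) ≤ ∑ e, G.dim e := by
  have h1 := W.sum_dim_le_sum_finrank_YdPerp S hYstar
  have h2 := G.sum_finrank_vertexSpace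
  have h3 : ∀ v, Module.finrank ℂ (G.VertexSpace v) = (Module.finrank ℂ ((W.Y v)ᗮ : Submodule ℂ _) +
      Module.finrank ℂ (W.Yd v)) + Module.finrank ℂ (W.YdPerp v) := fun v => by
    have a := (W.Y v).finrank_add_finrank_orthogonal
    have b := Submodule.finrank_add_inf_finrank_orthogonal (W.Yd_le v)
    rw [inf_comm] at b
    have b' : Module.finrank ℂ (W.Yd v) + Module.finrank ℂ (W.YdPerp v) =
      Module.finrank ℂ (W.Y v) := b
    omega
  simp only [h3] at h2
  rw [Finset.sum_add_distrib] at h2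
  simp only [Module.finrank_pi_fintype, Module.finrank_prod]
  omega

/-- A homogeneous solution with zero residual is an eigenvector of $\mathbb A$ for $z$ or zero, and
$|z|>\kappa$ excludes the former. Hence the residual map on initial values is injective into a space
of dimension at most $k$, and so bijective. -/
lemma exists_smul_sub_opA_eq_of_lt {κ : ℝ}
    (hκ : ∀ U : W.domA, |(W.innerD S (W.opA S U) U).re| ≤ κ * (W.innerD S (U : W.L2d) U).re)
    (hYstar : ∀ v, ∃ mu : ℝ, 0 ≤ mu ∧ W.IsAdjNull S v mu) {z : ℝ} (hz : κ < |z|) (F : W.L2d) :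
    ∃ U : W.domA, (z : ℂ) • (U : W.L2d) - W.opA S U = F := by
  obtain ⟨s, hs⟩ := S.exists_initialValue_section z
  have hinj : Function.Injective (W.vertexResidual z ∘ₗ s) := by
    refine (injective_iff_map_eq_zero _).2 fun a ha => ?_
    obtain ⟨h1, h2⟩ := hs a
    obtain ⟨U, hU, hUz⟩ := W.exists_smul_sub_opA_eq S (ψ := 0) h1 ha
    have h3 : W.opA S U = (z : ℂ) • (U : W.L2d) := (sub_eq_zero.1 hUz).symm
    have h4 := hκ U
    obtain ⟨c, hc, hlow⟩ := W.exists_le_re_innerD S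
    have h5 : W.innerD S ((z : ℂ) • (U : W.L2d)) U = z * W.innerD S (U : W.L2d) U :=
      W.innerD_smul_left S _ _ _
    rw [h3, h5, Complex.re_ofReal_mul, abs_mul] at h4
    have h6 := hlow U
    have h7 : 0 ≤ (W.innerD S (U : W.L2d) U).re := le_trans (by positivity) h6
    rw [abs_of_nonneg h7] at h4
    have h8 : (W.innerD S (U : W.L2d) U).re = 0 := by
      by_contra hne
      exact absurd (le_of_mul_le_mul_right h4 (lt_of_le_of_ne h7 (Ne.symm hne))) (not_le.2 hz)
    rw [h8] at h6
    have h9 : U = 0 := Subtype.ext (norm_eq_zero.1 (pow_eq_zero_iff two_ne_zero |>.1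
      (le_antisymm (nonpos_of_mul_nonpos_right h6 hc) (sq_nonneg _))))
    rw [← h2, ← hU, h9, map_zero, map_zero]
  have hfin : Module.finrank ℂ (∀ e, EuclideanSpace ℂ (Fin (G.dim e))) = ∑ e, G.dim e := by
    simp [Module.finrank_pi_fintype]
  have hsurj : Function.Surjective (W.vertexResidual z ∘ₗ s) :=
    (LinearMap.injective_iff_surjective_of_finrank_eq_finrank (le_antisymm
      (LinearMap.finrank_le_finrank_of_injective hinj)
      (hfin ▸ W.finrank_residual_le S hYstar))).1 hinj
  -- A particular solution on the edges; its initial value $0$ is arbitrary, and its wrong residual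
  -- is then corrected by a homogeneous solution.
  obtain ⟨u, hu, -⟩ := S.exists_edgeDiff_eq z F.fst 0
  obtain ⟨a, ha⟩ := hsurj ((fun v => (0, F.snd v)) - W.vertexResidual z u)
  obtain ⟨U, -, hU⟩ := W.exists_smul_sub_opA_eq S (z := z) (u := u + s a) (f := F.fst)
    (ψ := F.snd) (by
      rw [Submodule.coe_add, smul_add, map_add, add_sub_add_comm, hu, (hs a).1, add_zero])
    (by rw [map_add]; exact (congrArg _ ha).trans (add_sub_cancel _ _))
  exact ⟨U, hU⟩

end VertexConditions
end RangeCondition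

/-! ### Quasi-$m$-dissipativity and conclusion -/

section MDissipative

variable {H : Type*} [NormedAddCommGroup H] [NormedSpace ℂ H]

/-- The shift is $\omega=\kappa$, since $c-(A-\kappa)=(c+\kappa)-A$ and $c+\kappa>\kappa$. -/
lemma isQuasiMDissipative_of_le {ip : H → H → ℂ} {A : H →ₗ.[ℂ] H} {κ : ℝ}
    (hip : ∀ (c : ℝ) x y w, ip (x - (c : ℂ) • y) w = ip x w - c * ip y w)
    (hdis : ∀ u : A.domain, (ip (A u) u).re ≤ κ * (ip (u : H) u).re)
    (hsurj : ∀ z : ℝ, κ < z → ∀ f, ∃ u : A.domain, (z : ℂ) • (u : H) - A u = f) :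
    IsQuasiMDissipative ip A := by
  refine ⟨κ, fun u => ?_, fun c hc f => ?_⟩
  · change (ip (A u - (κ : ℂ) • (u : H)) u).re ≤ 0
    rw [hip, Complex.sub_re, Complex.re_ofReal_mul]
    exact sub_nonpos.2 (hdis u)
  · obtain ⟨u, hu⟩ := hsurj (c + κ) (by linarith) f
    refine ⟨u, ?_⟩
    change (c : ℂ) • (u : H) - (A u - (κ : ℂ) • (u : H)) = f
    rw [← hu]
    push_cast
    module

end MDissipative

end NetworkDyn


theorem mainTheorem4 {V E : Type*} [Fintype V] [DecidableEq V] [Fintype E] [DecidableEq E]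
    (G : NetworkDyn.Network V E) (S : NetworkDyn.HypSystem G)
    (W : NetworkDyn.VertexConditions G)
    (hY : ∀ v, ∃ lam : ℝ, 0 ≤ lam ∧ W.IsNull S v lam)
    (hYstar : ∀ v, ∃ mu : ℝ, 0 ≤ mu ∧ W.IsAdjNull S v mu) :
    NetworkDyn.IsQuasiMDissipative (W.innerD S) (W.opA S) ∧
      NetworkDyn.IsQuasiMDissipative (W.innerD S) (-W.opA S) ∧
      NetworkDyn.GeneratesC0Group (W.opA S) := by
  obtain ⟨κ, hκ0, hκ⟩ := W.exists_abs_re_innerD_opA_le S hY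
  obtain ⟨c, hc, hlow⟩ := W.exists_le_re_innerD S
  obtain ⟨C, hup⟩ := W.exists_re_innerD_le S
  have hsurj := fun z hz => W.exists_smul_sub_opA_eq_of_lt S hκ hYstar (z := z) hz
  have hip : ∀ (c : ℝ) x y w,
      W.innerD S (x - (c : ℂ) • y) w = W.innerD S x w - c * W.innerD S y w :=
    fun c x y w => by
    rw [sub_eq_add_neg, ← neg_smul, W.innerD_add_left, W.innerD_smul_left, neg_mul, sub_eq_add_neg]
  have hneg : ∀ x y, W.innerD S (-x) y = -W.innerD S x y := fun x y => by
    rw [← neg_one_smul ℂ x, W.innerD_smul_left, neg_one_mul]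
  refine ⟨NetworkDyn.isQuasiMDissipative_of_le hip (fun U => (le_abs_self _).trans (hκ U))
      fun z hz => hsurj z (hz.trans_le (le_abs_self z)),
    NetworkDyn.isQuasiMDissipative_of_le (κ := κ) hip (fun U => ?_) fun z hz F => ?_,
    NetworkDyn.generatesC0Group_of_core (W.innerDCore S) hc hlow hup hκ0 (fun U => ?_) hsurj⟩
  · change (W.innerD S (-(W.opA S U)) (U : W.L2d)).re ≤ _
    rw [hneg, Complex.neg_re]
    exact (neg_le_abs _).trans (hκ U)
  -- $(z+\mathbb A)U=F$ is $(-z-\mathbb A)U=-F$, which is covered because the range condition holds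
  -- for all $|z|>\kappa$.
  · obtain ⟨U, hU⟩ := hsurj (-z) (by rw [abs_neg]; exact hz.trans_le (le_abs_self z)) (-F)
    refine ⟨U, ?_⟩
    change (z : ℂ) • (U : W.L2d) - -(W.opA S U) = F
    rw [← neg_neg F, ← hU]
    push_cast
    module
  -- The exchanged arguments in `innerDCore` produce the conjugate, which has the same real part.
  · have h : W.innerD S (U : W.L2d) (W.opA S U) =
        (starRingEnd ℂ) (W.innerD S (W.opA S U) U) :=
      ((W.innerDCore S).conj_inner_symm _ _).symm
    change |(W.innerD S (U : W.L2d) (W.opA S U)).re| ≤ κ * (W.innerD S (U : W.L2d) U).re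
    rw [h, Complex.conj_re]
    exact hκ U
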